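/- Let $\Omega$ be a finite set of cardinality $d\ge 3$, let $T_d$ be the $d$-regular tree, and fix a colouring of its edges by $\Omega$ such that distinct edges sharing a vertex have different colours. For $g\in\mathrm{Aut}(T_d)$ and a vertex $v$, let $\sigma(g,v)\in\mathrm{Sym}(\Omega)$ be the permutation of colours induced by $g$ from the star of $v$ to the star of $g(v)$. Let $F\le F'\le \mathrm{Sym}(\Omega)$ be permutation groups such that $F'$ preserves every $F$-orbit in $\Omega$, and let $G(F,F')$ be the (discrete) group of all $g\in\mathrm{Aut}(T_d)$ with $\sigma(g,v)\in F'$ for all vertices $v$ and $\sigma(g,v)\in F$ for all but finitely many $v$. For a countable discrete group $\Gamma$, a compact $\Gamma$-space is a non-empty compact Hausdorff space on which $\Gamma$ acts by homeomorphisms. It is minimal if all orbits are dense, non-trivial if it has more than one point, and it is a $\Gamma$-boundary if it is minimal and the weak-* closure of the $\Gamma$-orbit of every regular Borel probability measure on it contains a Dirac measure. The Furstenberg boundary of $\Gamma$ is the $\Gamma$-boundary, unique up to isomorphism, that admits a continuous equivariant surjection onto every $\Gamma$-boundary. For a minimal compact $\Gamma$-space $X$, the stabilizer URS $\mathcal S_\Gamma(X)$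 is the closure, in the space $\mathrm{Sub}(\Gamma)$ of subgroups of $\Gamma$ with the Chabauty topology, of the set of stabilizers $\Gamma_x$ of those points $x\in X$ at which the map $y\mapsto\Gamma_y$ is continuous. Let $\mathcal A_\Gamma$ be the stabilizer URS of the Furstenberg boundary of $\Gamma$, and let $\mathrm{Env}(\mathcal A_\Gamma)$ be the subgroup (which is normal) generated by all $H\in\mathcal A_\Gamma$. A subgroup $L\le\Gamma$ is co-amenable if every compact convex subset of a Hausdorff locally convex real vector space, with an action of $\Gamma$ by affine homeomorphisms for which $L$ fixes a point, contains a point fixed by $\Gamma$. Two compact $\Gamma$-spaces $X,Y$ are disjoint if for every compact $\Gamma$-space $W$ and all continuous equivariant surjections $p:W\to X$, $q:W\to Y$, the map $(p,q):W\to X\times Y$ is surjective. The group $\Gamma$ is boundary indivisible if two non-trivial $\Gamma$-boundaries are never disjoint. Theorem. Assume that $F$ is semi-regular (that is, acts freely on $\Omega$) and $F\ne F'$, and write $\Gamma=G(F,F')$. The following are equivalent: (i) the subgroup of $F'$ generated by its point stabilizers has at most two orbits in $\Omega$; (ii) $\Gamma/\mathrm{Env}(\mathcal A_\Gamma)$ is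 isomorphic to one of $C_2$, $D_\infty$, or a semidirect product $D_\infty\rtimes C_2$; (iii) $\mathrm{Env}(\mathcal A_\Gamma)$ is co-amenable in $\Gamma$; (iv) $\mathcal S_\Gamma(X)=\mathcal A_\Gamma$ for every non-trivial $\Gamma$-boundary $X$; (v) $\Gamma$ is boundary indivisible. -/

import Mathlib

universe u v

/-! ### Compact `G`-spaces and boundaries, for a discrete group `G` -/

/-- `X` is a compact `G`-space: a non-empty compact Hausdorff space on which the discrete group `G`
acts by homeomorphisms. -/
structure IsCompactGSpace (G : Type*) [Group G] (X : Type*) [TopologicalSpace X] [MulAction G X] :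
    Prop where
  nonempty : Nonempty X
  compact : CompactSpace X
  t2 : T2Space X
  continuous_smul : ContinuousConstSMul G X

/-- The function on `C(X, ℝ)` given by integration against a measure. The weak-* topology on
measures is the one pulled back from the product topology on `C(X, ℝ) → ℝ` along this map. -/
noncomputable def integralFunctional {X : Type*} [TopologicalSpace X] [MeasurableSpace X]
    (μ : MeasureTheory.Measure X) : C(X, ℝ) → ℝ :=
  fun f => ∫ x, f x ∂μ

/-- Strong proximality: the weak-* closure of the `G`-orbit of every regular Borel probability
measure on `X` contains a Dirac measure. -/
def IsStronglyProximal (G : Type*) [Group G] (X : Type*) [TopologicalSpace X] [MulAction G X] :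
    Prop :=
  letI : MeasurableSpace X := borel X
  ∀ μ : MeasureTheory.Measure X, MeasureTheory.IsProbabilityMeasure μ → μ.Regular →
    ∃ x : X, integralFunctional (MeasureTheory.Measure.dirac x) ∈
      closure (Set.range fun g : G => integralFunctional (μ.map fun y => g • y))

/-- A `G`-boundary: a compact `G`-space that is minimal (all orbits are dense) and strongly
proximal. -/
structure IsBoundary (G : Type*) [Group G] (X : Type*) [TopologicalSpace X] [MulAction G X] :
    Prop extends IsCompactGSpace G X where
  minimal : MulAction.IsMinimal G X
  stronglyProximal : IsStronglyProximal G X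

/-- A factor map of `G`-spaces: a continuous equivariant surjection. -/
structure IsFactorMap (G : Type*) [Group G] {X Y : Type*} [TopologicalSpace X] [MulAction G X]
    [TopologicalSpace Y] [MulAction G Y] (f : X → Y) : Prop where
  continuous : Continuous f
  surjective : Function.Surjective f
  map_smul : ∀ (g : G) (x : X), f (g • x) = g • f x

/-- `B` is the Furstenberg boundary of `G`: a `G`-boundary that factors onto every `G`-boundary.
(By density of orbits, a boundary of a group in `Type u` has a copy in `Type u`, so testing
against boundaries in `Type u` is no restriction.) -/
structure IsFurstenbergBoundary (G : Type u) [Group G] (B : Type u) [TopologicalSpace B]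
    [MulAction G B] : Prop extends IsBoundary G B where
  universal : ∀ (X : Type u) [TopologicalSpace X] [MulAction G X], IsBoundary G X →
    ∃ f : B → X, IsFactorMap G f

/-- Two compact `G`-spaces `X`, `Y` are disjoint if for every compact `G`-space `W` with factor maps
`p : W → X` and `q : W → Y`, the map `(p, q) : W → X × Y` is surjective. -/
def AreDisjointSpaces (G : Type u) [Group G] (X Y : Type u) [TopologicalSpace X] [MulAction G X]
    [TopologicalSpace Y] [MulAction G Y] : Prop :=
  ∀ (W : Type u) [TopologicalSpace W] [MulAction G W], IsCompactGSpace G W →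
    ∀ (p : W → X) (q : W → Y), IsFactorMap G p → IsFactorMap G q →
      Function.Surjective fun w => (p w, q w)

/-- `G` is boundary indivisible if two non-trivial `G`-boundaries are never disjoint. -/
def IsBoundaryIndivisible (G : Type u) [Group G] : Prop :=
  ∀ (X Y : Type u) [TopologicalSpace X] [MulAction G X] [TopologicalSpace Y] [MulAction G Y],
    IsBoundary G X → Nontrivial X → IsBoundary G Y → Nontrivial Y → ¬ AreDisjointSpaces G X Y

/-! ### The Chabauty space, stabilizer URS and envelopes -/

open Classical in
/-- The Chabauty topology on the set of subgroups of a discrete group `G`: the topology induced by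
the inclusion of the set of subgroups in `{0, 1} ^ G`. (In a discrete group compact subsets are
finite, so this is the usual Chabauty topology.) -/
@[reducible]
noncomputable def chabautyTopology (G : Type*) [Group G] : TopologicalSpace (Subgroup G) :=
  TopologicalSpace.induced (fun (H : Subgroup G) (g : G) => decide (g ∈ H)) inferInstance

/-- The set of points of `X` at which the stabilizer map `X → Sub(G)` is continuous. -/
def stabContinuityPoints (G : Type*) [Group G] (X : Type*) [TopologicalSpace X] [MulAction G X] :
    Set X :=
  letI := chabautyTopology G
  {x | ContinuousAt (fun y : X => MulAction.stabilizer G y) x}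

/-- The stabilizer URS of a minimal compact `G`-space `X`, for `G` countable discrete: the closure
in `Sub(G)` of the set of stabilizers of the continuity points of the stabilizer map. -/
def stabilizerURS (G : Type*) [Group G] (X : Type*) [TopologicalSpace X] [MulAction G X] :
    Set (Subgroup G) :=
  letI := chabautyTopology G
  closure ((fun x : X => MulAction.stabilizer G x) '' stabContinuityPoints G X)

/-- The Furstenberg URS of `G`: the stabilizer URS of the Furstenberg boundary of `G`
(which is unique up to isomorphism). -/
def furstenbergURS (G : Type u) [Group G] : Set (Subgroup G) :=
  {H | ∃ (B : Type u) (_ : TopologicalSpace B) (_ : MulAction G B),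
    IsFurstenbergBoundary G B ∧ H ∈ stabilizerURS G B}

/-- The envelope of a set of subgroups of a discrete group: the subgroup that they generate. -/
def envelope {G : Type*} [Group G] (𝓗 : Set (Subgroup G)) : Subgroup G := sSup 𝓗

theorem continuous_map_conj (G : Type*) [Group G] (g : G) :
    letI := chabautyTopology G
    Continuous fun H : Subgroup G => H.map (MulAut.conj g).toMonoidHom := by
  classical
  let _ := chabautyTopology G
  refine continuous_induced_rng.2 (continuous_pi fun a => ?_)
  have h1 : Continuous fun H : Subgroup G => decide ((g⁻¹ * a * g) ∈ H) :=
    (continuous_apply (A := fun _ : G => Bool) (g⁻¹ * a * g)).comp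
      (continuous_induced_dom (f := fun (H : Subgroup G) (b : G) => decide (b ∈ H)))
  convert h1 using 2 with H
  simp only [Function.comp, decide_eq_decide]
  constructor
  · rintro ⟨b, hb, rfl⟩
    simpa [mul_assoc] using hb
  · intro hb
    exact ⟨_, hb, by simp [mul_assoc]⟩

theorem stabilizerURS_conj {G : Type*} [Group G] {X : Type*} [TopologicalSpace X] [MulAction G X]
    [ContinuousConstSMul G X] (g : G) {H : Subgroup G} (hH : H ∈ stabilizerURS G X) :
    H.map (MulAut.conj g).toMonoidHom ∈ stabilizerURS G X := by
  let _ := chabautyTopology G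
  have hc := continuous_map_conj G g
  refine map_mem_closure hc hH ?_
  rintro _ ⟨x, hx, rfl⟩
  refine ⟨g • x, ?_, MulAction.stabilizer_smul_eq_stabilizer_map_conj g x⟩
  have hx' : ContinuousAt (fun y : X => MulAction.stabilizer G y) (g⁻¹ • g • x) := by
    rw [inv_smul_smul]; exact hx
  have h2 : ContinuousAt (fun y : X => MulAction.stabilizer G (g⁻¹ • y)) (g • x) :=
    ContinuousAt.comp (g := fun y : X => MulAction.stabilizer G y) hx'
      (continuous_const_smul g⁻¹).continuousAt
  have h3 := hc.continuousAt.comp h2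
  have h4 : (fun y : X => MulAction.stabilizer G y) =
      (fun K : Subgroup G => K.map (MulAut.conj g).toMonoidHom) ∘
        (fun y : X => MulAction.stabilizer G (g⁻¹ • y)) := by
    funext y
    have := MulAction.stabilizer_smul_eq_stabilizer_map_conj g (g⁻¹ • y)
    rw [smul_inv_smul] at this
    exact this
  change ContinuousAt (fun y : X => MulAction.stabilizer G y) (g • x)
  rw [h4]
  exact h3

/-- The envelope of the Furstenberg URS is a normal subgroup. -/
instance envelope_furstenbergURS_normal (G : Type u) [Group G] :
    (envelope (furstenbergURS G)).Normal := by
  refine ⟨fun n hn g => ?_⟩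
  have key : envelope (furstenbergURS G) ≤
      (envelope (furstenbergURS G)).comap (MulAut.conj g).toMonoidHom := by
    refine sSup_le ?_
    rintro H ⟨B, _, _, hB, hH⟩
    have := hB.continuous_smul
    refine Subgroup.map_le_iff_le_comap.1 ?_
    exact le_sSup (show _ ∈ furstenbergURS G from ⟨B, _, _, hB, stabilizerURS_conj g hH⟩)
  exact key hn

/-! ### Co-amenability -/

/-- A subgroup `L` of a discrete group `G` is co-amenable in `G` if every convex compact `G`-space
`Q` (a compact convex subset of a Hausdorff locally convex real vector space, with an action of
`G` by affine homeomorphisms) in which `L` fixes a point has a point fixed by `G`. -/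
def IsCoamenable {G : Type u} [Group G] (L : Subgroup G) : Prop :=
  ∀ (E : Type u) [AddCommGroup E] [Module ℝ E] [TopologicalSpace E] [IsTopologicalAddGroup E]
    [ContinuousSMul ℝ E] [LocallyConvexSpace ℝ E] [T2Space E] (Q : Set E) [MulAction G Q],
    Convex ℝ Q → IsCompact Q → ContinuousConstSMul G Q →
    (∀ (g : G) (x y z : Q) (a b : ℝ), 0 ≤ a → 0 ≤ b → a + b = 1 →
      (z : E) = a • (x : E) + b • (y : E) →
      ((g • z : Q) : E) = a • ((g • x : Q) : E) + b • ((g • y : Q) : E)) →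
    (∃ x : Q, ∀ l ∈ L, l • x = x) → ∃ x : Q, ∀ g : G, g • x = x

/-! ### Groups of tree automorphisms with prescribed local action -/

/-- A colouring of the edges of `T` by `Ω` such that, for every vertex `v`, the edges at `v` are in
bijection with `Ω` through their colours. For `Ω` finite of cardinality `d` this says that `T` is
`d`-regular and that neighbouring edges have different colours. -/
structure LegalColoring {V : Type*} (T : SimpleGraph V) (Ω : Type*) where
  color : T.edgeSet → Ω
  bijective_star : ∀ v : V,
    Function.Bijective fun w : T.neighborSet v => color ⟨s(v, (w : V)), w.2⟩

namespace LegalColoring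

variable {V : Type*} {T : SimpleGraph V} {Ω : Type*} (c : LegalColoring T Ω)

/-- The bijection from the neighbours of `v` to the colours. -/
noncomputable def starEquiv (v : V) : T.neighborSet v ≃ Ω :=
  Equiv.ofBijective _ (c.bijective_star v)

/-- The local permutation `σ(g, v)` of `Ω` induced by the action of `g` on the star around `v`. -/
noncomputable def localPerm (g : T ≃g T) (v : V) : Equiv.Perm Ω :=
  (c.starEquiv v).symm.trans ((g.mapNeighborSet v).trans (c.starEquiv (g v)))

theorem localPerm_one (v : V) : c.localPerm 1 v = 1 := by
  ext a
  change c.starEquiv v _ = a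
  exact (c.starEquiv v).apply_symm_apply a

theorem localPerm_mul (g h : T ≃g T) (v : V) :
    c.localPerm (g * h) v = c.localPerm g (h v) * c.localPerm h v := by
  ext a
  simp only [localPerm, Equiv.Perm.mul_apply, Equiv.trans_apply, Equiv.symm_apply_apply]
  rfl

theorem localPerm_inv (g : T ≃g T) (v : V) :
    c.localPerm g⁻¹ v = (c.localPerm g (g⁻¹ v))⁻¹ := by
  have h := c.localPerm_mul g g⁻¹ v
  rw [mul_inv_cancel, localPerm_one] at h
  exact eq_inv_of_mul_eq_one_right h.symm

/-- The group `G(F, F')`: automorphisms all of whose local permutations are in `F'`, and all but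
finitely many of whose local permutations are in `F`. -/
def prescribedGroup (F F' : Subgroup (Equiv.Perm Ω)) : Subgroup (T ≃g T) where
  carrier := {g | (∀ v, c.localPerm g v ∈ F') ∧ {v | c.localPerm g v ∉ F}.Finite}
  one_mem' := by
    refine ⟨fun v => ?_, ?_⟩
    · rw [localPerm_one]; exact F'.one_mem
    · simp [localPerm_one, F.one_mem]
  mul_mem' := by
    rintro g h ⟨hg, hg'⟩ ⟨hh, hh'⟩
    refine ⟨fun v => ?_, ?_⟩
    · rw [localPerm_mul]; exact F'.mul_mem (hg _) (hh _)
    · refine (hh'.union (hg'.preimage (f := h) h.injective.injOn)).subset ?_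
      intro v hv
      by_contra hcon
      simp only [Set.mem_union, Set.mem_preimage, Set.mem_ofPred_eq, not_or, not_not] at hcon
      exact hv (by rw [localPerm_mul]; exact F.mul_mem hcon.2 hcon.1)
  inv_mem' := by
    rintro g ⟨hg, hg'⟩
    refine ⟨fun v => ?_, ?_⟩
    · rw [localPerm_inv]; exact F'.inv_mem (hg _)
    · refine (hg'.preimage (f := (g⁻¹ : T ≃g T)) (g⁻¹ : T ≃g T).injective.injOn).subset ?_
      intro v hv hcon
      exact hv (by rw [localPerm_inv]; exact F.inv_mem hcon)

end LegalColoring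

/-- A permutation group is semi-regular if it acts freely. -/
def IsSemiregularPermGroup {Ω : Type*} (F : Subgroup (Equiv.Perm Ω)) : Prop :=
  ∀ f ∈ F, ∀ a : Ω, f a = a → f = 1

/-- The subgroup of a permutation group generated by its point stabilizers. -/
def pointStabilizersSubgroup {Ω : Type*} (F : Subgroup (Equiv.Perm Ω)) :
    Subgroup (Equiv.Perm Ω) :=
  ⨆ a : Ω, F ⊓ MulAction.stabilizer (Equiv.Perm Ω) a

/-! Everything is read off the action of Γ on the boundary ∂T of the tree. It is extremely proximal:
every proper closed set can be moved into every non-empty open set (`isExtremelyProximal`), so ∂T is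
a boundary. Semi-regularity of F makes germ stabilizers (the groups of elements fixing a
neighbourhood of an end) locally finite, hence amenable (`hasAmenableGerms_prescribedGroup`).

Amenable germs link ∂T to an arbitrary boundary X. A germ stabilizer preserves a state on X; strong
proximality pushes that state to a point mass, and compactness yields a closed relation between
points x of X and ends z such that the germ stabilizer of z fixes x. Let N be the subgroup generated
by all germ stabilizers. If N moves a point of X, the set of ends related to x is proper and closed,
so it can be squeezed near any end. Stabilizers of translates of x then converge to stabilizers in
∂T, and X and ∂T have the same stabilizer URS (`stabilizerURS_eq`). Applied to the Furstenberg
boundary, this identifies its URS with that of ∂T, and the envelope with N, which is also the group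
generated by the fixators of edges (`germSubgroup_eq`).

If N is co-amenable it acts non-trivially on every non-trivial boundary
(`IsCoamenable.exists_smul_ne`). Thus (iv) holds, and (v) follows by squeezing inside the relation
between two boundaries.

The quotient Γ/N is explored by flips of the edges at a vertex. Modulo N a flip depends only on the
orbit of its colour under the group generated by the point stabilizers of F'. One orbit gives C₂ and
two give D_∞ (`nonempty_mulEquiv_of_card_le_two`); the groups in (ii) are all built from cyclic
steps, which gives (iii). With at least three orbits, Γ/N plays ping-pong through the free product
C₂ * C₂ * C₂. Hence N acts trivially on some non-trivial boundary, which is disjoint from ∂T and has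
another URS, so (iv) and (v) fail.

Measures are handled as states on C(X, ℝ), that is, as points of a product of real lines. -/

open Topology Filter

/-! ### States on `C(X, ℝ)` -/

/-- A state on `C(X, ℝ)`: a positive normalized linear functional. -/
structure IsState {X : Type*} [TopologicalSpace X] (φ : C(X, ℝ) → ℝ) : Prop where
  add : ∀ f g, φ (f + g) = φ f + φ g
  smul : ∀ (r : ℝ) f, φ (r • f) = r * φ f
  nonneg : ∀ f, 0 ≤ f → 0 ≤ φ f
  one : φ 1 = 1

/-- The set of states, as a subset of the product space `C(X, ℝ) → ℝ`. -/
def stateSpace (X : Type*) [TopologicalSpace X] : Set (C(X, ℝ) → ℝ) := {φ | IsState φ}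

/-- Evaluation at a point. -/
def evalState {X : Type*} [TopologicalSpace X] (x : X) : C(X, ℝ) → ℝ := fun f => f x

/-- The translate of a functional on `C(X, ℝ)` by a group element. -/
def actState {G : Type*} [Group G] {X : Type*} [TopologicalSpace X] [MulAction G X]
    [ContinuousConstSMul G X] (g : G) (φ : C(X, ℝ) → ℝ) : C(X, ℝ) → ℝ :=
  fun f => φ (f.comp ⟨fun x => g • x, continuous_const_smul g⟩)

namespace IsState

variable {X : Type*} [TopologicalSpace X] {φ : C(X, ℝ) → ℝ}

theorem neg (hφ : IsState φ) (f : C(X, ℝ)) : φ (-f) = -φ f := by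
  have := hφ.smul (-1) f
  simpa using this

theorem sub (hφ : IsState φ) (f g : C(X, ℝ)) : φ (f - g) = φ f - φ g := by
  rw [sub_eq_add_neg, hφ.add, hφ.neg, sub_eq_add_neg]

theorem zero (hφ : IsState φ) : φ 0 = 0 := by
  have := hφ.smul 0 0
  simpa using this

theorem mono (hφ : IsState φ) {f g : C(X, ℝ)} (h : ∀ x, f x ≤ g x) : φ f ≤ φ g := by
  have h1 := hφ.nonneg (g - f) (fun x => by simpa using h x)
  rw [hφ.sub] at h1
  linarith

theorem const (hφ : IsState φ) (r : ℝ) : φ (ContinuousMap.const X r) = r := by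
  have h := hφ.smul r 1
  rw [hφ.one, mul_one] at h
  have he : ContinuousMap.const X r = r • (1 : C(X, ℝ)) := by ext; simp
  rw [he, h]

theorem sum (hφ : IsState φ) {ι : Type*} (s : Finset ι) (f : ι → C(X, ℝ)) :
    φ (∑ i ∈ s, f i) = ∑ i ∈ s, φ (f i) := by
  classical
  induction s using Finset.induction_on with
  | empty => simp [hφ.zero]
  | insert a s ha ih => rw [Finset.sum_insert ha, Finset.sum_insert ha, hφ.add, ih]

theorem abs_apply_le (hφ : IsState φ) [CompactSpace X] (f : C(X, ℝ)) : |φ f| ≤ ‖f‖ := by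
  rw [abs_le]
  constructor
  · rw [← hφ.const (-‖f‖)]
    exact hφ.mono fun x => (abs_le.1 (f.norm_coe_le_norm x)).1
  · rw [← hφ.const ‖f‖]
    exact hφ.mono fun x => (abs_le.1 (f.norm_coe_le_norm x)).2

theorem eval (x : X) : IsState (evalState x) :=
  ⟨fun _ _ => rfl, fun _ _ => rfl, fun _ h => h x, rfl⟩

theorem comp (hφ : IsState φ) {Y : Type*} [TopologicalSpace Y] (p : C(X, Y)) :
    IsState fun f : C(Y, ℝ) => φ (f.comp p) :=
  ⟨fun f g => hφ.add (f.comp p) (g.comp p), fun r f => hφ.smul r (f.comp p),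
    fun _ h => hφ.nonneg _ fun x => h (p x), hφ.one⟩

theorem act (hφ : IsState φ) {G : Type*} [Group G] [MulAction G X] [ContinuousConstSMul G X]
    (g : G) : IsState (actState g φ) :=
  hφ.comp _

/-- If every point where `F` is positive is detected by a nonnegative function that is null for the
state `φ`, then `φ F ≤ 0`. -/
theorem le_zero_of_null (hφ : IsState φ) [CompactSpace X] (F : C(X, ℝ))
    (h : ∀ x, 0 < F x → ∃ G : C(X, ℝ), (∀ y, 0 ≤ G y) ∧ φ G = 0 ∧ 0 < G x) : φ F ≤ 0 := by
  refine le_of_forall_pos_le_add fun ε hε => ?_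
  rw [zero_add]
  -- Off K the bound ε suffices. On the compact set K finitely many null functions add up to a
  -- positive H, so F ≤ ε + C H everywhere while φ H = 0.
  let K : Set X := {x | ε ≤ F x}
  have hK : IsCompact K := (isClosed_le continuous_const F.continuous).isCompact
  choose! G hG0 hGφ hGpos using h
  obtain ⟨t, htK, ht⟩ := hK.elim_nhds_subcover (fun x => {y | 0 < G x y}) fun x hx =>
    (isOpen_lt continuous_const (G x).continuous).mem_nhds (hGpos x (hε.trans_le hx))
  let H : C(X, ℝ) := ∑ x ∈ t, G x
  have hHapp : ∀ y, H y = ∑ x ∈ t, G x y := fun y => by simp [H]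
  have hFpos : ∀ x ∈ t, 0 < F x := fun x hx => hε.trans_le (htK x hx)
  have hH0 : ∀ y, 0 ≤ H y := fun y => by
    rw [hHapp]; exact Finset.sum_nonneg fun x hx => hG0 x (hFpos x hx) y
  have hHφ : φ H = 0 := by
    rw [hφ.sum]; exact Finset.sum_eq_zero fun x hx => hGφ x (hFpos x hx)
  have hHK : ∀ y ∈ K, 0 < H y := fun y hy => by
    obtain ⟨x, hx, hxy⟩ := Set.mem_iUnion₂.1 (ht hy)
    rw [hHapp]
    exact Finset.sum_pos' (fun x hx => hG0 x (hFpos x hx) y) ⟨x, hx, hxy⟩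
  obtain ⟨C, hC0, hC⟩ : ∃ C : ℝ, 0 ≤ C ∧ ∀ y ∈ K, F y ≤ C * H y := by
    rcases K.eq_empty_or_nonempty with hKe | hKne
    · exact ⟨0, le_rfl, fun y hy => by simp [hKe] at hy⟩
    · obtain ⟨y₀, hy₀, hmin⟩ := hK.exists_isMinOn hKne H.continuous.continuousOn
      have hδ := hHK y₀ hy₀
      refine ⟨‖F‖ / H y₀, by positivity, fun y hy => ?_⟩
      calc F y ≤ ‖F‖ := (le_abs_self _).trans (F.norm_coe_le_norm y)
        _ = ‖F‖ / H y₀ * H y₀ := by field_simp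
        _ ≤ ‖F‖ / H y₀ * H y := by
          have : H y₀ ≤ H y := hmin hy
          gcongr
  have hle : φ F ≤ φ (ContinuousMap.const X ε + C • H) := by
    refine hφ.mono fun y => ?_
    simp only [ContinuousMap.add_apply, ContinuousMap.const_apply, ContinuousMap.smul_apply,
      smul_eq_mul]
    by_cases hy : y ∈ K
    · linarith [hC y hy]
    · have : F y < ε := not_le.1 hy
      nlinarith [hH0 y]
  rwa [hφ.add, hφ.const, hφ.smul, hHφ, mul_zero, add_zero] at hle

/-- A state that vanishes on functions separating every other point from `x` is evaluation
at `x`. -/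
theorem eq_eval_of_null (hφ : IsState φ) [CompactSpace X] (x : X)
    (h : ∀ y, y ≠ x → ∃ G : C(X, ℝ), (∀ y, 0 ≤ G y) ∧ φ G = 0 ∧ 0 < G y) : φ = evalState x := by
  have key : ∀ F : C(X, ℝ), φ F ≤ F x := fun F => by
    have := hφ.le_zero_of_null (F - ContinuousMap.const X (F x)) fun y hy => h y (by
      rintro rfl; simp at hy)
    rw [hφ.sub, hφ.const] at this
    linarith
  funext F
  refine le_antisymm (key F) ?_
  have := key (-F)
  rw [hφ.neg] at this
  simpa [evalState] using this

end IsState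

theorem isClosed_stateSpace (X : Type*) [TopologicalSpace X] : IsClosed (stateSpace X) := by
  have : stateSpace X = (⋂ f : C(X, ℝ), ⋂ g : C(X, ℝ), {φ | φ (f + g) = φ f + φ g}) ∩
      (⋂ r : ℝ, ⋂ f : C(X, ℝ), {φ | φ (r • f) = r * φ f}) ∩
      (⋂ f : C(X, ℝ), ⋂ _ : 0 ≤ f, {φ | 0 ≤ φ f}) ∩ {φ | φ 1 = 1} := by
    ext φ
    simp only [stateSpace, Set.mem_ofPred_eq, Set.mem_inter_iff, Set.mem_iInter]
    exact ⟨fun h => ⟨⟨⟨h.add, h.smul⟩, h.nonneg⟩, h.one⟩, fun h => ⟨h.1.1.1, h.1.1.2, h.1.2, h.2⟩⟩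
  rw [this]
  refine ((((isClosed_iInter fun f => isClosed_iInter fun g => isClosed_eq ?_ ?_).inter
    (isClosed_iInter fun r => isClosed_iInter fun f => isClosed_eq ?_ ?_)).inter
    (isClosed_iInter fun f => isClosed_iInter fun _ => isClosed_le ?_ ?_)).inter
    (isClosed_eq ?_ ?_)) <;> fun_prop

/-- States are contractions, so Tychonoff's theorem on a product of intervals replaces
Banach–Alaoglu. -/
theorem isCompact_stateSpace (X : Type*) [TopologicalSpace X] [CompactSpace X] :
    IsCompact (stateSpace X) := by
  refine (isCompact_univ_pi fun f : C(X, ℝ) => isCompact_Icc (a := -‖f‖) (b := ‖f‖)).of_isClosed_subset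
    (isClosed_stateSpace X) fun φ hφ f _ => ?_
  exact abs_le.1 (IsState.abs_apply_le hφ f)

theorem convex_stateSpace (X : Type*) [TopologicalSpace X] : Convex ℝ (stateSpace X) := by
  intro φ hφ ψ hψ a b ha hb hab
  refine ⟨fun f g => ?_, fun r f => ?_, fun f hf => ?_, ?_⟩
  · simp only [Pi.add_apply, Pi.smul_apply, smul_eq_mul, hφ.add, hψ.add]; ring
  · simp only [Pi.add_apply, Pi.smul_apply, smul_eq_mul, hφ.smul, hψ.smul]; ring
  · have h1 := hφ.nonneg f hf
    have h2 := hψ.nonneg f hf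
    simp only [Pi.add_apply, Pi.smul_apply, smul_eq_mul]
    positivity
  · simp [hφ.one, hψ.one, hab]

theorem continuous_evalState {X : Type*} [TopologicalSpace X] :
    Continuous (evalState : X → C(X, ℝ) → ℝ) :=
  continuous_pi fun f => f.continuous

theorem exists_continuousMap_ne {X : Type*} [TopologicalSpace X] [CompactSpace X] [T2Space X]
    {x y : X} (h : x ≠ y) : ∃ f : C(X, ℝ), f x = 0 ∧ f y = 1 := by
  obtain ⟨f, hf0, hf1, -⟩ := exists_continuous_zero_one_of_isClosed (isClosed_singleton (x := x))
    (isClosed_singleton (x := y)) (by simpa using h)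
  exact ⟨f, hf0 rfl, hf1 rfl⟩

theorem evalState_injective {X : Type*} [TopologicalSpace X] [CompactSpace X] [T2Space X] :
    Function.Injective (evalState : X → C(X, ℝ) → ℝ) := by
  intro x y h
  by_contra hne
  obtain ⟨f, hf0, hf1⟩ := exists_continuousMap_ne hne
  have := congrFun h f
  simp [evalState, hf0, hf1] at this

section actState

variable {G : Type*} [Group G] {X : Type*} [TopologicalSpace X] [MulAction G X]
  [ContinuousConstSMul G X]

theorem continuous_actState (g : G) : Continuous (actState g : (C(X, ℝ) → ℝ) → C(X, ℝ) → ℝ) :=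
  continuous_pi fun _ => continuous_apply _

theorem actState_mul (g h : G) (φ : C(X, ℝ) → ℝ) :
    actState (g * h) φ = actState g (actState h φ) := by
  funext f
  simp only [actState]
  congr 1
  ext x
  simp [mul_smul]

theorem actState_one (φ : C(X, ℝ) → ℝ) : actState (1 : G) φ = φ := by
  funext f
  simp only [actState]
  congr 1
  ext x
  simp

theorem actState_evalState (g : G) (x : X) : actState g (evalState x) = evalState (g • x) := rfl

theorem actState_linear (g : G) (φ ψ : C(X, ℝ) → ℝ) (a b : ℝ) :
    actState g (a • φ + b • ψ) = a • actState g φ + b • actState g ψ := rfl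

theorem actState_inv_actState (g : G) (φ : C(X, ℝ) → ℝ) :
    actState g⁻¹ (actState g φ) = φ := by
  rw [← actState_mul, inv_mul_cancel, actState_one]

end actState

/-! ### States and regular probability measures -/

section measures

variable {X : Type*} [TopologicalSpace X] [CompactSpace X]

theorem isState_integralFunctional [MeasurableSpace X] [BorelSpace X] (μ : MeasureTheory.Measure X)
    [MeasureTheory.IsProbabilityMeasure μ] : IsState (integralFunctional μ) := by
  have hint : ∀ f : C(X, ℝ), MeasureTheory.Integrable f μ := fun f =>
    f.continuous.integrable_of_hasCompactSupport (HasCompactSupport.of_compactSpace _)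
  refine ⟨fun f g => ?_, fun r f => ?_, fun f hf => ?_, ?_⟩
  · exact MeasureTheory.integral_add (hint f) (hint g)
  · exact MeasureTheory.integral_const_mul r f
  · exact MeasureTheory.integral_nonneg hf
  · simp [integralFunctional]

/-- Riesz–Markov–Kakutani: on a compact space every continuous function has compact support, and φ 1
= 1 gives total mass one. -/
theorem IsState.exists_measure [T2Space X] [MeasurableSpace X] [BorelSpace X] {φ : C(X, ℝ) → ℝ}
    (hφ : IsState φ) : ∃ μ : MeasureTheory.Measure X, MeasureTheory.IsProbabilityMeasure μ ∧
      μ.Regular ∧ integralFunctional μ = φ := by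
  let Λ : CompactlySupportedContinuousMap X ℝ →ₚ[ℝ] ℝ :=
    { toFun := fun g => φ g.toContinuousMap
      map_add' := fun g g' => hφ.add _ _
      map_smul' := fun c g => hφ.smul _ _
      monotone' := fun g g' h => hφ.mono h }
  have key : ∀ f : C(X, ℝ), ∫ x, f x ∂(RealRMK.rieszMeasure Λ) = φ f := fun f =>
    RealRMK.integral_rieszMeasure Λ ⟨f, HasCompactSupport.of_compactSpace _⟩
  refine ⟨RealRMK.rieszMeasure Λ, ⟨?_⟩, inferInstance, funext key⟩
  have h1 := key 1
  rw [hφ.one] at h1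
  simp only [ContinuousMap.one_apply, MeasureTheory.integral_const, smul_eq_mul, mul_one] at h1
  exact (ENNReal.toReal_eq_one_iff _).1 h1

/-- Strong proximality in terms of states. -/
theorem isStronglyProximal_iff [T2Space X] {G : Type*} [Group G] [MulAction G X]
    [ContinuousConstSMul G X] :
    IsStronglyProximal G X ↔ ∀ φ : C(X, ℝ) → ℝ, IsState φ →
      ∃ x : X, evalState x ∈ closure (Set.range fun g : G => actState g φ) := by
  let _ : MeasurableSpace X := borel X
  have : BorelSpace X := ⟨rfl⟩
  have hdirac : ∀ x : X, integralFunctional (MeasureTheory.Measure.dirac x) = evalState x :=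
    fun x => funext fun f => MeasureTheory.integral_dirac _ _
  have hmap : ∀ (μ : MeasureTheory.Measure X) (g : G),
      integralFunctional (μ.map fun y => g • y) = actState g (integralFunctional μ) := by
    intro μ g
    funext f
    exact MeasureTheory.integral_map (continuous_const_smul g).measurable.aemeasurable
      f.continuous.aestronglyMeasurable
  constructor
  · intro h φ hφ
    obtain ⟨μ, hμ, hμr, rfl⟩ := hφ.exists_measure
    obtain ⟨x, hx⟩ := h μ hμ hμr
    refine ⟨x, ?_⟩
    rw [hdirac] at hx
    simpa only [hmap] using hx
  · intro h μ hμ hμr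
    obtain ⟨x, hx⟩ := h _ (isState_integralFunctional μ)
    refine ⟨x, ?_⟩
    rw [hdirac]
    simpa only [hmap] using hx

end measures

/-! ### Barycenters and boundaries inside state spaces -/

/-- The condition |l| < 1 holds on a neighbourhood of 0 that restricts only finitely many
coordinates. A vector vanishing at these can be rescaled freely within it, so l kills it. -/
theorem ContinuousLinearMap.exists_finset_sum_of_pi {I : Type*} (l : (I → ℝ) →L[ℝ] ℝ) :
    ∃ (s : Finset I) (c : I → ℝ), ∀ φ, l φ = ∑ i ∈ s, c i * φ i := by
  classical
  have h1 : {φ | |l φ| < 1} ∈ 𝓝 (0 : I → ℝ) :=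
    (isOpen_lt (l.continuous.abs) continuous_const).mem_nhds (by simp)
  rw [nhds_pi, Filter.mem_pi'] at h1
  obtain ⟨s, t, ht, hst⟩ := h1
  have hzero : ∀ φ : I → ℝ, (∀ i ∈ s, φ i = 0) → l φ = 0 := by
    intro φ hφ
    by_contra hne
    have h2 : (l φ)⁻¹ • φ ∈ {φ | |l φ| < 1} := hst fun i hi => by
      have : ((l φ)⁻¹ • φ) i = 0 := by simp [hφ i hi]
      rw [this]
      exact mem_of_mem_nhds (ht i)
    simp [hne] at h2
  refine ⟨s, fun i => l (Pi.single i 1), fun φ => ?_⟩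
  have h3 := hzero (φ - ∑ i ∈ s, φ i • Pi.single i 1) fun i hi => by
    simp [Finset.sum_apply, Pi.single_apply, hi]
  rw [map_sub, sub_eq_zero, map_sum] at h3
  rw [h3]
  refine Finset.sum_congr rfl fun i _ => ?_
  rw [map_smul, smul_eq_mul, mul_comm]

section barycenter

variable {Y I : Type*} [TopologicalSpace Y]

/-- A coordinate of a map into a product of copies of `ℝ`. -/
def coordMap (j : C(Y, I → ℝ)) (i : I) : C(Y, ℝ) :=
  ⟨fun y => j y i, (continuous_apply i).comp j.continuous⟩

/-- The barycenter of the image of a state under a map into a product of copies of `ℝ`. -/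
def barycenter (j : C(Y, I → ℝ)) (φ : C(Y, ℝ) → ℝ) : I → ℝ := fun i => φ (coordMap j i)

theorem continuous_barycenter (j : C(Y, I → ℝ)) : Continuous (barycenter j) :=
  continuous_pi fun _ => continuous_apply _

/-- A separating functional involves finitely many coordinates, so it commutes with the linear φ,
and positivity carries its bound on C over to the barycenter. -/
theorem barycenter_mem {j : C(Y, I → ℝ)} {φ : C(Y, ℝ) → ℝ} (hφ : IsState φ) {C : Set (I → ℝ)}
    (hC : IsClosed C) (hconv : Convex ℝ C) (hj : ∀ y, j y ∈ C) : barycenter j φ ∈ C := by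
  by_contra hb
  obtain ⟨l, r, hlr, hr⟩ := geometric_hahn_banach_closed_point hconv hC hb
  obtain ⟨s, c, hl⟩ := l.exists_finset_sum_of_pi
  have h1 : l (barycenter j φ) = φ (∑ i ∈ s, c i • coordMap j i) := by
    rw [hl, hφ.sum]
    exact Finset.sum_congr rfl fun i _ => by rw [hφ.smul]; rfl
  have h2 : φ (∑ i ∈ s, c i • coordMap j i) ≤ φ (ContinuousMap.const Y r) :=
    hφ.mono fun y => by
      have := hlr _ (hj y)
      rw [hl] at this
      simpa [coordMap] using this.le
  rw [hφ.const] at h2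
  linarith

/-- A state whose barycenter is an extreme point has no variance. -/
theorem IsState.variance_eq_zero [CompactSpace Y] {j : C(Y, I → ℝ)} {φ : C(Y, ℝ) → ℝ}
    (hφ : IsState φ) {C : Set (I → ℝ)} (hC : IsClosed C) (hconv : Convex ℝ C) (hj : ∀ y, j y ∈ C)
    (hext : barycenter j φ ∈ C.extremePoints ℝ) (i : I) :
    φ ((coordMap j i - ContinuousMap.const Y (barycenter j φ i)) ^ 2) = 0 := by
  set F := coordMap j i with hF
  set M := ‖F‖ + 1 with hM
  have hM0 : 0 < M := by positivity
  have hFM : ∀ y, |F y| ≤ M := fun y => (F.norm_coe_le_norm y).trans (by simp [hM])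
  -- Since h takes values in [1/4, 3/4], the densities h and 1 - h split φ into a proper convex
  -- combination of two states. Extremality equates their barycenters, which gives φ (h F) = φ h φ
  -- F; as h is affine in F, this says φ (F²) = (φ F)².
  set h : C(Y, ℝ) := ContinuousMap.const Y (1 / 2) + (1 / (4 * M)) • F with hh
  have hval : ∀ y, h y = 1 / 2 + F y / (4 * M) := fun y => by simp [hh]; ring_nf
  have hbd : ∀ y, 1 / 4 ≤ h y ∧ h y ≤ 3 / 4 := fun y => by
    rw [hval]
    have := abs_le.1 (hFM y)
    have h1 : F y / (4 * M) ≤ 1 / 4 := by rw [div_le_iff₀ (by positivity)]; linarith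
    have h2 : -(1 / 4) ≤ F y / (4 * M) := by rw [le_div_iff₀ (by positivity)]; linarith
    constructor <;> linarith
  have ht1 : 1 / 4 ≤ φ h := by
    rw [← hφ.const (1 / 4)]; exact hφ.mono fun y => (hbd y).1
  have ht2 : φ h ≤ 3 / 4 := by
    rw [← hφ.const (3 / 4)]; exact hφ.mono fun y => (hbd y).2
  set t := φ h with ht
  have ht0 : 0 < t := by linarith
  have ht0' : 0 < 1 - t := by linarith
  have hs1 : IsState fun g => φ (h * g) / t :=
    ⟨fun f g => by rw [mul_add, hφ.add, add_div],
      fun r f => by rw [mul_smul_comm, hφ.smul, mul_div_assoc],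
      fun f hf => div_nonneg (hφ.nonneg _ fun y =>
        mul_nonneg (by linarith [(hbd y).1]) (hf y)) ht0.le,
      by rw [mul_one, ← ht, div_self ht0.ne']⟩
  have hs2 : IsState fun g => φ ((1 - h) * g) / (1 - t) :=
    ⟨fun f g => by rw [mul_add, hφ.add, add_div],
      fun r f => by rw [mul_smul_comm, hφ.smul, mul_div_assoc],
      fun f hf => div_nonneg (hφ.nonneg _ fun y =>
        mul_nonneg (sub_nonneg.2 ((hbd y).2.trans (by norm_num))) (hf y)) ht0'.le,
      by rw [mul_one, hφ.sub, hφ.one, ← ht, div_self ht0'.ne']⟩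
  have hb1 := barycenter_mem hs1 hC hconv hj
  have hb2 := barycenter_mem hs2 hC hconv hj
  have hseg : barycenter j φ ∈ openSegment ℝ (barycenter j fun g => φ (h * g) / t)
      (barycenter j fun g => φ ((1 - h) * g) / (1 - t)) := by
    refine ⟨t, 1 - t, ht0, ht0', add_sub_cancel t 1, ?_⟩
    funext k
    simp only [barycenter, Pi.add_apply, Pi.smul_apply, smul_eq_mul]
    rw [mul_div_cancel₀ _ ht0.ne', mul_div_cancel₀ _ ht0'.ne', ← hφ.add, ← add_mul,
      add_sub_cancel, one_mul]
  have heq := congrFun (hext.2 hb1 hb2 hseg) i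
  simp only [barycenter, ← hF] at heq ⊢
  rw [div_eq_iff ht0.ne'] at heq
  have e1 : h * F = (1 / 2 : ℝ) • F + (1 / (4 * M)) • F ^ 2 := by
    ext y; simp [hh]; ring
  have e2 : t = 1 / 2 + 1 / (4 * M) * φ F := by
    rw [ht, hh, hφ.add, hφ.const, hφ.smul]
  rw [e1, hφ.add, hφ.smul, hφ.smul, e2] at heq
  have e3 : φ (F ^ 2) = φ F ^ 2 := by
    have : 1 / (4 * M) * φ (F ^ 2) = 1 / (4 * M) * φ F ^ 2 := by linarith
    exact mul_left_cancel₀ (by positivity) this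
  have e4 : (F - ContinuousMap.const Y (φ F)) ^ 2 =
      F ^ 2 - (2 * φ F) • F + ContinuousMap.const Y (φ F ^ 2) := by
    ext y; simp; ring
  rw [e4, hφ.add, hφ.sub, hφ.smul, hφ.const, e3]
  ring

end barycenter

/-! ### Minimal invariant convex sets and the boundaries they contain -/

section invariant

variable {G : Type*} [Group G] {W : Type*} [TopologicalSpace W] [MulAction G W]
  [ContinuousConstSMul G W]

/-- The action of `G` on an invariant set of functionals. -/
@[reducible]
def invariantAction (S : Set (C(W, ℝ) → ℝ)) (hS : ∀ (g : G), ∀ φ ∈ S, actState g φ ∈ S) :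
    MulAction G S where
  smul g φ := ⟨actState g φ, hS g φ φ.2⟩
  one_smul _ := Subtype.ext (actState_one _)
  mul_smul g h _ := Subtype.ext (actState_mul g h _)

theorem invariantAction_continuous (S : Set (C(W, ℝ) → ℝ))
    (hS : ∀ (g : G), ∀ φ ∈ S, actState g φ ∈ S) :
    letI := invariantAction S hS
    ContinuousConstSMul G S :=
  letI := invariantAction S hS
  ⟨fun g => Continuous.subtype_mk ((continuous_actState g).comp continuous_subtype_val) _⟩

/-- The closed convex invariant non-empty subsets of the state space. -/
def invariantConvexSets (G W : Type*) [Group G] [TopologicalSpace W] [MulAction G W]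
    [ContinuousConstSMul G W] : Set (Set (C(W, ℝ) → ℝ)) :=
  {C | C ⊆ stateSpace W ∧ IsClosed C ∧ Convex ℝ C ∧ C.Nonempty ∧
    ∀ g : G, ∀ φ ∈ C, actState g φ ∈ C}

theorem exists_minimal_invariantConvexSet [CompactSpace W] [Nonempty W] :
    ∃ C, Minimal (· ∈ invariantConvexSets G W) C := by
  refine zorn_superset _ fun F hF hchain => ?_
  rcases F.eq_empty_or_nonempty with rfl | hne
  · obtain ⟨w⟩ := ‹Nonempty W›
    exact ⟨stateSpace W, ⟨subset_rfl, isClosed_stateSpace W, convex_stateSpace W,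
      ⟨_, IsState.eval w⟩, fun g φ hφ => IsState.act hφ g⟩, by simp⟩
  · have := hne.to_subtype
    refine ⟨⋂₀ F, ⟨?_, isClosed_sInter fun t ht => (hF ht).2.1,
      convex_sInter fun t ht => (hF ht).2.2.1, ?_, ?_⟩, fun t ht => Set.sInter_subset_of_mem ht⟩
    · obtain ⟨t, ht⟩ := hne
      exact (Set.sInter_subset_of_mem ht).trans (hF ht).1
    · rw [Set.sInter_eq_iInter]
      refine IsCompact.nonempty_iInter_of_directed_nonempty_isCompact_isClosed _ (fun t r => ?_)
        (fun t => (hF t.2).2.2.2.1)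
        (fun t => (isCompact_stateSpace W).of_isClosed_subset (hF t.2).2.1 (hF t.2).1)
        fun t => (hF t.2).2.1
      obtain h | h := hchain.total t.2 r.2
      exacts [⟨t, subset_rfl, h⟩, ⟨r, h, subset_rfl⟩]
    · exact fun g φ hφ t ht => (hF ht).2.2.2.2 g φ (hφ t ht)

/-- A compact `G`-space mapping equivariantly into a minimal closed convex invariant set hits
every extreme point. -/
theorem extremePoint_mem_range {C : Set (C(W, ℝ) → ℝ)} (hC : Minimal (· ∈ invariantConvexSets G W) C)
    {Y : Type*} [TopologicalSpace Y] [CompactSpace Y] [Nonempty Y] [MulAction G Y]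
    [ContinuousConstSMul G Y] (j : C(Y, C(W, ℝ) → ℝ)) (hj : ∀ y, j y ∈ C)
    (hjG : ∀ (g : G) y, j (g • y) = actState g (j y)) {e : C(W, ℝ) → ℝ}
    (he : e ∈ C.extremePoints ℝ) : ∃ y, j y = e := by
  -- The barycenters form a closed convex invariant subset of C, hence all of C by minimality.
  have hK : barycenter j '' stateSpace Y ∈ invariantConvexSets G W := by
    refine ⟨?_, ((isCompact_stateSpace Y).image (continuous_barycenter j)).isClosed, ?_, ?_, ?_⟩
    · rintro _ ⟨φ, hφ, rfl⟩
      exact hC.prop.1 (barycenter_mem hφ hC.prop.2.1 hC.prop.2.2.1 hj)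
    · rintro _ ⟨φ, hφ, rfl⟩ _ ⟨ψ, hψ, rfl⟩ a b ha hb hab
      exact ⟨_, convex_stateSpace Y hφ hψ ha hb hab, rfl⟩
    · obtain ⟨y⟩ := ‹Nonempty Y›
      exact ⟨_, _, IsState.eval y, rfl⟩
    · rintro g _ ⟨φ, hφ, rfl⟩
      refine ⟨actState g φ, IsState.act hφ g, ?_⟩
      funext f
      simp only [barycenter, actState]
      congr 1
      ext y
      exact congrFun (hjG g y) f
  have hsub : C ⊆ barycenter j '' stateSpace Y := hC.le_of_le hK (by
    rintro _ ⟨φ, hφ, rfl⟩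
    exact barycenter_mem hφ hC.prop.2.1 hC.prop.2.2.1 hj)
  obtain ⟨φ, hφ, rfl⟩ := hsub he.1
  by_contra hne
  push Not at hne
  -- If e were missed, some null variance function would be positive at each point of Y, forcing φ 1
  -- ≤ 0.
  have hle := IsState.le_zero_of_null hφ 1 fun y _ => by
    obtain ⟨f, hf⟩ := Function.ne_iff.1 (hne y)
    refine ⟨_, fun z => ?_, IsState.variance_eq_zero hφ hC.prop.2.1 hC.prop.2.2.1 hj he f, ?_⟩
    · exact sq_nonneg _
    · exact sq_pos_of_ne_zero (sub_ne_zero.2 hf)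
  rw [IsState.one hφ] at hle
  linarith

/-- The state space of a compact `G`-space contains a `G`-boundary. -/
theorem exists_boundary_stateSpace {G W : Type u} [Group G] [TopologicalSpace W] [MulAction G W]
    [ContinuousConstSMul G W] [CompactSpace W] [Nonempty W] :
    ∃ (X : Type u) (_ : TopologicalSpace X) (_ : MulAction G X) (j : X → C(W, ℝ) → ℝ),
      IsBoundary G X ∧ Continuous j ∧ Function.Injective j ∧ (∀ x, IsState (j x)) ∧
        ∀ (g : G) x, j (g • x) = actState g (j x) := by
  obtain ⟨C, hC⟩ := exists_minimal_invariantConvexSet (G := G) (W := W)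
  have hCc : IsCompact C := (isCompact_stateSpace W).of_isClosed_subset hC.prop.2.1 hC.prop.1
  have hextG : ∀ g : G, ∀ e ∈ C.extremePoints ℝ, actState g e ∈ C.extremePoints ℝ := by
    intro g e he
    refine ⟨hC.prop.2.2.2.2 g e he.1, ?_⟩
    rintro φ hφ ψ hψ ⟨a, b, ha, hb, hab, heq⟩
    have h1 := he.2 (hC.prop.2.2.2.2 g⁻¹ φ hφ) (hC.prop.2.2.2.2 g⁻¹ ψ hψ) ⟨a, b, ha, hb, hab, by
      rw [← actState_linear, heq, actState_inv_actState]⟩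
    rw [← h1, ← actState_mul, mul_inv_cancel, actState_one]
  -- The boundary sought is the closure of the extreme points of a minimal invariant convex set.
  -- Minimality and strong proximality both come from `extremePoint_mem_range`, applied to an orbit
  -- closure of points and of states respectively.
  set S := closure (C.extremePoints ℝ) with hS
  have hSC : S ⊆ C := closure_minimal extremePoints_subset hC.prop.2.1
  have hSG : ∀ g : G, ∀ φ ∈ S, actState g φ ∈ S := fun g φ hφ =>
    map_mem_closure (continuous_actState g) hφ (hextG g)
  have hSc : IsCompact S := hCc.of_isClosed_subset isClosed_closure hSC
  have hext : (C.extremePoints ℝ).Nonempty := hCc.extremePoints_nonempty hC.prop.2.2.2.1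
  let _ := invariantAction S hSG
  have hcont := invariantAction_continuous S hSG
  have hcomp : CompactSpace S := isCompact_iff_compactSpace.1 hSc
  have hval : ∀ (g : G) (x : S), ((g • x : S) : C(W, ℝ) → ℝ) = actState g x := fun _ _ => rfl
  refine ⟨S, inferInstance, inferInstance, Subtype.val,
    ⟨⟨(hext.mono subset_closure).to_subtype, hcomp, inferInstance, hcont⟩, ⟨fun x => ?_⟩, ?_⟩,
    continuous_subtype_val, Subtype.val_injective, fun x => hC.prop.1 (hSC x.2), fun _ _ => rfl⟩
  · -- minimality
    set O : Set S := closure (MulAction.orbit G x) with hO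
    have hOG : ∀ (g : G), ∀ y ∈ O, g • y ∈ O := fun g y hy =>
      map_mem_closure (continuous_const_smul g) hy fun z hz =>
        MulAction.mem_orbit_of_mem_orbit g hz
    let O' : Set (C(W, ℝ) → ℝ) := Subtype.val '' O
    have hO'G : ∀ (g : G), ∀ φ ∈ O', actState g φ ∈ O' := by
      rintro g _ ⟨y, hy, rfl⟩
      exact ⟨g • y, hOG g y hy, rfl⟩
    let _ := invariantAction O' hO'G
    have := invariantAction_continuous O' hO'G
    have hO'c : IsCompact O' := isClosed_closure.isCompact.image continuous_subtype_val
    have : CompactSpace O' := isCompact_iff_compactSpace.1 hO'c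
    have : Nonempty O' := ⟨x, x, subset_closure (MulAction.mem_orbit_self x), rfl⟩
    have hO'S : O' ⊆ S := by rintro _ ⟨y, -, rfl⟩; exact y.2
    have hsub : C.extremePoints ℝ ⊆ O' := fun e he => by
      obtain ⟨y, rfl⟩ := extremePoint_mem_range hC ⟨Subtype.val, continuous_subtype_val⟩
        (fun y : O' => hSC (hO'S y.2)) (fun _ _ => rfl) he
      exact y.2
    have hsub' : S ⊆ O' := closure_minimal hsub hO'c.isClosed
    intro y
    obtain ⟨z, hz, hzy⟩ := hsub' y.2
    rwa [← Subtype.ext hzy]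
  · -- strong proximality
    rw [isStronglyProximal_iff]
    intro φ hφ
    set O : Set (C(S, ℝ) → ℝ) := closure (Set.range fun g : G => actState g φ) with hO
    have hOst : O ⊆ stateSpace S := closure_minimal (by
      rintro _ ⟨g, rfl⟩; exact hφ.act g) (isClosed_stateSpace S)
    have hOG : ∀ (g : G), ∀ ψ ∈ O, actState g ψ ∈ O := fun g y hy =>
      map_mem_closure (continuous_actState g) hy (by
        rintro _ ⟨h, rfl⟩; exact ⟨g * h, actState_mul _ _ _⟩)
    let _ := invariantAction O hOG
    have := invariantAction_continuous O hOG
    have : CompactSpace O := isCompact_iff_compactSpace.1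
      ((isCompact_stateSpace S).of_isClosed_subset isClosed_closure hOst)
    have : Nonempty O := ⟨φ, subset_closure ⟨1, actState_one _⟩⟩
    let incl : C(S, C(W, ℝ) → ℝ) := ⟨Subtype.val, continuous_subtype_val⟩
    obtain ⟨e, he⟩ := hext
    -- Some limit ψ of translates of φ has the extreme point e as barycenter. Its variances vanish,
    -- so ψ is evaluation at e.
    obtain ⟨⟨ψ, hψO⟩, hψ⟩ := extremePoint_mem_range hC
      (⟨fun ψ : O => barycenter incl ψ, (continuous_barycenter incl).comp continuous_subtype_val⟩ :
        C(O, C(W, ℝ) → ℝ))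
      (fun ψ => barycenter_mem (hOst ψ.2) hC.prop.2.1 hC.prop.2.2.1 fun x => hSC x.2)
      (fun g ψ => rfl) he
    simp only [ContinuousMap.coe_mk] at hψ
    refine ⟨⟨e, subset_closure he⟩, ?_⟩
    rw [← IsState.eq_eval_of_null (hOst hψO) ⟨e, subset_closure he⟩ fun y hy => ?_]
    · exact hψO
    · obtain ⟨f, hf⟩ := Function.ne_iff.1 (Subtype.coe_injective.ne hy)
      refine ⟨_, fun z => ?_, IsState.variance_eq_zero (hOst hψO) (j := incl) hC.prop.2.1
        hC.prop.2.2.1 (fun x => hSC x.2) (by rwa [hψ]) f, ?_⟩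
      · exact sq_nonneg _
      · rw [hψ]
        exact sq_pos_of_ne_zero (sub_ne_zero.2 hf)

end invariant

/-! ### Existence of the Furstenberg boundary -/

section ultrafilter

/-- The action on ultrafilters induced by an action on a set. -/
@[reducible]
def ultrafilterAction (G α : Type*) [Group G] [MulAction G α] : MulAction G (Ultrafilter α) where
  smul g p := p.map fun a => g • a
  one_smul p := by
    change p.map (fun a => (1 : G) • a) = p
    simp only [one_smul]
    exact Ultrafilter.map_id p
  mul_smul g h p := by
    change p.map (fun a => (g * h) • a) = (p.map fun a => h • a).map fun a => g • a
    rw [Ultrafilter.map_map]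
    congr 1
    funext a
    exact mul_smul g h a

theorem ultrafilterAction_continuous (G α : Type*) [Group G] [MulAction G α] :
    letI := ultrafilterAction G α
    ContinuousConstSMul G (Ultrafilter α) := by
  let _ := ultrafilterAction G α
  refine ⟨fun g => ultrafilterBasis_is_basis.continuous_iff.2 ?_⟩
  rintro _ ⟨s, rfl⟩
  exact ultrafilter_isOpen_basic ((fun a => g • a) ⁻¹' s)

end ultrafilter

/-- An equivariant map from a minimal space to the state space of a boundary consists of point
evaluations. -/
theorem exists_factorMap_of_stateSpace {G X Y : Type*} [Group G] [TopologicalSpace X]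
    [MulAction G X] [TopologicalSpace Y] [MulAction G Y] (hX : IsCompactGSpace G X)
    (hXm : MulAction.IsMinimal G X) (hY : IsBoundary G Y) (k : X → C(Y, ℝ) → ℝ)
    (hk : Continuous k) (hkst : ∀ x, IsState (k x))
    (hkG : letI := hY.continuous_smul; ∀ (g : G) x, k (g • x) = actState g (k x)) :
    ∃ f : X → Y, IsFactorMap G f := by
  have := hX.compact
  have := hX.continuous_smul
  have := hY.compact
  have := hY.t2
  have := hY.nonempty
  have := hY.continuous_smul
  have := hY.minimal
  obtain ⟨x₀⟩ := hX.nonempty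
  have hev : IsClosedEmbedding (evalState : Y → C(Y, ℝ) → ℝ) :=
    continuous_evalState.isClosedEmbedding evalState_injective
  -- The points sent to evaluations form a closed invariant set. It is non-empty because the compact
  -- set `Set.range k` contains the orbit closure of `k x₀`, which meets the evaluations by strong
  -- proximality.
  have hA : k ⁻¹' Set.range evalState = Set.univ := by
    refine (eq_empty_or_univ_of_smul_invariant_closed G (hev.isClosed_range.preimage hk)
      ?_).resolve_left ?_
    · rintro g _ ⟨x, ⟨y, hy⟩, rfl⟩
      refine ⟨g • y, ?_⟩
      change _ = k (g • x)
      rw [hkG, ← hy, actState_evalState]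
    · obtain ⟨y, hy⟩ := isStronglyProximal_iff.1 hY.stronglyProximal _ (hkst x₀)
      have hcl : closure (Set.range fun g : G => actState g (k x₀)) ⊆ Set.range k :=
        closure_minimal (by rintro _ ⟨g, rfl⟩; exact ⟨g • x₀, hkG g x₀⟩)
          (isCompact_range hk).isClosed
      obtain ⟨x, hx⟩ := hcl hy
      exact Set.Nonempty.ne_empty ⟨x, y, hx.symm⟩
  have hex : ∀ x, ∃ y, evalState y = k x := fun x => by
    have : x ∈ k ⁻¹' Set.range evalState := hA ▸ Set.mem_univ x
    exact this
  choose f hf using hex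
  have hfc : Continuous f := by
    rw [hev.isInducing.continuous_iff]
    convert hk using 1
    exact funext hf
  have hfG : ∀ (g : G) x, f (g • x) = g • f x := fun g x => evalState_injective <| by
    rw [hf, hkG, ← hf, actState_evalState]
  refine ⟨f, hfc, ?_, hfG⟩
  rw [← Set.range_eq_univ]
  refine (eq_empty_or_univ_of_smul_invariant_closed G (isCompact_range hfc).isClosed
      ?_).resolve_left (Set.Nonempty.ne_empty ⟨f x₀, x₀, rfl⟩)
  rintro g _ ⟨_, ⟨x, rfl⟩, rfl⟩
  exact ⟨g • x, hfG g x⟩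

/-- B is found among the states on the Stone–Čech compactification of G. An orbit map into a
boundary Y extends to that compactification; pushing states forward maps B to states on Y, and these
are point evaluations. -/
theorem exists_furstenbergBoundary (G : Type u) [Group G] :
    ∃ (B : Type u) (_ : TopologicalSpace B) (_ : MulAction G B), IsFurstenbergBoundary G B := by
  let _ := ultrafilterAction G G
  have := ultrafilterAction_continuous G G
  obtain ⟨B, _, _, j, hB, hj, -, hjst, hjG⟩ :=
    exists_boundary_stateSpace (G := G) (W := Ultrafilter G)
  refine ⟨B, inferInstance, inferInstance, hB, fun Y _ _ hY => ?_⟩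
  have := hY.compact
  have := hY.t2
  have := hY.continuous_smul
  obtain ⟨y₀⟩ := hY.nonempty
  let q : Ultrafilter G → Y := Ultrafilter.extend fun g => g • y₀
  have hq : Continuous q := continuous_ultrafilter_extend _
  have hqp : ∀ g : G, q (pure g) = g • y₀ := fun g =>
    congrFun (ultrafilter_extend_extends fun g : G => g • y₀) g
  have hqG : ∀ (g : G) p, q (g • p) = g • q p := fun g => by
    refine fun p => congrFun (denseRange_pure.equalizer (hq.comp (continuous_const_smul g))
      ((continuous_const_smul g).comp hq) ?_) p
    funext h
    have : g • (pure h : Ultrafilter G) = pure (g * h) := Ultrafilter.map_pure _ _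
    simp only [Function.comp, this, hqp, mul_smul]
  refine exists_factorMap_of_stateSpace hB.toIsCompactGSpace hB.minimal hY
    (fun x f => j x (f.comp ⟨q, hq⟩)) ?_ (fun x => (hjst x).comp _) fun g x => ?_
  · exact continuous_pi fun f => (continuous_apply _).comp hj
  · funext f
    simp only [hjG, actState]
    congr 1
    ext p
    simp [hqG]

/-! ### The Chabauty topology and stabilizers -/

theorem mem_closure_chabauty {G : Type*} [Group G] {S : Set (Subgroup G)} {H : Subgroup G} :
    (letI := chabautyTopology G; H ∈ closure S) ↔
      ∀ A : Finset G, ∃ K ∈ S, ∀ a ∈ A, (a ∈ K ↔ a ∈ H) := by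
  classical
  let _ := chabautyTopology G
  rw [closure_induced, mem_closure_iff_nhds]
  constructor
  · intro h A
    obtain ⟨_, hKA, K, hK, rfl⟩ := h (Set.pi A fun a => {decide (a ∈ H)})
      (set_pi_mem_nhds A.finite_toSet fun a _ => by simp)
    exact ⟨K, hK, fun a ha => by simpa using hKA a ha⟩
  · intro h t ht
    rw [nhds_pi, Filter.mem_pi'] at ht
    obtain ⟨A, s, hs, hst⟩ := ht
    obtain ⟨K, hK, hKA⟩ := h A
    refine ⟨_, hst fun a ha => ?_, K, hK, rfl⟩
    have := mem_of_mem_nhds (hs a)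
    rwa [← decide_eq_decide.2 (hKA a ha)] at this

section stabilizers

variable {G : Type*} [Group G] {X : Type*} [TopologicalSpace X] [MulAction G X]
  [ContinuousConstSMul G X]

theorem isClosed_fixedBy_of_t2 [T2Space X] (g : G) : IsClosed (MulAction.fixedBy X g) :=
  isClosed_eq (continuous_const_smul g) continuous_id

/-- Being moved by g is an open condition, so only the elements fixing x constrain continuity: the
stabilizer must equal the germ stabilizer. -/
theorem mem_stabContinuityPoints [T2Space X] {x : X} : x ∈ stabContinuityPoints G X ↔
    ∀ g : G, g • x = x → x ∈ interior (MulAction.fixedBy X g) := by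
  classical
  let _ := chabautyTopology G
  have hind : IsInducing fun (H : Subgroup G) (g : G) => decide (g ∈ H) := ⟨rfl⟩
  change ContinuousAt _ _ ↔ _
  rw [hind.continuousAt_iff, continuousAt_pi]
  refine forall_congr' fun g => ?_
  simp only [ContinuousAt, Function.comp, nhds_discrete, tendsto_pure, decide_eq_decide,
    MulAction.mem_stabilizer_iff, mem_interior_iff_mem_nhds]
  constructor
  · intro h hg
    filter_upwards [h] with y hy
    exact hy.2 hg
  · intro h
    by_cases hg : g • x = x
    · filter_upwards [h hg] with y hy
      exact iff_of_true hy hg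
    · filter_upwards [(isClosed_fixedBy_of_t2 g).isOpen_compl.mem_nhds hg] with y hy
      exact iff_of_false hy hg

/-- Baire: discontinuities lie on the frontiers of the countably many closed fixed sets. -/
theorem dense_stabContinuityPoints [Countable G] [T2Space X] [CompactSpace X] :
    Dense (stabContinuityPoints G X) := by
  have h : Dense (⋂ g : G, (frontier (MulAction.fixedBy X g))ᶜ) := by
    refine dense_iInter_of_isOpen (fun g => isClosed_frontier.isOpen_compl) fun g => ?_
    rw [← interior_eq_empty_iff_dense_compl]
    exact interior_frontier (isClosed_fixedBy_of_t2 g)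
  refine h.mono fun x hx => mem_stabContinuityPoints.2 fun g hg => ?_
  have h1 := Set.mem_iInter.1 hx g
  rw [(isClosed_fixedBy_of_t2 g).frontier_eq] at h1
  by_contra h2
  exact h1 ⟨hg, h2⟩

/-- A closed conjugation-invariant set of subgroups that meets the closure of the set of
stabilizers of a minimal space contains its stabilizer URS. -/
theorem stabilizerURS_subset [CompactSpace X] [MulAction.IsMinimal G X] {C : Set (Subgroup G)}
    (hC : letI := chabautyTopology G; IsClosed C)
    (hconj : ∀ (g : G), ∀ H ∈ C, H.map (MulAut.conj g).toMonoidHom ∈ C) {H : Subgroup G}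
    (hH : H ∈ C)
    (hH' : letI := chabautyTopology G; H ∈ closure (Set.range fun x : X => MulAction.stabilizer G x)) :
    stabilizerURS G X ⊆ C := by
  classical
  let _ := chabautyTopology G
  refine closure_minimal ?_ hC
  rintro _ ⟨x, hx, rfl⟩
  rw [← hC.closure_eq]
  refine mem_closure_chabauty.2 fun A => ?_
  have hind : IsInducing fun (H : Subgroup G) (g : G) => decide (g ∈ H) := ⟨rfl⟩
  have hx' : ∀ a : G, ∀ᶠ y in 𝓝 x, (a • y = y ↔ a • x = x) := by
    have hx : ContinuousAt (fun y : X => MulAction.stabilizer G y) x := hx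
    rw [hind.continuousAt_iff, continuousAt_pi] at hx
    simpa only [ContinuousAt, Function.comp, nhds_discrete, tendsto_pure, decide_eq_decide,
      MulAction.mem_stabilizer_iff] using hx
  have hU : ∀ᶠ y in 𝓝 x, ∀ a ∈ A, (a • y = y ↔ a • x = x) :=
    (Filter.eventually_all_finset A).2 fun a _ => hx' a
  obtain ⟨U, hUA, hUo, hxU⟩ := eventually_nhds_iff.1 hU
  -- Finitely many translates of U cover X. A stabilizer agreeing with H on all conjugates of A by
  -- these finitely many elements belongs to a point that one of them carries back into U.
  obtain ⟨B, hB⟩ := isCompact_univ.exists_finite_cover_smul G hUo ⟨x, hxU⟩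
  obtain ⟨_, ⟨y, rfl⟩, hy⟩ := mem_closure_chabauty.1 hH'
    (B.biUnion fun g => A.image fun a => g * a * g⁻¹)
  obtain ⟨g, hgB, hgy⟩ := Set.mem_iUnion₂.1 (hB (Set.mem_univ y))
  rw [Set.mem_smul_set_iff_inv_smul_mem] at hgy
  refine ⟨_, hconj g⁻¹ H hH, fun a ha => ?_⟩
  have h1 := hy (g * a * g⁻¹) (Finset.mem_biUnion.2 ⟨g, hgB, Finset.mem_image_of_mem _ ha⟩)
  have h2 := hUA _ hgy a ha
  rw [MulAction.mem_stabilizer_iff, mul_smul, mul_smul, smul_eq_iff_eq_inv_smul] at h1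
  rw [MulAction.mem_stabilizer_iff, ← h2, h1]
  constructor
  · rintro ⟨b, hb, rfl⟩
    simpa [mul_assoc] using hb
  · exact fun hb => ⟨_, hb, by simp [mul_assoc]⟩

end stabilizers

set_option linter.unusedSectionVars false

/-! ### Extremely proximal actions -/

/-- An action is extremely proximal if every proper closed subset can be moved into every non-empty
open subset. -/
def IsExtremelyProximal (G : Type*) [Group G] (Z : Type*) [TopologicalSpace Z] [MulAction G Z] :
    Prop :=
  ∀ C : Set Z, IsClosed C → C ≠ Set.univ → ∀ U : Set Z, IsOpen U → U.Nonempty →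
    ∃ g : G, ∀ z ∈ C, g • z ∈ U

/-- The subgroup generated by the elements fixing some non-empty open set pointwise. -/
def germSubgroup (G : Type*) [Group G] (Z : Type*) [TopologicalSpace Z] [MulAction G Z] :
    Subgroup G :=
  Subgroup.closure {h : G | (interior (MulAction.fixedBy Z h)).Nonempty}

section basic

variable {G : Type*} [Group G] {Z : Type*} [TopologicalSpace Z] [MulAction G Z]
  [ContinuousConstSMul G Z]

theorem smul_mem_interior_fixedBy_iff (g h : G) (z : Z) :
    g • z ∈ interior (MulAction.fixedBy Z h) ↔ z ∈ interior (MulAction.fixedBy Z (g⁻¹ * h * g)) := by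
  have h1 : (fun z : Z => g • z) ⁻¹' MulAction.fixedBy Z h =
      MulAction.fixedBy Z (g⁻¹ * h * g) := by
    ext y
    simp only [Set.mem_preimage, MulAction.mem_fixedBy, mul_smul, inv_smul_eq_iff]
  have h2 := (Homeomorph.smul g : Z ≃ₜ Z).preimage_interior (MulAction.fixedBy Z h)
  change z ∈ (Homeomorph.smul g : Z ≃ₜ Z) ⁻¹' interior (MulAction.fixedBy Z h) ↔ _
  rw [h2, ← h1]
  rfl

/-- Otherwise an orbit closure could be moved into its own complement. -/
theorem IsExtremelyProximal.isMinimal (h : IsExtremelyProximal G Z) : MulAction.IsMinimal G Z := by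
  refine ⟨fun z => ?_⟩
  by_contra hd
  obtain ⟨g, hg⟩ := h (closure (MulAction.orbit G z)) isClosed_closure
    (fun hu => hd (dense_iff_closure_eq.2 hu)) _ isClosed_closure.isOpen_compl
    (Set.nonempty_compl.2 fun hu => hd (dense_iff_closure_eq.2 hu))
  refine hg z (subset_closure (MulAction.mem_orbit_self z)) ?_
  exact subset_closure (MulAction.mem_orbit z g)

/-- A normal subgroup acting non-trivially acts minimally. -/
theorem IsExtremelyProximal.eq_univ_of_invariant [T2Space Z] (h : IsExtremelyProximal G Z)
    {N : Subgroup G} [hN : N.Normal] (hne : ∃ n ∈ N, ∃ z : Z, n • z ≠ z) {C : Set Z}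
    (hC : IsClosed C) (hCne : C.Nonempty) (hinv : ∀ n ∈ N, ∀ z ∈ C, n • z ∈ C) : C = Set.univ := by
  by_contra hCu
  obtain ⟨n, hn, z, hz⟩ := hne
  obtain ⟨U, V, hU, hV, hzU, hzV, hUV⟩ := t2_separation hz
  -- The target set is disjoint from its image under n. Moving C into it by g while the conjugate
  -- g⁻¹ n g preserves C puts n g c in both.
  obtain ⟨g, hg⟩ := h C hC hCu (V ∩ (fun y => n • y) ⁻¹' U)
    (hV.inter (hU.preimage (continuous_const_smul n))) ⟨z, hzV, hzU⟩
  obtain ⟨c, hc⟩ := hCne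
  have h1 := hg _ (hinv _ (by simpa using hN.conj_mem n hn g⁻¹) c hc)
  rw [← mul_smul, show g * (g⁻¹ * n * g) = n * g by group, mul_smul] at h1
  exact hUV.le_bot ⟨(hg c hc).2, h1.1⟩

/-- Extremely proximal actions on infinite compact spaces are strongly proximal. -/
theorem IsExtremelyProximal.isStronglyProximal [CompactSpace Z] [T2Space Z] [Infinite Z]
    (h : IsExtremelyProximal G Z) : IsStronglyProximal G Z := by
  classical
  rw [isStronglyProximal_iff]
  intro φ hφ
  obtain ⟨w⟩ := (inferInstance : Nonempty Z)
  refine ⟨w, ?_⟩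
  rw [mem_closure_iff_nhds]
  intro t ht
  rw [nhds_pi, Filter.mem_pi'] at ht
  obtain ⟨I, s, hs, hst⟩ := ht
  obtain ⟨ε, hε, hεs⟩ : ∃ ε > 0, ∀ f ∈ I, Metric.ball (f w) ε ⊆ s f := by
    have h1 : ∀ᶠ ε in 𝓝[>] (0 : ℝ), ∀ f ∈ I, Metric.ball (f w) ε ⊆ s f := by
      refine (Filter.eventually_all_finset I).2 fun f _ => ?_
      obtain ⟨ε, hε, hεs⟩ := Metric.mem_nhds_iff.1 (hs f)
      filter_upwards [Ioo_mem_nhdsGT hε] with δ hδ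
      exact (Metric.ball_subset_ball hδ.2.le).trans hεs
    obtain ⟨ε, hε, h0⟩ := (h1.and self_mem_nhdsWithin).exists
    exact ⟨ε, h0, hε⟩
  -- the total deviation from the values at `w`
  let D : C(Z, ℝ) := ∑ f ∈ I, |f - ContinuousMap.const Z (f w)|
  have hDapp : ∀ z, D z = ∑ f ∈ I, |f z - f w| := fun z => by simp [D]
  have hD0 : ∀ z, 0 ≤ D z := fun z => by rw [hDapp]; positivity
  -- Each of n disjoint open sets has its complement moved to where D < ε / 2. At any point at most
  -- one of the n translated functions is large, so they sum to at most n ε / 2 + ‖D‖ < n ε, and φ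
  -- makes one of them smaller than ε.
  obtain ⟨n, hn⟩ := exists_nat_gt (2 * ‖D‖ / ε)
  have hn0 : 0 < (n : ℝ) := lt_of_le_of_lt (by positivity) hn
  obtain ⟨A, hA⟩ := Infinite.exists_subset_card_eq Z n
  obtain ⟨V, hV, hVd⟩ := A.finite_toSet.t2_separation
  have hU : IsOpen {z | D z < ε / 2} := isOpen_lt D.continuous continuous_const
  have hwU : w ∈ {z | D z < ε / 2} := by
    simp only [Set.mem_ofPred_eq, hDapp, sub_self, abs_zero, Finset.sum_const_zero]
    positivity
  have hex : ∀ a : Z, ∃ g : G, ∀ z ∈ (V a)ᶜ, D (g • z) < ε / 2 := fun a =>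
    h _ (hV a).2.isClosed_compl (fun hu => by
      have : a ∈ (V a)ᶜ := hu ▸ Set.mem_univ a
      exact this (hV a).1) _ hU ⟨w, hwU⟩
  choose g hg using hex
  let Dg : Z → C(Z, ℝ) := fun a => D.comp ⟨fun z => g a • z, continuous_const_smul (g a)⟩
  have hsum : ∀ z, ∑ a ∈ A, Dg a z ≤ n * (ε / 2) + ‖D‖ := by
    intro z
    have hnorm : ∀ a, Dg a z ≤ ‖D‖ := fun a => (le_abs_self _).trans (D.norm_coe_le_norm _)
    by_cases hz : ∃ a ∈ A, z ∈ V a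
    · obtain ⟨a, ha, hza⟩ := hz
      rw [← Finset.sum_erase_add _ _ ha]
      refine add_le_add ?_ (hnorm a)
      calc ∑ x ∈ A.erase a, Dg x z ≤ ∑ x ∈ A.erase a, ε / 2 := by
            refine Finset.sum_le_sum fun b hb => (hg b z fun hzb => ?_).le
            exact (hVd (Finset.mem_of_mem_erase hb) ha (Finset.ne_of_mem_erase hb)).le_bot
              ⟨hzb, hza⟩
        _ ≤ ∑ x ∈ A, ε / 2 :=
            Finset.sum_le_sum_of_subset_of_nonneg (Finset.erase_subset _ _) fun _ _ _ => by
              positivity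
        _ = n * (ε / 2) := by rw [Finset.sum_const, hA, nsmul_eq_mul]
    · push Not at hz
      calc ∑ a ∈ A, Dg a z ≤ ∑ a ∈ A, ε / 2 :=
            Finset.sum_le_sum fun b hb => (hg b z (hz b hb)).le
        _ = n * (ε / 2) := by rw [Finset.sum_const, hA, nsmul_eq_mul]
        _ ≤ _ := le_add_of_nonneg_right (norm_nonneg _)
  obtain ⟨a, ha, hlt⟩ : ∃ a ∈ A, φ (Dg a) < ε := by
    by_contra! hcon
    have h1 : ∑ a ∈ A, φ (Dg a) ≤ n * (ε / 2) + ‖D‖ := by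
      rw [← hφ.sum, ← hφ.const (n * (ε / 2) + ‖D‖)]
      exact hφ.mono fun z => by simpa using hsum z
    have h2 : (n : ℝ) * ε ≤ ∑ a ∈ A, φ (Dg a) := by
      rw [← hA, ← nsmul_eq_mul, ← Finset.sum_const]
      exact Finset.sum_le_sum hcon
    rw [div_lt_iff₀ hε] at hn
    linarith
  refine ⟨_, hst fun f hf => hεs f hf ?_, g a, rfl⟩
  rw [Metric.mem_ball, Real.dist_eq]
  refine lt_of_le_of_lt ?_ hlt
  have hpt : ∀ z, |f (g a • z) - f w| ≤ Dg a z := fun z => by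
    change _ ≤ D (g a • z)
    rw [hDapp]
    exact Finset.single_le_sum (f := fun f : C(Z, ℝ) => |f (g a • z) - f w|)
      (fun _ _ => abs_nonneg _) hf
  set f' := f.comp ⟨fun z => g a • z, continuous_const_smul (g a)⟩
  change |φ f' - f w| ≤ _
  rw [← hφ.const (f w), ← hφ.sub, abs_le, ← hφ.neg]
  exact ⟨hφ.mono fun z => (abs_le.1 (hpt z)).1, hφ.mono fun z => (abs_le.1 (hpt z)).2⟩

theorem IsExtremelyProximal.isBoundary [CompactSpace Z] [T2Space Z] [Infinite Z]
    (h : IsExtremelyProximal G Z) : IsBoundary G Z :=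
  ⟨⟨inferInstance, inferInstance, inferInstance, inferInstance⟩, h.isMinimal,
    h.isStronglyProximal⟩

end basic

/-! ### Germ stabilizers and boundaries -/

/-- The points of `Z` whose germ stabilizer fixes `x`. -/
def germFixer (G : Type*) [Group G] {X : Type*} [MulAction G X] (Z : Type*) [TopologicalSpace Z]
    [MulAction G Z] (x : X) : Set Z :=
  {z | ∀ h : G, z ∈ interior (MulAction.fixedBy Z h) → h • x = x}

/-- Every compact `G`-space carries a state fixed by the germ stabilizer of some point of `Z`. -/
def HasAmenableGerms (G : Type u) [Group G] (Z : Type u) [TopologicalSpace Z] [MulAction G Z] :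
    Prop :=
  ∀ (X : Type u) [TopologicalSpace X] [MulAction G X] [ContinuousConstSMul G X] [CompactSpace X]
    [T2Space X] [Nonempty X], ∃ (z : Z) (φ : C(X, ℝ) → ℝ), IsState φ ∧
      ∀ h : G, z ∈ interior (MulAction.fixedBy Z h) → actState h φ = φ

section germs

variable {G : Type u} [Group G] {Z : Type u} [TopologicalSpace Z] [MulAction G Z]
  [ContinuousConstSMul G Z] {X : Type u} [TopologicalSpace X] [MulAction G X]

theorem smul_mem_germFixer {x : X} {z : Z} (h : z ∈ germFixer G Z x) (g : G) :
    g • z ∈ germFixer G Z (g • x) := by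
  intro k hk
  have := h _ ((smul_mem_interior_fixedBy_iff g k z).1 hk)
  rwa [mul_smul, mul_smul, inv_smul_eq_iff] at this

/-- Each h requires z to avoid an open set or x to lie in a closed one. Closedness allows the
relation to be projected along compact factors. -/
theorem isClosed_germFixer_graph [ContinuousConstSMul G X] [T2Space X] :
    IsClosed {p : X × Z | p.2 ∈ germFixer G Z p.1} := by
  have : {p : X × Z | p.2 ∈ germFixer G Z p.1} =
      ⋂ h : G, {p | p.2 ∈ (interior (MulAction.fixedBy Z h))ᶜ} ∪ {p | h • p.1 = p.1} := by
    ext p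
    simp only [germFixer, Set.mem_ofPred_eq, Set.mem_iInter, Set.mem_union, Set.mem_compl_iff,
      imp_iff_not_or]
  rw [this]
  exact isClosed_iInter fun h => (isOpen_interior.isClosed_compl.preimage continuous_snd).union
    (isClosed_eq ((continuous_const_smul h).comp continuous_fst) continuous_fst)

/-- Invariance of a state under the germ stabilizer of a point is a closed condition on the pair. By
compactness of Z it survives as translates of φ approach a point evaluation. -/
theorem HasAmenableGerms.exists_mem_germFixer [CompactSpace Z] (hAm : HasAmenableGerms G Z)
    (hX : IsBoundary G X) : ∃ (x : X) (z : Z), z ∈ germFixer G Z x := by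
  have := hX.nonempty
  have := hX.compact
  have := hX.t2
  have := hX.continuous_smul
  obtain ⟨z, φ, hφ, hφz⟩ := hAm X
  obtain ⟨x, hx⟩ := isStronglyProximal_iff.1 hX.stronglyProximal φ hφ
  let R : Set ((C(X, ℝ) → ℝ) × Z) :=
    ⋂ h : G, {p | p.2 ∈ (interior (MulAction.fixedBy Z h))ᶜ} ∪ {p | actState h p.1 = p.1}
  have hR : IsClosed R :=
    isClosed_iInter fun h => (isOpen_interior.isClosed_compl.preimage continuous_snd).union
      (isClosed_eq ((continuous_actState h).comp continuous_fst) continuous_fst)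
  have hmem : ∀ p, p ∈ R ↔ ∀ h : G, p.2 ∈ interior (MulAction.fixedBy Z h) →
      actState h p.1 = p.1 := by
    intro p
    simp only [R, Set.mem_ofPred_eq, Set.mem_iInter, Set.mem_union, Set.mem_compl_iff,
      imp_iff_not_or]
  have hcl : closure (Set.range fun g : G => actState g φ) ⊆ Prod.fst '' R := by
    refine closure_minimal ?_ (isClosedMap_fst_of_compactSpace R hR)
    rintro _ ⟨g, rfl⟩
    refine ⟨(actState g φ, g • z), (hmem _).2 fun h hh => ?_, rfl⟩
    have h1 := hφz _ ((smul_mem_interior_fixedBy_iff g h z).1 hh)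
    calc actState h (actState g φ) = actState g (actState (g⁻¹ * h * g) φ) := by
          rw [← actState_mul, ← actState_mul]; congr 1; group
      _ = actState g φ := by rw [h1]
  obtain ⟨⟨ψ, y⟩, hψ, rfl : ψ = _⟩ := hcl hx
  refine ⟨x, y, fun h hh => evalState_injective ?_⟩
  exact (hmem _).1 hψ h hh

/-- The projection of the relation to X is closed, invariant and non-empty, so minimality makes it
everything; the same argument on the side of Z gives the next lemma. -/
theorem HasAmenableGerms.germFixer_nonempty [CompactSpace Z] (hAm : HasAmenableGerms G Z)
    (hX : IsBoundary G X) (x : X) : (germFixer G Z x).Nonempty := by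
  have := hX.t2
  have := hX.continuous_smul
  have := hX.minimal
  obtain ⟨x₀, z₀, h₀⟩ := hAm.exists_mem_germFixer hX
  have hcl : IsClosed (Prod.fst '' {p : X × Z | p.2 ∈ germFixer G Z p.1}) :=
    isClosedMap_fst_of_compactSpace _ isClosed_germFixer_graph
  have := (eq_empty_or_univ_of_smul_invariant_closed G hcl ?_).resolve_left
    (Set.Nonempty.ne_empty ⟨x₀, (x₀, z₀), h₀, rfl⟩)
  · obtain ⟨⟨x', z⟩, hz, rfl⟩ := this.symm ▸ Set.mem_univ x
    exact ⟨z, hz⟩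
  · rintro g _ ⟨_, ⟨⟨x, z⟩, hz, rfl⟩, rfl⟩
    exact ⟨(g • x, g • z), smul_mem_germFixer hz g, rfl⟩

theorem HasAmenableGerms.exists_mem_germFixer_of_point [CompactSpace Z] [MulAction.IsMinimal G Z]
    (hAm : HasAmenableGerms G Z) (hX : IsBoundary G X) (z : Z) : ∃ x : X, z ∈ germFixer G Z x := by
  have := hX.t2
  have := hX.compact
  have := hX.continuous_smul
  obtain ⟨x₀, z₀, h₀⟩ := hAm.exists_mem_germFixer hX
  have hcl : IsClosed (Prod.snd '' {p : X × Z | p.2 ∈ germFixer G Z p.1}) :=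
    isClosedMap_snd_of_compactSpace _ isClosed_germFixer_graph
  have := (eq_empty_or_univ_of_smul_invariant_closed G hcl ?_).resolve_left
    (Set.Nonempty.ne_empty ⟨z₀, (x₀, z₀), h₀, rfl⟩)
  · obtain ⟨⟨x', z⟩, hz, rfl⟩ := this.symm ▸ Set.mem_univ z
    exact ⟨x', hz⟩
  · rintro g _ ⟨_, ⟨⟨x, z⟩, hz, rfl⟩, rfl⟩
    exact ⟨(g • x, g • z), smul_mem_germFixer hz g, rfl⟩

/-- Germ stabilizers are permuted by conjugation. If all of them fixed x, they would fix its orbit,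
which is dense, and so act trivially. -/
theorem germFixer_ne_univ (hX : IsBoundary G X)
    (hne : ∃ n ∈ germSubgroup G Z, ∃ x : X, n • x ≠ x) (x : X) : germFixer G Z x ≠ Set.univ := by
  intro hu
  have := hX.t2
  have := hX.continuous_smul
  have := hX.minimal
  have hall : ∀ g : G, germFixer G Z (g • x) = Set.univ := fun g => by
    refine Set.eq_univ_of_forall fun z => ?_
    have := smul_mem_germFixer (x := x) (z := g⁻¹ • z) (hu ▸ Set.mem_univ _) g
    rwa [smul_inv_smul] at this
  obtain ⟨n, hn, y, hy⟩ := hne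
  refine hy ?_
  have : germSubgroup G Z ≤ (MulAction.toPermHom G X).ker := by
    refine (Subgroup.closure_le _).2 ?_
    rintro h ⟨z, hz⟩
    refine MonoidHom.mem_ker.2 (Equiv.ext fun y => ?_)
    have hcl := (isClosed_fixedBy_of_t2 (X := X) h).closure_subset_iff.2
      (show MulAction.orbit G x ⊆ _ from ?_)
    · exact hcl (MulAction.dense_orbit G x y)
    · rintro _ ⟨g, rfl⟩
      exact (show z ∈ germFixer G Z (g • x) from hall g ▸ Set.mem_univ z) h hz
  exact DFunLike.congr_fun (MonoidHom.mem_ker.1 (this hn)) y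

theorem isClosed_germFixer [ContinuousConstSMul G X] [T2Space X] (x : X) :
    IsClosed (germFixer G Z x) :=
  (isClosed_germFixer_graph (G := G) (X := X) (Z := Z)).preimage (Continuous.prodMk_right x)

/-- Stabilizers of points of continuity in `Z` are limits of stabilizers in any boundary on which
the germ subgroup acts non-trivially. -/
theorem stabilizer_mem_closure [CompactSpace Z] [T2Space Z] (hEP : IsExtremelyProximal G Z)
    (hAm : HasAmenableGerms G Z) (hX : IsBoundary G X)
    (hne : ∃ n ∈ germSubgroup G Z, ∃ x : X, n • x ≠ x) {w : Z} (hw : w ∈ stabContinuityPoints G Z) :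
    letI := chabautyTopology G
    MulAction.stabilizer G w ∈ closure (Set.range fun x : X => MulAction.stabilizer G x) := by
  classical
  have := hX.t2
  have := hX.continuous_smul
  obtain ⟨x⟩ := hX.nonempty
  refine mem_closure_chabauty.2 fun A => ?_
  -- As w is a continuity point, near w each a either acts trivially or displaces a whole
  -- neighbourhood off itself.
  have hloc : ∀ a : G, ∃ U : Set Z, IsOpen U ∧ w ∈ U ∧
      ((a • w = w ∧ U ⊆ interior (MulAction.fixedBy Z a)) ∨
        (a • w ≠ w ∧ ∀ z ∈ U, a • z ∉ U)) := by
    intro a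
    by_cases ha : a • w = w
    · exact ⟨_, isOpen_interior, mem_stabContinuityPoints.1 hw a ha, Or.inl ⟨ha, subset_rfl⟩⟩
    · obtain ⟨U, V, hU, hV, hzU, hzV, hUV⟩ := t2_separation ha
      exact ⟨V ∩ (fun y => a • y) ⁻¹' U, hV.inter (hU.preimage (continuous_const_smul a)),
        ⟨hzV, hzU⟩, Or.inr ⟨ha, fun z hz hz' => hUV.le_bot ⟨hz.2, hz'.1⟩⟩⟩
  choose U hUo hwU hU using hloc
  -- Once the ends related to g • x all lie in every `U a`, an a trivial on `U a` fixes g • x. An a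
  -- that displaces `U a` cannot, since it would preserve this non-empty set of ends.
  obtain ⟨g, hg⟩ := hEP (germFixer G Z x) (isClosed_germFixer x) (germFixer_ne_univ hX hne x)
    (⋂ a ∈ A, U a) (isOpen_biInter_finset fun a _ => hUo a) ⟨w, Set.mem_iInter₂.2 fun a _ => hwU a⟩
  obtain ⟨z, hz⟩ := hAm.germFixer_nonempty hX x
  refine ⟨_, ⟨g • x, rfl⟩, fun a ha => ?_⟩
  simp only [MulAction.mem_stabilizer_iff]
  have hgz : ∀ z ∈ germFixer G Z x, g • z ∈ U a := fun z hz => Set.mem_iInter₂.1 (hg z hz) a ha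
  rcases hU a with ⟨haw, hsub⟩ | ⟨haw, hdisj⟩
  · exact iff_of_true (smul_mem_germFixer hz g a (hsub (hgz z hz))) haw
  · refine iff_of_false (fun hax => ?_) haw
    have h1 : (g⁻¹ * a * g) • z ∈ germFixer G Z x := by
      have h2 := smul_mem_germFixer hz (g⁻¹ * a * g)
      rwa [mul_smul, mul_smul, hax, inv_smul_smul] at h2
    have h3 := hgz _ h1
    rw [← mul_smul, show g * (g⁻¹ * a * g) = a * g by group, mul_smul] at h3
    exact hdisj _ (hgz z hz) h3

theorem isClosed_stabilizerURS (G X : Type*) [Group G] [TopologicalSpace X] [MulAction G X] :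
    letI := chabautyTopology G
    IsClosed (stabilizerURS G X) := by
  let _ := chabautyTopology G
  exact isClosed_closure

theorem stabilizerURS_subset_closure (G X : Type*) [Group G] [TopologicalSpace X] [MulAction G X] :
    letI := chabautyTopology G
    stabilizerURS G X ⊆ closure (Set.range fun x : X => MulAction.stabilizer G x) := by
  let _ := chabautyTopology G
  refine closure_mono ?_
  rintro _ ⟨x, -, rfl⟩
  exact ⟨x, rfl⟩

theorem stabilizer_mem_stabilizerURS {G X : Type*} [Group G] [TopologicalSpace X] [MulAction G X]
    {x : X} (hx : x ∈ stabContinuityPoints G X) : MulAction.stabilizer G x ∈ stabilizerURS G X := by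
  let _ := chabautyTopology G
  exact subset_closure ⟨x, hx, rfl⟩

/-- `stabilizer_mem_closure` puts the URS of X inside that of Z; a common member then gives the
reverse inclusion, again by `stabilizerURS_subset`. -/
theorem stabilizerURS_eq [Countable G] [CompactSpace Z] [T2Space Z] [Nonempty Z]
    (hEP : IsExtremelyProximal G Z) (hAm : HasAmenableGerms G Z) (hX : IsBoundary G X)
    (hne : ∃ n ∈ germSubgroup G Z, ∃ x : X, n • x ≠ x) :
    stabilizerURS G X = stabilizerURS G Z := by
  have := hX.t2
  have := hX.compact
  have := hX.nonempty
  have := hX.continuous_smul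
  have := hX.minimal
  have := hEP.isMinimal
  obtain ⟨w, hw⟩ := (dense_stabContinuityPoints (G := G) (X := Z)).nonempty
  obtain ⟨x, hx⟩ := (dense_stabContinuityPoints (G := G) (X := X)).nonempty
  have h1 : stabilizerURS G X ⊆ stabilizerURS G Z :=
    stabilizerURS_subset (isClosed_stabilizerURS G Z) (fun g H hH => stabilizerURS_conj g hH)
      (stabilizer_mem_stabilizerURS hw) (stabilizer_mem_closure hEP hAm hX hne hw)
  refine h1.antisymm ?_
  have hxX := stabilizer_mem_stabilizerURS hx
  exact stabilizerURS_subset (isClosed_stabilizerURS G X) (fun g H hH => stabilizerURS_conj g hH)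
    hxX (stabilizerURS_subset_closure G Z (h1 hxX))

/-- Z is itself a boundary, hence a factor of B, so non-triviality of the action of the germ
subgroup lifts from Z to B. -/
theorem furstenbergURS_eq [Countable G] [CompactSpace Z] [T2Space Z] [Infinite Z]
    (hEP : IsExtremelyProximal G Z) (hAm : HasAmenableGerms G Z)
    (hne : ∃ n ∈ germSubgroup G Z, ∃ z : Z, n • z ≠ z) :
    furstenbergURS G = stabilizerURS G Z := by
  have key : ∀ (B : Type u) [TopologicalSpace B] [MulAction G B], IsFurstenbergBoundary G B →
      stabilizerURS G B = stabilizerURS G Z := by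
    intro B _ _ hB
    obtain ⟨f, hf⟩ := hB.universal Z hEP.isBoundary
    refine stabilizerURS_eq hEP hAm hB.toIsBoundary ?_
    obtain ⟨n, hn, z, hz⟩ := hne
    obtain ⟨b, rfl⟩ := hf.surjective z
    exact ⟨n, hn, b, fun h => hz (by rw [← hf.map_smul, h])⟩
  ext H
  constructor
  · rintro ⟨B, _, _, hB, hH⟩
    exact key B hB ▸ hH
  · intro hH
    obtain ⟨B, _, _, hB⟩ := exists_furstenbergBoundary G
    exact ⟨B, _, _, hB, (key B hB).symm ▸ hH⟩

/-- Stabilizers of continuity points are germ stabilizers, and by density a continuity point lies in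
any open set fixed by an element. -/
theorem envelope_stabilizerURS [Countable G] [CompactSpace Z] [T2Space Z] :
    envelope (stabilizerURS G Z) = germSubgroup G Z := by
  apply le_antisymm
  · refine sSup_le fun H hH g hg => ?_
    obtain ⟨_, ⟨z, hz, rfl⟩, hK⟩ := mem_closure_chabauty.1 hH {g}
    have h1 := (hK g (Finset.mem_singleton_self g)).2 hg
    exact Subgroup.subset_closure ⟨z, mem_stabContinuityPoints.1 hz g h1⟩
  · refine (Subgroup.closure_le _).2 fun g hg => ?_
    obtain ⟨z, hz, hzg⟩ := dense_stabContinuityPoints (G := G) (X := Z) |>.inter_open_nonempty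
      _ isOpen_interior hg
    have h2 : g • z = z := MulAction.mem_fixedBy.1 (interior_subset hz)
    exact le_sSup (α := Subgroup G) (stabilizer_mem_stabilizerURS hzg) h2

/-- If N acted trivially it would fix an evaluation, so co-amenability would give a G-invariant
state. Strong proximality turns that into a global fixed point, contrary to minimality. -/
theorem IsCoamenable.exists_smul_ne {N : Subgroup G} (hN : IsCoamenable N) (hX : IsBoundary G X)
    (hX' : Nontrivial X) : ∃ n ∈ N, ∃ x : X, n • x ≠ x := by
  by_contra! hcon
  have := hX.t2
  have := hX.compact
  have := hX.nonempty
  have := hX.continuous_smul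
  have := hX.minimal
  have hinv : ∀ (g : G), ∀ φ ∈ stateSpace X, actState g φ ∈ stateSpace X :=
    fun g φ hφ => IsState.act hφ g
  let _ := invariantAction (stateSpace X) hinv
  obtain ⟨⟨φ, hφ⟩, hfix⟩ := hN (C(X, ℝ) → ℝ) (stateSpace X) (convex_stateSpace X)
    (isCompact_stateSpace X) (invariantAction_continuous _ hinv)
    (fun g x y z a b _ _ _ hz => by
      change actState g (z : C(X, ℝ) → ℝ) = _
      rw [hz, actState_linear]; rfl)
    ⟨⟨evalState hX.nonempty.some, IsState.eval _⟩, fun n hn => Subtype.ext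
      (congrArg evalState (hcon n hn _))⟩
  obtain ⟨x, hx⟩ := isStronglyProximal_iff.1 hX.stronglyProximal φ hφ
  have hr : (Set.range fun g : G => actState g φ) = {φ} := by
    ext ψ
    constructor
    · rintro ⟨g, rfl⟩
      exact congrArg Subtype.val (hfix g)
    · rintro rfl
      exact ⟨1, actState_one _⟩
  rw [hr, closure_singleton, Set.mem_singleton_iff] at hx
  have hgx : ∀ g : G, g • x = x := fun g => evalState_injective <| by
    rw [← actState_evalState, hx]
    exact congrArg Subtype.val (hfix g)
  obtain ⟨y, hy⟩ := exists_ne x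
  have hcl : MulAction.orbit G x ⊆ {x} := by rintro _ ⟨g, rfl⟩; exact hgx g
  exact hy (closure_minimal hcl isClosed_singleton (MulAction.dense_orbit G x y))

/-- The pairs of points related to a common point of Z form a joining of X and Y. It is proper,
because extreme proximality moves the set of points related to y off the one related to x. -/
theorem isBoundaryIndivisible_of_germSubgroup [CompactSpace Z] [T2Space Z]
    (hEP : IsExtremelyProximal G Z) (hAm : HasAmenableGerms G Z)
    (hne : ∀ (X : Type u) [TopologicalSpace X] [MulAction G X], IsBoundary G X → Nontrivial X →
      ∃ n ∈ germSubgroup G Z, ∃ x : X, n • x ≠ x) : IsBoundaryIndivisible G := by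
  intro X Y _ _ _ _ hX hX' hY hY' hdisj
  have := hX.t2
  have := hX.compact
  have := hX.continuous_smul
  have := hY.t2
  have := hY.compact
  have := hY.continuous_smul
  have := hEP.isMinimal
  -- the pairs of points with a common germ
  let R : Set (X × Y) := Prod.fst '' {p : (X × Y) × Z |
    p.2 ∈ germFixer G Z p.1.1 ∧ p.2 ∈ germFixer G Z p.1.2}
  have hRc : IsClosed R := by
    refine isClosedMap_fst_of_compactSpace _ (IsClosed.inter ?_ ?_)
    · exact (isClosed_germFixer_graph (G := G) (X := X) (Z := Z)).preimage
        ((continuous_fst.comp continuous_fst).prodMk continuous_snd)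
    · exact (isClosed_germFixer_graph (G := G) (X := Y) (Z := Z)).preimage
        ((continuous_snd.comp continuous_fst).prodMk continuous_snd)
  have hRinv : ∀ (g : G), ∀ p ∈ R, g • p ∈ R := by
    rintro g _ ⟨⟨⟨x, y⟩, z⟩, ⟨hx, hy⟩, rfl⟩
    exact ⟨((g • x, g • y), g • z), ⟨smul_mem_germFixer hx g, smul_mem_germFixer hy g⟩, rfl⟩
  let _ : MulAction G R :=
    { smul := fun g p => ⟨g • p.1, hRinv g p p.2⟩
      one_smul := fun p => Subtype.ext (one_smul G p.1)
      mul_smul := fun g h p => Subtype.ext (mul_smul g h p.1) }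
  have hRX : ∀ x : X, ∃ y : Y, (x, y) ∈ R := fun x => by
    obtain ⟨z, hz⟩ := hAm.germFixer_nonempty hX x
    obtain ⟨y, hy⟩ := hAm.exists_mem_germFixer_of_point hY z
    exact ⟨y, ((x, y), z), ⟨hz, hy⟩, rfl⟩
  have hRY : ∀ y : Y, ∃ x : X, (x, y) ∈ R := fun y => by
    obtain ⟨z, hz⟩ := hAm.germFixer_nonempty hY y
    obtain ⟨x, hx⟩ := hAm.exists_mem_germFixer_of_point hX z
    exact ⟨x, ((x, y), z), ⟨hx, hz⟩, rfl⟩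
  obtain ⟨x⟩ := hX.nonempty
  obtain ⟨y⟩ := hY.nonempty
  have hRsp : IsCompactGSpace G R := by
    obtain ⟨y', hy'⟩ := hRX x
    exact ⟨⟨⟨_, hy'⟩⟩, isCompact_iff_compactSpace.1 hRc.isCompact, inferInstance,
      ⟨fun g => Continuous.subtype_mk ((continuous_const_smul g).comp continuous_subtype_val) _⟩⟩
  have hsurj := hdisj R hRsp (fun p => p.1.1) (fun p => p.1.2)
    ⟨continuous_fst.comp continuous_subtype_val,
      fun x => (hRX x).elim fun y h => ⟨⟨_, h⟩, rfl⟩, fun _ _ => rfl⟩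
    ⟨continuous_snd.comp continuous_subtype_val,
      fun y => (hRY y).elim fun x h => ⟨⟨_, h⟩, rfl⟩, fun _ _ => rfl⟩
  obtain ⟨g, hg⟩ := hEP (germFixer G Z y) (isClosed_germFixer y)
    (germFixer_ne_univ hY (hne Y hY hY') y) _ (isClosed_germFixer x).isOpen_compl
    (Set.nonempty_compl.2 (germFixer_ne_univ hX (hne X hX hX') x))
  obtain ⟨⟨_, ⟨⟨p, z⟩, ⟨hzx, hzy⟩, rfl⟩⟩, hp⟩ := hsurj (x, g • y)
  simp only [Prod.mk.injEq] at hp hzx hzy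
  rw [hp.1] at hzx
  rw [hp.2] at hzy
  have h1 := smul_mem_germFixer hzy g⁻¹
  rw [inv_smul_smul] at h1
  have h2 := hg _ h1
  rw [smul_inv_smul] at h2
  exact h2 hzx

/-- A boundary with trivial action of a normal subgroup `N` is disjoint from an extremely proximal
space on which `N` acts non-trivially. -/
theorem areDisjointSpaces_of_trivial [T2Space Z] (hEP : IsExtremelyProximal G Z)
    {N : Subgroup G} [N.Normal] (hne : ∃ n ∈ N, ∃ z : Z, n • z ≠ z)
    (hX : ∀ n ∈ N, ∀ x : X, n • x = x) [T2Space X] : AreDisjointSpaces G X Z := by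
  rintro W _ _ hW p q hp hq ⟨x, z⟩
  have := hW.compact
  -- N preserves the fibres of p, so the image of a fibre in Z is a closed N-invariant set.
  have hC : q '' (p ⁻¹' {x}) = Set.univ := by
    refine hEP.eq_univ_of_invariant hne
      (((isClosed_singleton.preimage hp.continuous).isCompact.image hq.continuous).isClosed) ?_ ?_
    · obtain ⟨w, hw⟩ := hp.surjective x
      exact ⟨q w, w, hw, rfl⟩
    · rintro n hn _ ⟨w, hw, rfl⟩
      refine ⟨n • w, ?_, hq.map_smul n w⟩
      rw [Set.mem_preimage, hp.map_smul, hw, hX n hn]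
      rfl
  obtain ⟨w, hw, rfl⟩ := hC.symm ▸ Set.mem_univ z
  exact ⟨w, Prod.ext hw rfl⟩

/-- A boundary on which a normal subgroup acts trivially has a different stabilizer URS from that
of a minimal space on which it acts non-trivially. -/
theorem stabilizerURS_ne_of_trivial [Countable G] [CompactSpace Z] [T2Space Z] [Nonempty Z]
    [MulAction.IsMinimal G Z] {N : Subgroup G} [hN : N.Normal]
    (hne : ∃ n ∈ N, ∃ z : Z, n • z ≠ z) (hX : ∀ n ∈ N, ∀ x : X, n • x = x) :
    stabilizerURS G X ≠ stabilizerURS G Z := by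
  intro heq
  obtain ⟨w, hw⟩ := (dense_stabContinuityPoints (G := G) (X := Z)).nonempty
  have h1 := stabilizerURS_subset_closure G X
    (heq.symm ▸ stabilizer_mem_stabilizerURS hw : MulAction.stabilizer G w ∈ stabilizerURS G X)
  have h2 : ∀ n ∈ N, n • w = w := fun n hn => by
    obtain ⟨_, ⟨x, rfl⟩, hx⟩ := mem_closure_chabauty.1 h1 {n}
    exact (hx n (Finset.mem_singleton_self n)).1 (hX n hn x)
  obtain ⟨n, hn, z, hz⟩ := hne
  refine hz ?_
  have hcl : closure (MulAction.orbit G w) ⊆ MulAction.fixedBy Z n := by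
    refine closure_minimal ?_ (isClosed_fixedBy_of_t2 n)
    rintro _ ⟨g, rfl⟩
    have := h2 _ (by simpa using hN.conj_mem n hn g⁻¹ : g⁻¹ * n * g ∈ N)
    rwa [mul_smul, mul_smul, inv_smul_eq_iff] at this
  exact hcl (MulAction.dense_orbit G w z)

end germs

/-! ### Co-amenability of subgroups with polycyclic quotient -/

/-- Subgroups obtained from the trivial one by successively adding an element that normalizes
the subgroup reached so far. -/
inductive IsIteratedCyclic {H : Type*} [Group H] : Subgroup H → Prop
  | bot : IsIteratedCyclic ⊥
  | step (L : Subgroup H) (g : H) : IsIteratedCyclic L → (∀ l ∈ L, g⁻¹ * l * g ∈ L) →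
      IsIteratedCyclic (L ⊔ Subgroup.zpowers g)

theorem IsIteratedCyclic.map {H K : Type*} [Group H] [Group K] (f : H →* K) {L : Subgroup H}
    (h : IsIteratedCyclic L) : IsIteratedCyclic (L.map f) := by
  induction h with
  | bot => rw [Subgroup.map_bot]; exact .bot
  | step L g _ hg ih =>
    rw [Subgroup.map_sup, MonoidHom.map_zpowers]
    refine .step _ _ ih ?_
    rintro _ ⟨l, hl, rfl⟩
    exact ⟨_, hg l hl, by simp⟩

/-- A continuous affine self-map of a compact convex set preserving a non-empty closed convex
subset has a fixed point there. -/
theorem exists_fixedPoint_of_affine {E : Type*} [AddCommGroup E] [Module ℝ E] [TopologicalSpace E]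
    [IsTopologicalAddGroup E] [ContinuousSMul ℝ E] [T2Space E] {Q : Set E} (hQ : Convex ℝ Q)
    (hQc : IsCompact Q) (f : Q → Q) (hf : Continuous f)
    (haff : ∀ (x y z : Q) (a b : ℝ), 0 ≤ a → 0 ≤ b → a + b = 1 →
      (z : E) = a • (x : E) + b • (y : E) → (f z : E) = a • (f x : E) + b • (f y : E))
    {S : Set Q} (hS : IsClosed S) (hSne : S.Nonempty) (hSf : ∀ x ∈ S, f x ∈ S)
    (hSconv : ∀ x ∈ S, ∀ y ∈ S, ∀ (z : Q) (a b : ℝ), 0 ≤ a → 0 ≤ b → a + b = 1 →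
      (z : E) = a • (x : E) + b • (y : E) → z ∈ S) : ∃ x ∈ S, f x = x := by
  obtain ⟨x, hx⟩ := hSne
  have hcomp : CompactSpace Q := isCompact_iff_compactSpace.1 hQc
  have hit : ∀ n, f^[n] x ∈ S := fun n => by
    induction n with
    | zero => exact hx
    | succ n ih => rw [Function.iterate_succ_apply']; exact hSf _ ih
  -- Cesàro averages
  have havg : ∀ n : ℕ, ∃ y ∈ S, ((n : ℝ) + 1) • (y : E) = ∑ i ∈ Finset.range (n + 1), (f^[i] x : E) ∧
      ((n : ℝ) + 1) • (f y : E) = ∑ i ∈ Finset.range (n + 1), (f^[i + 1] x : E) := by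
    intro n
    induction n with
    | zero => exact ⟨x, hx, by simp, by simp⟩
    | succ n ih =>
      obtain ⟨y, hyS, hy, hfy⟩ := ih
      have hn : (0 : ℝ) < (n : ℝ) + 1 + 1 := by positivity
      set a : ℝ := ((n : ℝ) + 1) / ((n : ℝ) + 1 + 1)
      set b : ℝ := 1 / ((n : ℝ) + 1 + 1)
      have ha : 0 ≤ a := by positivity
      have hb : 0 ≤ b := by positivity
      have hab : a + b = 1 := by simp only [a, b]; field_simp
      have hna : ((n : ℝ) + 1 + 1) * a = n + 1 := by simp only [a]; field_simp
      have hnb : ((n : ℝ) + 1 + 1) * b = 1 := by simp only [b]; field_simp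
      let z : Q := ⟨a • (y : E) + b • (f^[n + 1] x : E), hQ y.2 (f^[n + 1] x).2 ha hb hab⟩
      refine ⟨z, hSconv y hyS _ (hit (n + 1)) z a b ha hb hab rfl, ?_, ?_⟩
      · rw [Finset.sum_range_succ, ← hy]
        push_cast
        simp only [z, smul_add, smul_smul, hna, hnb, one_smul]
      · rw [Finset.sum_range_succ, ← hfy, haff y _ z a b ha hb hab rfl]
        push_cast
        simp only [smul_add, smul_smul, hna, hnb, one_smul, Function.iterate_succ_apply']
  choose y hyS hy hfy using havg
  obtain ⟨p, -, hp⟩ := isCompact_univ.ultrafilter_le_nhds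
    ((hyperfilter ℕ : Ultrafilter ℕ).map y) (by simp)
  have hlim : Tendsto y (hyperfilter ℕ) (𝓝 p) := hp
  refine ⟨p, hS.mem_of_tendsto hlim (Eventually.of_forall hyS), ?_⟩
  have h1 : Tendsto (fun n => (f (y n) : E) - (y n : E)) (hyperfilter ℕ) (𝓝 ((f p : E) - p)) :=
    ((continuous_subtype_val.comp hf).continuousAt.tendsto.comp hlim).sub
      (continuous_subtype_val.continuousAt.tendsto.comp hlim)
  -- The sums telescope, and the remaining difference ranges over a bounded set, so division by n +
  -- 1 sends it to 0.
  have h2 : ∀ n, (f (y n) : E) - (y n : E) = (1 / ((n : ℝ) + 1)) • ((f^[n + 1] x : E) - x) := by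
    intro n
    have hn : ((n : ℝ) + 1) ≠ 0 := by positivity
    have h3 : ((n : ℝ) + 1) • ((f (y n) : E) - (y n : E)) = (f^[n + 1] x : E) - x := by
      rw [smul_sub, hy, hfy, ← Finset.sum_sub_distrib,
        Finset.sum_range_sub (fun i => (f^[i] x : E))]
      rfl
    rw [← h3, smul_smul, one_div_mul_cancel hn, one_smul]
  have h4 : Tendsto (fun n => (f (y n) : E) - (y n : E)) (hyperfilter ℕ) (𝓝 0) := by
    have hb : Bornology.IsVonNBounded ℝ ((fun p : E × E => p.1 - p.2) '' Q ×ˢ Q) :=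
      ((hQc.prod hQc).image (continuous_fst.sub continuous_snd)).isVonNBounded ℝ
    have h5 := hb.smul_tendsto_zero (l := (hyperfilter ℕ : Filter ℕ))
      (ε := fun n : ℕ => 1 / ((n : ℝ) + 1)) (x := fun n => (f^[n + 1] x : E) - x)
      (Eventually.of_forall fun n => ⟨(_, _), ⟨(f^[n + 1] x).2, x.2⟩, rfl⟩)
      (tendsto_one_div_add_atTop_nhds_zero_nat.mono_left
        (Nat.hyperfilter_le_atTop))
    exact h5.congr fun n => (h2 n).symm
  exact Subtype.ext (sub_eq_zero.1 (tendsto_nhds_unique h1 h4))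

/-- The points fixed by the preimage of L form a closed convex set. A new generator normalizing L
preserves this set, so Markov–Kakutani gives a point fixed by both. -/
theorem IsIteratedCyclic.isCoamenable {G : Type u} {H : Type v} [Group G] [Group H]
    (hH : IsIteratedCyclic (⊤ : Subgroup H)) (f : G →* H) (hf : Function.Surjective f) :
    IsCoamenable f.ker := by
  intro E _ _ _ _ _ _ _ Q _ hQ hQc hcont haff hfix
  have key : ∀ L : Subgroup H, IsIteratedCyclic L → ∃ x : Q, ∀ g ∈ L.comap f, g • x = x := by
    intro L hL
    induction hL with
    | bot => exact hfix
    | step L h _ hh ih =>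
      obtain ⟨g, rfl⟩ := hf h
      let S : Set Q := {x | ∀ k ∈ L.comap f, k • x = x}
      have hSc : IsClosed S := by
        have : S = ⋂ k ∈ L.comap f, {x | k • x = x} := by ext; simp [S]
        rw [this]
        exact isClosed_biInter fun k _ => isClosed_eq (continuous_const_smul k) continuous_id
      have hSg : ∀ x ∈ S, g • x ∈ S := by
        intro x hx k hk
        have h1 := hx (g⁻¹ * k * g) (by simpa using hh _ hk)
        rwa [mul_smul, mul_smul, inv_smul_eq_iff] at h1
      obtain ⟨x, hx, hgx⟩ := exists_fixedPoint_of_affine hQ hQc (fun x => g • x)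
        (continuous_const_smul g) (haff g) (S := S) hSc ih hSg (by
          intro x hx y hy z a b ha hb hab hz k hk
          refine Subtype.ext ?_
          rw [haff k x y z a b ha hb hab hz, hx k hk, hy k hk, hz])
      refine ⟨x, fun k hk => ?_⟩
      have hle : L.comap f ⊔ Subgroup.zpowers g ≤ MulAction.stabilizer G x :=
        sup_le hx ((Subgroup.zpowers_le).2 hgx)
      refine hle ?_
      have h1 : (L ⊔ Subgroup.zpowers (f g)) = (L.comap f ⊔ Subgroup.zpowers g).map f := by
        rw [Subgroup.map_sup, MonoidHom.map_zpowers, Subgroup.map_comap_eq_self_of_surjective hf]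
      have hker : f.ker ≤ L.comap f ⊔ Subgroup.zpowers g := by
        refine le_trans (fun k hk => ?_) le_sup_left
        exact Subgroup.mem_comap.2 ((MonoidHom.mem_ker.1 hk).symm ▸ L.one_mem)
      rwa [h1, Subgroup.comap_map_eq_self hker] at hk
  obtain ⟨x, hx⟩ := key ⊤ hH
  exact ⟨x, fun g => hx g (Subgroup.mem_top _)⟩

theorem isIteratedCyclic_of_isCyclic (H : Type*) [Group H] [IsCyclic H] :
    IsIteratedCyclic (⊤ : Subgroup H) := by
  obtain ⟨g, hg⟩ := IsCyclic.exists_zpow_surjective (G := H)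
  have h := IsIteratedCyclic.step (⊥ : Subgroup H) g .bot (by simp)
  rwa [bot_sup_eq, (Subgroup.eq_top_iff' (Subgroup.zpowers g)).2 fun x => hg x] at h

theorem isIteratedCyclic_dihedralGroup :
    IsIteratedCyclic (⊤ : Subgroup (DihedralGroup 0)) := by
  have h1 := IsIteratedCyclic.step (⊥ : Subgroup (DihedralGroup 0)) (.r 1) .bot (by simp)
  rw [bot_sup_eq] at h1
  have h2 := IsIteratedCyclic.step _ (.sr 0) h1 (by
    rintro _ ⟨k, rfl⟩
    exact ⟨-k, by simp⟩)
  convert h2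
  symm
  rw [Subgroup.eq_top_iff']
  have hr : ∀ i : ZMod 0, DihedralGroup.r i ∈ Subgroup.zpowers (DihedralGroup.r (1 : ZMod 0)) :=
    fun i => ⟨(show ℤ from i), by
      change DihedralGroup.r 1 ^ (show ℤ from i) = _
      rw [DihedralGroup.r_one_zpow]; rfl⟩
  rintro (i | i)
  · exact Subgroup.mem_sup_left (hr i)
  · have : DihedralGroup.sr i = DihedralGroup.sr 0 * DihedralGroup.r i := by simp
    rw [this]
    exact Subgroup.mul_mem _ (Subgroup.mem_sup_right (Subgroup.mem_zpowers _))
      (Subgroup.mem_sup_left (hr i))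

theorem isIteratedCyclic_semidirectProduct {H K : Type*} [Group H] [Group K] [IsCyclic K]
    (hH : IsIteratedCyclic (⊤ : Subgroup H)) (φ : K →* MulAut H) :
    IsIteratedCyclic (⊤ : Subgroup (H ⋊[φ] K)) := by
  obtain ⟨k, hk⟩ := IsCyclic.exists_zpow_surjective (G := K)
  have h2 := IsIteratedCyclic.step _ (SemidirectProduct.inr k) (hH.map SemidirectProduct.inl) (by
    rintro _ ⟨l, -, rfl⟩
    refine ⟨φ k⁻¹ l, trivial, ?_⟩
    rw [SemidirectProduct.inl_aut]
    simp)
  convert h2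
  symm
  rw [Subgroup.eq_top_iff']
  intro x
  rw [← SemidirectProduct.inl_left_mul_inr_right x]
  obtain ⟨n, hn⟩ := hk x.right
  refine Subgroup.mul_mem _ (Subgroup.mem_sup_left ⟨_, trivial, rfl⟩)
    (Subgroup.mem_sup_right ⟨n, ?_⟩)
  simp only [← hn, map_zpow]

/-! ### Coloured trees: developing maps and automorphisms with given local permutations -/

namespace LegalColoring

variable {V : Type*} {T : SimpleGraph V} {Ω : Type*} (c : LegalColoring T Ω)

/-- The neighbour of `v` along the edge coloured `a`. -/
noncomputable def nbr (v : V) (a : Ω) : V := ((c.starEquiv v).symm a : V)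

theorem adj_nbr (v : V) (a : Ω) : T.Adj v (c.nbr v a) := ((c.starEquiv v).symm a).2

theorem color_nbr (v : V) (a : Ω) : c.color ⟨s(v, c.nbr v a), c.adj_nbr v a⟩ = a :=
  (c.starEquiv v).apply_symm_apply a

theorem nbr_color {v w : V} (h : T.Adj v w) : c.nbr v (c.color ⟨s(v, w), h⟩) = w :=
  congrArg Subtype.val ((c.starEquiv v).symm_apply_apply ⟨w, h⟩)

theorem exists_nbr_eq {v w : V} (h : T.Adj v w) : ∃ a, c.nbr v a = w := ⟨_, c.nbr_color h⟩

@[simp]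
theorem nbr_nbr (v : V) (a : Ω) : c.nbr (c.nbr v a) a = v := by
  have h := c.nbr_color (c.adj_nbr v a).symm
  have h2 : c.color ⟨s(c.nbr v a, v), (c.adj_nbr v a).symm⟩ = a := by
    rw [← c.color_nbr v a]
    simp only [Sym2.eq_swap (a := c.nbr v a), c.color_nbr]
  rwa [h2] at h

theorem nbr_injective (v : V) : Function.Injective (c.nbr v) :=
  Subtype.val_injective.comp (c.starEquiv v).symm.injective

@[simp]
theorem nbr_inj {v : V} {a b : Ω} : c.nbr v a = c.nbr v b ↔ a = b := (c.nbr_injective v).eq_iff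

theorem nbr_eq_comm {v w : V} {a : Ω} : c.nbr v a = w ↔ c.nbr w a = v := by
  constructor <;> (rintro rfl; simp)

theorem map_nbr (g : T ≃g T) (v : V) (a : Ω) : g (c.nbr v a) = c.nbr (g v) (c.localPerm g v a) := by
  simp only [nbr, localPerm, Equiv.trans_apply, Equiv.symm_apply_apply]
  rfl

theorem localPerm_eq_of_map_nbr {g : T ≃g T} {v : V} {a b : Ω} (h : g (c.nbr v a) = c.nbr (g v) b) :
    c.localPerm g v a = b := by
  rwa [map_nbr, nbr_inj] at h

/-- An edge has one colour, seen from either end. By `exists_aut` this is the only constraint on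
families of local permutations. -/
theorem localPerm_nbr (g : T ≃g T) (v : V) (a : Ω) :
    c.localPerm g (c.nbr v a) a = c.localPerm g v a := by
  refine c.localPerm_eq_of_map_nbr ?_
  rw [nbr_nbr, map_nbr, nbr_nbr]

theorem nbr_induction (hT : T.IsTree) {P : V → Prop} {v₀ : V} (h₀ : P v₀)
    (h : ∀ v a, P v → P (c.nbr v a)) (v : V) : P v := by
  obtain ⟨p⟩ := hT.connected.preconnected v₀ v
  induction p with
  | nil => exact h₀
  | cons hadj p ih =>
    obtain ⟨a, rfl⟩ := c.exists_nbr_eq hadj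
    exact ih (h _ a h₀)

theorem aut_ext (hT : T.IsTree) {g h : T ≃g T} (v₀ : V) (h₀ : g v₀ = h v₀)
    (hl : ∀ v, c.localPerm g v = c.localPerm h v) : g = h := by
  refine RelIso.ext fun v => ?_
  induction v using c.nbr_induction hT (v₀ := v₀) with
  | h₀ => exact h₀
  | h v a ih => rw [map_nbr, map_nbr, ih, hl]

/-- The transport along a walk. -/
noncomputable def transport {A : Type*} (τ : V → Ω → A → A) : {v w : V} → T.Walk v w → A → A
  | _, _, .nil, x => x
  | v, _, .cons h p, x => transport τ p (τ v (c.color ⟨s(v, _), h⟩) x)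

theorem transport_concat {A : Type*} (τ : V → Ω → A → A) {u v w : V} (p : T.Walk u v)
    (h : T.Adj v w) (x : A) :
    c.transport τ (p.concat h) x = τ v (c.color ⟨s(v, w), h⟩) (c.transport τ p x) := by
  induction p generalizing x with
  | nil => rfl
  | cons h' p ih =>
    rw [SimpleGraph.Walk.concat_cons]
    exact ih _ _

/-- Developing maps on trees: consistent transition maps along edges can be integrated. -/
theorem exists_dev (hT : T.IsTree) {A : Type*} (τ : V → Ω → A → A)
    (hτ : ∀ v a x, τ (c.nbr v a) a (τ v a x) = x) (v₀ : V) (x₀ : A) :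
    ∃ d : V → A, d v₀ = x₀ ∧ ∀ v a, d (c.nbr v a) = τ v a (d v) := by
  choose p hp using fun v => (hT.existsUnique_path v₀ v).exists
  obtain ⟨d, hd⟩ : ∃ d : V → A, ∀ v, d v = c.transport τ (p v) x₀ := ⟨_, fun _ => rfl⟩
  -- Across an edge leading away from v₀ the path just gets longer. Every other edge is such an edge
  -- read backwards, where `hτ` inverts the transition.
  have key : ∀ v a, c.nbr v a ∉ (p v).support → d (c.nbr v a) = τ v a (d v) := by
    intro v a h
    have hadj := c.adj_nbr v a
    have h1 := hT.isAcyclic.path_concat (hp v) (hp (c.nbr v a)) hadj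
      (hT.isAcyclic.mem_support_of_ne_mem_support_of_adj_of_isPath (hp _) (hp v) hadj.symm h)
    rw [hd, h1, transport_concat, color_nbr, hd]
  refine ⟨d, ?_, fun v a => ?_⟩
  · have : p v₀ = .nil := (hT.existsUnique_path v₀ v₀).unique (hp v₀) .nil
    rw [hd, this]
    rfl
  · by_cases h : c.nbr v a ∈ (p v).support
    · have h2 := hT.isAcyclic.ne_mem_support_of_support_of_adj_of_isPath (hp v)
        (hp (c.nbr v a)) (c.adj_nbr v a) h
      have h4 := key (c.nbr v a) a (by rwa [nbr_nbr])
      have h5 := hτ (c.nbr v a) a (d (c.nbr v a))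
      rw [← h4, nbr_nbr] at h5
      exact h5.symm
    · exact key v a h

/-- Automorphisms with prescribed local permutations. -/
theorem exists_aut (hT : T.IsTree) (s : V → Equiv.Perm Ω) (hs : ∀ v a, s (c.nbr v a) a = s v a)
    (v₀ w₀ : V) : ∃ g : T ≃g T, g v₀ = w₀ ∧ ∀ v, c.localPerm g v = s v := by
  obtain ⟨g, hg₀, hg⟩ := c.exists_dev hT (fun v a x => c.nbr x (s v a))
    (fun v a x => by simp [hs]) v₀ w₀
  -- The inverse is developed too; the permutation to invert is the one at the current value of h.
  obtain ⟨h, hh₀, hh⟩ := c.exists_dev hT (fun w b x => c.nbr x ((s x).symm b))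
    (fun w b x => by
      have h1 : (s (c.nbr x ((s x).symm b))).symm b = (s x).symm b := by
        rw [Equiv.symm_apply_eq, hs, Equiv.apply_symm_apply]
      rw [h1, nbr_nbr]) w₀ v₀
  have hgh : ∀ w, g (h w) = w := fun w => by
    induction w using c.nbr_induction hT (v₀ := w₀) with
    | h₀ => rw [hh₀, hg₀]
    | h w b ih => rw [hh, hg, ih, Equiv.apply_symm_apply]
  have hhg : ∀ v, h (g v) = v := fun v => by
    induction v using c.nbr_induction hT (v₀ := v₀) with
    | h₀ => rw [hg₀, hh₀]
    | h v a ih => rw [hg, hh, ih, Equiv.symm_apply_apply]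
  have hadj : ∀ v w, T.Adj v w → T.Adj (g v) (g w) := fun v w hvw => by
    obtain ⟨a, rfl⟩ := c.exists_nbr_eq hvw
    rw [hg]
    exact c.adj_nbr _ _
  have hadj' : ∀ v w, T.Adj v w → T.Adj (h v) (h w) := fun v w hvw => by
    obtain ⟨a, rfl⟩ := c.exists_nbr_eq hvw
    rw [hh]
    exact c.adj_nbr _ _
  let e : T ≃g T :=
    { toFun := g
      invFun := h
      left_inv := hhg
      right_inv := hgh
      map_rel_iff' := fun {v w} => ⟨fun hvw => by
        have := hadj' _ _ hvw
        change T.Adj (h (g v)) (h (g w)) at this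
        rwa [hhg, hhg] at this, hadj v w⟩ }
  refine ⟨e, hg₀, fun v => Equiv.ext fun a => c.localPerm_eq_of_map_nbr ?_⟩
  exact hg v a

/-- The colour-preserving automorphisms act transitively on vertices. -/
theorem exists_aut_one (hT : T.IsTree) (v₀ w₀ : V) :
    ∃ g : T ≃g T, g v₀ = w₀ ∧ ∀ v, c.localPerm g v = 1 :=
  c.exists_aut hT (fun _ => 1) (fun _ _ => rfl) v₀ w₀

/-- The first colour of the path from `v` to `x`, as a function of `x`. -/
theorem exists_dir (hT : T.IsTree) (v : V) : ∃ dir : V → Option Ω, dir v = none ∧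
    (∀ a, dir (c.nbr v a) = some a) ∧
    (∀ x a, x ≠ v → c.nbr x a ≠ v → dir (c.nbr x a) = dir x) ∧ ∀ x, x ≠ v → dir x ≠ none := by
  classical
  -- Only edges at v change the value, through the involution exchanging `none` and `some a`.
  obtain ⟨dir, h0, h⟩ := c.exists_dev hT
    (fun x a o => if x = v ∨ c.nbr x a = v then Equiv.swap none (some a) o else o)
    (fun x a o => by
      by_cases h : x = v ∨ c.nbr x a = v
      · simp only [h, nbr_nbr, or_comm (a := c.nbr x a = v), if_true, Equiv.swap_apply_self]
      · simp only [h, nbr_nbr, or_comm (a := c.nbr x a = v), if_false]) v none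
  have hv : ∀ a, dir (c.nbr v a) = some a := fun a => by rw [h, h0]; simp
  have hstep : ∀ x a, x ≠ v → c.nbr x a ≠ v → dir (c.nbr x a) = dir x := fun x a h1 h2 => by
    rw [h, if_neg (by tauto)]
  refine ⟨dir, h0, hv, hstep, fun x => ?_⟩
  induction x using c.nbr_induction hT (v₀ := v) with
  | h₀ => exact fun h => absurd rfl h
  | h x a ih =>
    intro hne
    by_cases hx : x = v
    · subst hx
      simp [hv]
    · rw [hstep x a hx hne]
      exact ih hx

section prescribed

variable {F F' : Subgroup (Equiv.Perm Ω)}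

theorem mem_prescribedGroup_of_one {g : T ≃g T} (hg : ∀ v, c.localPerm g v = 1) :
    g ∈ c.prescribedGroup F F' :=
  ⟨fun v => by rw [hg]; exact F'.one_mem, by simp [hg, F.one_mem]⟩

/-- Every element of `F'` is the local permutation at `v` of an element fixing `v`. -/
theorem exists_localPerm_eq (hT : T.IsTree) (hFF' : F ≤ F')
    (horb : ∀ f ∈ F', ∀ a : Ω, f a ∈ MulAction.orbit F a) (v : V) {f : Equiv.Perm Ω} (hf : f ∈ F') :
    ∃ g ∈ c.prescribedGroup F F', g v = v ∧ c.localPerm g v = f := by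
  obtain ⟨dir, h0, hv, hstep, hne⟩ := c.exists_dir hT v
  -- `k a` lies in F and agrees with f at a. Using f at v and `k a` throughout the branch of colour
  -- a is compatible along edges, and v is the only possible singularity.
  choose k hk using horb f hf
  obtain ⟨g, hgv, hg⟩ := c.exists_aut hT
    (fun x => (dir x).elim f fun a => (k a : Equiv.Perm Ω)) (fun x a => by
      by_cases h1 : x = v
      · subst h1
        rw [hv, h0]
        exact hk a
      · by_cases h2 : c.nbr x a = v
        · have h3 : x = c.nbr v a := (c.nbr_eq_comm.1 h2).symm
          rw [h2, h3, h0, hv]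
          exact (hk a).symm
        · rw [hstep x a h1 h2]) v v
  refine ⟨g, ⟨fun x => ?_, (Set.finite_singleton v).subset fun x hx => ?_⟩, hgv, by rw [hg, h0]; rfl⟩
  · rw [hg]
    cases dir x with
    | none => exact hf
    | some a => exact hFF' (k a).2
  · by_contra hxv
    rw [Set.mem_ofPred_eq, hg] at hx
    obtain ⟨a, ha⟩ := Option.ne_none_iff_exists'.1 (hne x hxv)
    rw [ha] at hx
    exact hx (k a).2

/-- Elements fixing an edge decompose as products of elements fixing either of the two half-trees,
described by a function that separates the end points of this edge only. -/
theorem exists_mul_of_fixes_edge (hT : T.IsTree) {g : T ≃g T} (hg : g ∈ c.prescribedGroup F F')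
    {v : V} {a : Ω} (hv : g v = v) (hw : g (c.nbr v a) = c.nbr v a) :
    ∃ g₁ ∈ c.prescribedGroup F F', ∃ g₂ ∈ c.prescribedGroup F F', ∃ side : Set V,
      g = g₁ * g₂ ∧ v ∉ side ∧ c.nbr v a ∈ side ∧
      (∀ x b, x ∈ side → c.nbr x b ∉ side → x = c.nbr v a ∧ b = a) ∧
      (∀ x b, x ∉ side → c.nbr x b ∈ side → x = v ∧ b = a) ∧
      (∀ x ∉ side, g₁ x = x) ∧ (∀ x ∈ side, g₂ x = x) := by
  classical
  obtain ⟨dir, h0, hdv, hstep, hne⟩ := c.exists_dir hT v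
  set side : Set V := {x | dir x = some a}
  have hvs : v ∉ side := by simp [side, h0]
  have hws : c.nbr v a ∈ side := hdv a
  have hin : ∀ x b, x ∉ side → c.nbr x b ∈ side → x = v ∧ b = a := by
    intro x b h1 h2
    by_cases hx : x = v
    · subst hx
      refine ⟨rfl, ?_⟩
      have : dir (c.nbr x b) = some a := h2
      rw [hdv] at this
      exact Option.some_injective _ this
    · by_cases hx' : c.nbr x b = v
      · exact absurd (hx' ▸ h2) hvs
      · exact absurd ((hstep x b hx hx').symm.trans h2) h1
  have hout : ∀ x b, x ∈ side → c.nbr x b ∉ side → x = c.nbr v a ∧ b = a := by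
    intro x b h1 h2
    obtain ⟨h3, rfl⟩ := hin (c.nbr x b) b h2 (by rwa [nbr_nbr])
    exact ⟨(c.nbr_eq_comm.1 h3).symm, rfl⟩
  have hga : c.localPerm g v a = a := c.localPerm_eq_of_map_nbr (by rw [hw, hv])
  have hga' : c.localPerm g (c.nbr v a) a = a := by rw [localPerm_nbr, hga]
  -- The local permutations of g on one half-tree are glued to the identity on the other; g fixes
  -- the colour a at the separating edge, so these are compatible.
  obtain ⟨g₁, hg₁v, hg₁⟩ := c.exists_aut hT (fun x => if x ∈ side then c.localPerm g x else 1)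
    (fun x b => by
      by_cases h1 : x ∈ side <;> by_cases h2 : c.nbr x b ∈ side
      · simp only [h1, h2, if_true, localPerm_nbr]
      · obtain ⟨rfl, rfl⟩ := hout x b h1 h2
        simp [hvs, hws, hga']
      · obtain ⟨rfl, rfl⟩ := hin x b h1 h2
        simp [hvs, hws, hga']
      · simp only [h1, h2, if_false]) v v
  obtain ⟨g₂, hg₂v, hg₂⟩ := c.exists_aut hT (fun x => if x ∈ side then 1 else c.localPerm g x)
    (fun x b => by
      by_cases h1 : x ∈ side <;> by_cases h2 : c.nbr x b ∈ side
      · simp only [h1, h2, if_true]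
      · obtain ⟨rfl, rfl⟩ := hout x b h1 h2
        simp [hvs, hws, hga]
      · obtain ⟨rfl, rfl⟩ := hin x b h1 h2
        simp [hvs, hws, hga]
      · simp only [h1, h2, if_false, localPerm_nbr]) v v
  have hfix₁ : ∀ x ∉ side, g₁ x = x := fun x => by
    induction x using c.nbr_induction hT (v₀ := v) with
    | h₀ => exact fun _ => hg₁v
    | h x b ih =>
      intro h2
      by_cases h1 : x ∈ side
      · obtain ⟨rfl, rfl⟩ := hout x b h1 h2
        rw [nbr_nbr, hg₁v]
      · rw [map_nbr, ih h1, hg₁, if_neg h1]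
        rfl
  have hfix₂ : ∀ x ∈ side, g₂ x = x := fun x => by
    induction x using c.nbr_induction hT (v₀ := v) with
    | h₀ => exact fun h => absurd h hvs
    | h x b ih =>
      intro h2
      by_cases h1 : x ∈ side
      · rw [map_nbr, ih h1, hg₂, if_pos h1]
        rfl
      · obtain ⟨rfl, rfl⟩ := hin x b h1 h2
        rw [map_nbr, hg₂v, hg₂, if_neg hvs, hga]
  have hside : ∀ x, g₂ x ∈ side ↔ x ∈ side := fun x => by
    refine ⟨fun h => ?_, fun h => by rwa [hfix₂ x h]⟩
    rwa [← g₂.injective (hfix₂ _ h)]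
  have hmem : ∀ h : T ≃g T, (∀ x, c.localPerm h x = c.localPerm g x ∨ c.localPerm h x = 1) →
      h ∈ c.prescribedGroup F F' := fun h hh => by
    refine ⟨fun x => ?_, hg.2.subset fun x hx hx' => hx ?_⟩
    · rcases hh x with h | h <;> rw [h]
      exacts [hg.1 x, F'.one_mem]
    · rcases hh x with h | h <;> rw [h]
      exacts [hx', F.one_mem]
  refine ⟨g₁, hmem _ fun x => ?_, g₂, hmem _ fun x => ?_, side, ?_, hvs, hws, hout, hin, hfix₁,
    hfix₂⟩
  · rw [hg₁]; split_ifs <;> simp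
  · rw [hg₂]; split_ifs <;> simp
  · refine c.aut_ext hT v ?_ fun x => ?_
    · rw [RelIso.mul_apply, hg₂v, hg₁v, hv]
    · rw [localPerm_mul, hg₁, hg₂]
      by_cases hx : x ∈ side
      · rw [if_pos ((hside x).2 hx), if_pos hx, hfix₂ x hx, mul_one]
      · rw [if_neg (mt (hside x).1 hx), if_neg hx, one_mul]

end prescribed

end LegalColoring

/-! ### The boundary of a tree -/

/-- An end of a tree, given by the function sending each vertex to the next vertex towards the
end. -/
structure IsTreeEnd {V : Type*} (T : SimpleGraph V) (ξ : V → V) : Prop where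
  adj : ∀ v, T.Adj v (ξ v)
  orient : ∀ v w, T.Adj v w → ξ v = w ∨ ξ w = v
  ne : ∀ v, ξ (ξ v) ≠ v

/-- The boundary of a tree. -/
def TreeBoundary {V : Type*} (T : SimpleGraph V) : Type _ := {ξ : V → V // IsTreeEnd T ξ}

namespace TreeBoundary

section topology

variable {V : Type*} {T : SimpleGraph V}

instance : CoeFun (TreeBoundary T) fun _ => V → V := ⟨Subtype.val⟩

@[ext]
theorem ext {ξ η : TreeBoundary T} (h : ∀ v, ξ v = η v) : ξ = η := Subtype.ext (funext h)

theorem adj (ξ : TreeBoundary T) (v : V) : T.Adj v (ξ v) := ξ.2.adj v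

theorem orient (ξ : TreeBoundary T) {v w : V} (h : T.Adj v w) : ξ v = w ∨ ξ w = v := ξ.2.orient v w h

theorem ne (ξ : TreeBoundary T) (v : V) : ξ (ξ v) ≠ v := ξ.2.ne v

instance : TopologicalSpace (TreeBoundary T) :=
  TopologicalSpace.induced Subtype.val (@Pi.topologicalSpace V (fun _ => V) fun _ => ⊥)

theorem isOpen_apply_mem (v : V) (S : Set V) : IsOpen {ξ : TreeBoundary T | ξ v ∈ S} := by
  let _ : TopologicalSpace V := ⊥
  have : DiscreteTopology V := ⟨rfl⟩
  exact ((isOpen_discrete S).preimage (continuous_apply v)).preimage continuous_induced_dom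

theorem isOpen_apply_eq (v w : V) : IsOpen {ξ : TreeBoundary T | ξ v = w} :=
  isOpen_apply_mem v {w}

instance : T2Space (TreeBoundary T) := by
  let _ : TopologicalSpace V := ⊥
  have : DiscreteTopology V := ⟨rfl⟩
  exact (inferInstance : T2Space {ξ : V → V // IsTreeEnd T ξ})

theorem exists_finset_of_isOpen {U : Set (TreeBoundary T)} (hU : IsOpen U) {ξ : TreeBoundary T}
    (hξ : ξ ∈ U) : ∃ S : Finset V, ∀ η : TreeBoundary T, (∀ v ∈ S, η v = ξ v) → η ∈ U := by
  let _ : TopologicalSpace V := ⊥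
  obtain ⟨O, hO, rfl⟩ := isOpen_induced_iff.1 hU
  obtain ⟨S, u, hu, hS⟩ := isOpen_pi_iff.1 hO _ hξ
  exact ⟨S, fun η hη => hS fun v hv => by rw [hη v hv]; exact (hu v hv).2⟩

theorem compactSpace (hfin : ∀ v, (T.neighborSet v).Finite) : CompactSpace (TreeBoundary T) := by
  let _ : TopologicalSpace V := ⊥
  have : DiscreteTopology V := ⟨rfl⟩
  have hc : IsCompact {ξ : V → V | IsTreeEnd T ξ} := by
    refine (isCompact_univ_pi fun v => (hfin v).isCompact).of_isClosed_subset ?_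
      fun ξ hξ v _ => hξ.adj v
    have hop : ∀ v (S : Set V), IsOpen {ξ : V → V | ξ v ∈ S} := fun v S =>
      (isOpen_discrete S).preimage (continuous_apply v)
    have hcl : ∀ v (S : Set V), IsClosed {ξ : V → V | ξ v ∈ S} := fun v S =>
      (isClosed_discrete S).preimage (continuous_apply v)
    have : {ξ : V → V | IsTreeEnd T ξ} = (⋂ v, {ξ | ξ v ∈ T.neighborSet v}) ∩
        (⋂ v, ⋂ w, ⋂ _ : T.Adj v w, {ξ | ξ v ∈ ({w} : Set V)} ∪ {ξ | ξ w ∈ ({v} : Set V)}) ∩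
        (⋂ v, (⋃ w, {ξ | ξ v ∈ ({w} : Set V)} ∩ {ξ | ξ w ∈ ({v} : Set V)})ᶜ) := by
      ext ξ
      simp only [Set.mem_ofPred_eq, Set.mem_inter_iff, Set.mem_iInter, Set.mem_union,
        Set.mem_singleton_iff, Set.mem_compl_iff, Set.mem_iUnion, SimpleGraph.mem_neighborSet,
        not_exists, not_and]
      exact ⟨fun h => ⟨⟨h.adj, h.orient⟩, fun v w hw => hw ▸ h.ne v⟩,
        fun h => ⟨h.1.1, h.1.2, fun v => h.2 v _ rfl⟩⟩
    rw [this]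
    exact ((isClosed_iInter fun v => hcl v _).inter (isClosed_iInter fun v => isClosed_iInter
      fun w => isClosed_iInter fun _ => (hcl v _).union (hcl w _))).inter
      (isClosed_iInter fun v => (isOpen_iUnion fun w => (hop v _).inter (hop w _)).isClosed_compl)
  exact isCompact_iff_compactSpace.1 hc

instance : MulAction (T ≃g T) (TreeBoundary T) where
  smul g ξ := ⟨fun v => g (ξ (g⁻¹ v)), fun v => by
      have h := g.map_adj_iff.2 (ξ.adj (g⁻¹ v))
      rwa [RelIso.apply_inv_self] at h,
    fun v w h => by
      rcases ξ.orient ((g⁻¹ : T ≃g T).map_adj_iff.2 h) with h | h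
      · exact Or.inl (by rw [h, RelIso.apply_inv_self])
      · exact Or.inr (by rw [h, RelIso.apply_inv_self]),
    fun v h => ξ.ne (g⁻¹ v) (g.injective (by
      rw [RelIso.inv_apply_self] at h
      rw [h, RelIso.apply_inv_self]))⟩
  one_smul ξ := rfl
  mul_smul g h ξ := rfl

theorem smul_apply (g : T ≃g T) (ξ : TreeBoundary T) (v : V) : (g • ξ) v = g (ξ (g⁻¹ v)) := rfl

theorem smul_apply_apply (g : T ≃g T) (ξ : TreeBoundary T) (v : V) : (g • ξ) (g v) = g (ξ v) := by
  rw [smul_apply, RelIso.inv_apply_self]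

instance : ContinuousConstSMul (T ≃g T) (TreeBoundary T) := by
  refine ⟨fun g => ?_⟩
  let _ : TopologicalSpace V := ⊥
  have : DiscreteTopology V := ⟨rfl⟩
  refine continuous_induced_rng.2 (continuous_pi fun v => ?_)
  exact (continuous_of_discreteTopology (f := g)).comp
    ((continuous_apply (g⁻¹ v)).comp continuous_induced_dom)

instance (Γ : Subgroup (T ≃g T)) : ContinuousConstSMul Γ (TreeBoundary T) :=
  ⟨fun g => continuous_const_smul (g : T ≃g T)⟩

end topology

section combinatorics

variable {V : Type*} {T : SimpleGraph V}

/-- Ends pointing in the same direction far along a ray agree on the whole ray. -/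
theorem apply_eq_of_iterate (ξ η : TreeBoundary T) (v : V) (n : ℕ)
    (h : η (ξ^[n] v) = ξ (ξ^[n] v)) : η v = ξ v := by
  induction n generalizing v with
  | zero => exact h
  | succ n ih =>
    have h1 := ih (ξ v) h
    refine (η.orient (ξ.adj v)).resolve_right fun h2 => ξ.ne v ?_
    rw [← h1, h2]

theorem exists_iterate_eq (hT : T.IsTree) (ξ : TreeBoundary T) (v w : V) :
    ∃ m n, ξ^[m] v = ξ^[n] w := by
  obtain ⟨p⟩ := hT.connected.preconnected v w
  induction p with
  | nil => exact ⟨0, 0, rfl⟩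
  | @cons v x w h p ih =>
    obtain ⟨m, n, hmn⟩ := ih
    rcases ξ.orient h with h | h
    · exact ⟨m + 1, n, by rw [Function.iterate_succ_apply, h, hmn]⟩
    · refine ⟨m, n + 1, ?_⟩
      rw [Function.iterate_succ_apply', ← hmn, ← Function.iterate_succ_apply' (f := ξ),
        Function.iterate_succ_apply, h]

/-- Half-trees form a neighbourhood basis. -/
theorem exists_halfTree_subset (hT : T.IsTree) {U : Set (TreeBoundary T)} (hU : IsOpen U)
    {ξ : TreeBoundary T} (hξ : ξ ∈ U) : ∃ x, ∀ η : TreeBoundary T, η x = ξ x → η ∈ U := by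
  classical
  obtain ⟨S, hS⟩ := exists_finset_of_isOpen hU hξ
  -- The rays towards ξ from finitely many vertices merge at some x, and the value at x determines
  -- the values back along them.
  obtain ⟨x, hx⟩ : ∃ x, ∀ v ∈ S, ∃ n, ξ^[n] v = x := by
    clear hS
    induction S using Finset.induction_on with
    | empty =>
      obtain ⟨v⟩ := hT.connected.nonempty
      exact ⟨v, by simp⟩
    | insert w S _ ih =>
      obtain ⟨x, hx⟩ := ih
      obtain ⟨m, n, hmn⟩ := exists_iterate_eq hT ξ x w
      refine ⟨ξ^[m] x, fun v hv => ?_⟩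
      rcases Finset.mem_insert.1 hv with rfl | hv
      · exact ⟨n, hmn.symm⟩
      · obtain ⟨k, hk⟩ := hx v hv
        exact ⟨m + k, by rw [Function.iterate_add_apply, hk]⟩
  refine ⟨x, fun η hη => hS η fun v hv => ?_⟩
  obtain ⟨n, rfl⟩ := hx v hv
  exact apply_eq_of_iterate ξ η v n hη

/-- An end that does not leave z along p is pointed to backwards from every later vertex of p. -/
theorem apply_eq_penultimate (ξ : TreeBoundary T) {z z' : V} (p : T.Walk z z') (hp : p.IsPath)
    (hne : z ≠ z') (h : ξ z ≠ p.snd) : ξ z' = p.penultimate := by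
  induction p with
  | nil => exact absurd rfl hne
  | @cons z x z' hadj p ih =>
    have h1 : ξ x = z := (ξ.orient hadj).resolve_left (by simpa using h)
    cases p with
    | nil => simpa using h1
    | @cons _ y _ hadj' p =>
      rw [SimpleGraph.Walk.cons_isPath_iff] at hp
      have h2 := ih hp.1 (by
        rintro rfl
        have := (SimpleGraph.Walk.cons_isPath_iff _ _).1 hp.1
        exact this.2 p.end_mem_support) (by
        rw [h1]
        rintro rfl
        exact hp.2 (by simp))
      simpa using h2

/-- An automorphism fixing three ends issuing from `z` in different directions fixes `z`. -/
theorem apply_eq_of_smul_eq (hT : T.IsTree) (g : T ≃g T) (z : V) (ξ : Fin 3 → TreeBoundary T)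
    (hinj : Function.Injective fun i => ξ i z) (hg : ∀ i, g • ξ i = ξ i) : g z = z := by
  by_contra hne
  obtain ⟨p, hp, -⟩ := hT.existsUnique_path z (g z)
  have h1 : ∀ i, ξ i (g z) = g (ξ i z) := fun i => by
    conv_lhs => rw [← hg i]
    exact smul_apply_apply g (ξ i) z
  -- Two ends not starting along the path from z to g z both arrive at g z from its last edge, so g
  -- would identify their directions. At most one end starts along the path, so three ends are too
  -- many.
  have h2 : ∀ i j, ξ i z ≠ p.snd → ξ j z ≠ p.snd → i = j := fun i j hi hj => by
    refine hinj (g.injective ?_)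
    rw [← h1, ← h1, apply_eq_penultimate _ p hp (Ne.symm hne) hi,
      apply_eq_penultimate _ p hp (Ne.symm hne) hj]
  have h3 : ∀ i j, ξ i z = p.snd → ξ j z = p.snd → i = j := fun i j hi hj =>
    hinj (hi.trans hj.symm)
  by_cases a0 : ξ 0 z = p.snd <;> by_cases a1 : ξ 1 z = p.snd <;> by_cases a2 : ξ 2 z = p.snd
  all_goals first
    | exact absurd (h3 0 1 a0 a1) (by decide)
    | exact absurd (h3 0 2 a0 a2) (by decide)
    | exact absurd (h3 1 2 a1 a2) (by decide)
    | exact absurd (h2 0 1 a0 a1) (by decide)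
    | exact absurd (h2 0 2 a0 a2) (by decide)
    | exact absurd (h2 1 2 a1 a2) (by decide)

end combinatorics

end TreeBoundary

namespace LegalColoring

variable {V : Type*} {T : SimpleGraph V} {Ω : Type*} (c : LegalColoring T Ω)

theorem neighborSet_finite {V : Type*} {T : SimpleGraph V} {Ω : Type*} (c : LegalColoring T Ω)
    [Finite Ω] (v : V) : (T.neighborSet v).Finite :=
  have : Finite (T.neighborSet v) := Finite.of_equiv _ (c.starEquiv v).symm
  Set.toFinite _

/-- There is an end following any prescribed reduced colour sequence. -/
theorem exists_end (hT : T.IsTree) (v : V) {a b : Ω} (hab : a ≠ b) : ∃ ξ : TreeBoundary T,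
    ξ v = c.nbr v a ∧ ξ (c.nbr v a) = c.nbr (c.nbr v a) b := by
  classical
  let A := {o : ℕ → Ω // ∀ n, o n ≠ o (n + 1)}
  let shift : A → A := fun o => ⟨fun n => o.1 (n + 1), fun n => o.2 (n + 1)⟩
  let cons : (x : Ω) → (o : A) → x ≠ o.1 0 → A := fun x o h =>
    ⟨fun n => n.casesOn x o.1, fun n => by cases n; exacts [h, o.2 _]⟩
  -- A vertex carries the colour sequence of its ray: crossing the first colour deletes it, and
  -- crossing another one prepends it.
  let τ : V → Ω → A → A := fun _ x o => if h : x = o.1 0 then shift o else cons x o h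
  have hτ1 : ∀ v (o : A), τ v (o.1 0) o = shift o := fun v o => dif_pos rfl
  have hτ2 : ∀ v x (o : A), x ≠ o.1 0 → (τ v x o).1 0 = x ∧ shift (τ v x o) = o := by
    intro v x o h
    have : τ v x o = cons x o h := dif_neg h
    rw [this]
    exact ⟨rfl, rfl⟩
  let o₀ : A := ⟨fun n => if Even n then a else b, fun n => by
    by_cases h : Even n
    · simp [h, Nat.even_add_one, hab]
    · simp [h, Nat.even_add_one, hab.symm]⟩
  obtain ⟨d, hd0, hd⟩ := c.exists_dev hT τ (fun v x o => by
    by_cases h : x = o.1 0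
    · subst h
      rw [hτ1 v]
      have h2 := hτ2 (c.nbr v (o.1 0)) (o.1 0) (shift o) (o.2 0)
      refine Subtype.ext (funext fun n => ?_)
      cases n with
      | zero => exact h2.1
      | succ n => exact congrFun (congrArg Subtype.val h2.2) n
    · obtain ⟨h1, h2⟩ := hτ2 v x o h
      have h3 := hτ1 (c.nbr v x) (τ v x o)
      rw [h1, h2] at h3
      exact h3) v o₀
  refine ⟨⟨fun w => c.nbr w ((d w).1 0), fun w => c.adj_nbr _ _, fun x y hxy => ?_, fun w => ?_⟩,
    ?_, ?_⟩
  · obtain ⟨e, rfl⟩ := c.exists_nbr_eq hxy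
    by_cases h : e = (d x).1 0
    · exact Or.inl (by rw [← h])
    · right
      rw [hd, (hτ2 x e (d x) h).1, nbr_nbr]
  · rw [hd, hτ1 w]
    intro h
    have h2 := c.nbr_nbr w ((d w).1 0)
    conv_rhs at h2 => rw [← h]
    exact (d w).2 0 (c.nbr_injective _ h2)
  · change c.nbr v ((d v).1 0) = _
    rw [hd0]
    rfl
  · change c.nbr (c.nbr v a) ((d (c.nbr v a)).1 0) = _
    have : a = (d v).1 0 := by rw [hd0]; rfl
    conv_lhs => rw [this, hd, hτ1 v, hd0]
    change c.nbr (c.nbr v (o₀.1 0)) (o₀.1 1) = _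
    simp [o₀]

end LegalColoring

/-! ### The action of `G(F, F')` on the boundary of the tree -/

theorem exists_ne_ne_of_card {Ω : Type*} [Finite Ω] (hΩ : 3 ≤ Nat.card Ω) (a b : Ω) :
    ∃ x, x ≠ a ∧ x ≠ b := by
  classical
  have := Fintype.ofFinite Ω
  rw [Nat.card_eq_fintype_card] at hΩ
  obtain ⟨x, -, hx⟩ := Finset.exists_mem_notMem_of_card_lt_card
    (s := {a, b}) (t := Finset.univ) (lt_of_le_of_lt Finset.card_le_two (by rw [Finset.card_univ]; exact hΩ))
  exact ⟨x, by simpa using hx⟩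

theorem IsExtremelyProximal.infinite {G Z : Type*} [Group G] [TopologicalSpace Z] [MulAction G Z]
    [T2Space Z] (h : IsExtremelyProximal G Z) {x y z : Z} (hxy : x ≠ y) (hxz : x ≠ z)
    (hyz : y ≠ z) : Infinite Z := by
  by_contra hfin
  rw [not_infinite_iff_finite] at hfin
  obtain ⟨g, hg⟩ := h {x, y} (Set.toFinite _).isClosed (fun hu => by
    have : z ∈ ({x, y} : Set Z) := hu ▸ Set.mem_univ z
    rcases this with h | h
    exacts [hxz h.symm, hyz h.symm]) {x} (by
      rw [← isClosed_compl_iff]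
      exact (Set.toFinite _).isClosed) ⟨x, rfl⟩
  refine hxy (MulAction.injective g ?_)
  exact (hg x (by simp)).trans (hg y (by simp)).symm

/-- The average of the evaluations along the orbit of a finite subgroup. -/
theorem exists_state_of_finite_subgroup {G X : Type*} [Group G] [TopologicalSpace X]
    [MulAction G X] [ContinuousConstSMul G X] [Nonempty X] (K : Subgroup G) [Finite K] :
    ∃ φ : C(X, ℝ) → ℝ, IsState φ ∧ ∀ k ∈ K, actState k φ = φ := by
  have := Fintype.ofFinite K
  obtain ⟨x⟩ := ‹Nonempty X›
  have hc : (0 : ℝ) < Fintype.card K := by exact_mod_cast Fintype.card_pos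
  refine ⟨fun f => (∑ k : K, f ((k : G) • x)) / Fintype.card K, ⟨fun f g => ?_, fun r f => ?_,
    fun f hf => div_nonneg (Finset.sum_nonneg fun k _ => hf _) hc.le, ?_⟩, fun k hk => ?_⟩
  · simp [Finset.sum_add_distrib, add_div]
  · simp [← Finset.mul_sum, mul_div_assoc]
  · simp [hc.ne']
  · funext f
    simp only [actState, ContinuousMap.comp_apply, ContinuousMap.coe_mk]
    congr 1
    refine Fintype.sum_equiv (Equiv.mulLeft (⟨k, hk⟩ : K)) _ _ fun l => ?_
    simp [mul_smul]

/-- If every finite subset of germs at `z` is contained in a finite subgroup, then germ stabilizers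
are amenable. -/
theorem hasAmenableGerms_of_finite {G Z : Type u} [Group G] [TopologicalSpace Z] [MulAction G Z]
    (z : Z) (h : ∀ A : Finset G, (∀ a ∈ A, z ∈ interior (MulAction.fixedBy Z a)) →
      ∃ K : Subgroup G, Finite K ∧ ∀ a ∈ A, a ∈ K) : HasAmenableGerms G Z := by
  classical
  intro X _ _ _ _ _ _
  let ι := {a : G // z ∈ interior (MulAction.fixedBy Z a)}
  obtain ⟨φ, hφ, hφ'⟩ := (isCompact_stateSpace X).inter_iInter_nonempty
    (fun a : ι => {φ | actState (a : G) φ = φ})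
    (fun a => isClosed_eq (continuous_actState _) continuous_id) fun s => by
      obtain ⟨K, hK, hsK⟩ := h (s.image Subtype.val) fun a ha => by
        obtain ⟨b, -, rfl⟩ := Finset.mem_image.1 ha
        exact b.2
      obtain ⟨φ, hφ, hφK⟩ := exists_state_of_finite_subgroup (X := X) K
      exact ⟨φ, hφ, Set.mem_iInter₂.2 fun a ha => hφK _ (hsK _ (Finset.mem_image_of_mem _ ha))⟩
  exact ⟨z, φ, hφ, fun a ha => Set.mem_iInter.1 hφ' ⟨a, ha⟩⟩

namespace LegalColoring

variable {V : Type u} {T : SimpleGraph V} {Ω : Type v} (c : LegalColoring T Ω)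

/-- If the two edges have the same colour, y is sent to x'. Otherwise y is sent to y', and the moved
ends leave y' by a colour other than that of the edge to x'. -/
theorem exists_aut_one_smul (hT : T.IsTree) {x y x' y' : V} (h : T.Adj x y) (h' : T.Adj x' y') :
    ∃ g : T ≃g T, (∀ v, c.localPerm g v = 1) ∧
      ∀ ξ : TreeBoundary T, ξ y = x → (g • ξ) x' = y' := by
  obtain ⟨a, rfl⟩ := c.exists_nbr_eq h.symm
  obtain ⟨b, rfl⟩ := c.exists_nbr_eq h'
  by_cases hab : a = b
  · subst hab
    obtain ⟨g, hg, hg1⟩ := c.exists_aut_one hT y x'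
    refine ⟨g, hg1, fun ξ hξ => ?_⟩
    rw [← hg, TreeBoundary.smul_apply_apply, hξ, map_nbr, hg1]
    rfl
  · obtain ⟨g, hg, hg1⟩ := c.exists_aut_one hT y (c.nbr x' b)
    refine ⟨g, hg1, fun ξ hξ => ((g • ξ).orient (c.adj_nbr x' b)).resolve_right fun h2 => ?_⟩
    rw [← hg, TreeBoundary.smul_apply_apply, hξ, map_nbr, hg1, hg, Equiv.Perm.one_apply] at h2
    have h3 := c.nbr_nbr x' b
    conv_rhs at h3 => rw [← h2]
    exact hab (c.nbr_injective _ h3).symm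

section prescribed

variable {F F' : Subgroup (Equiv.Perm Ω)} {Γ : Subgroup (T ≃g T)}

/-- A proper closed set misses a half-tree, so it lies in the opposite one, and colour-preserving
automorphisms move any half-tree into any other. -/
theorem isExtremelyProximal (hT : T.IsTree) (hΓ : ∀ g : T ≃g T, (∀ v, c.localPerm g v = 1) → g ∈ Γ) :
    IsExtremelyProximal Γ (TreeBoundary T) := by
  intro C hC hCne U hU ⟨η, hη⟩
  obtain ⟨ζ, hζ⟩ := (Set.ne_univ_iff_exists_notMem C).1 hCne
  obtain ⟨x', hx'⟩ := TreeBoundary.exists_halfTree_subset hT hU hη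
  obtain ⟨x, hx⟩ := TreeBoundary.exists_halfTree_subset hT hC.isOpen_compl hζ
  obtain ⟨g, hg1, hg⟩ := c.exists_aut_one_smul hT (ζ.adj x) (η.adj x')
  refine ⟨⟨g, hΓ g hg1⟩, fun ξ hξ => hx' _ (hg ξ ?_)⟩
  exact (ξ.orient (ζ.adj x)).resolve_left fun h => hx ξ h hξ

theorem infinite_treeBoundary {V : Type u} {T : SimpleGraph V} {Ω : Type v}
    (c : LegalColoring T Ω) [Finite Ω] (hΩ : 3 ≤ Nat.card Ω) (hT : T.IsTree) :
    Infinite (TreeBoundary T) := by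
  obtain ⟨v⟩ := hT.connected.nonempty
  have hne : Nonempty Ω := by
    rw [← Finite.card_pos_iff]; omega
  obtain ⟨a⟩ := hne
  obtain ⟨b, hb, -⟩ := exists_ne_ne_of_card hΩ a a
  obtain ⟨d, hda, hdb⟩ := exists_ne_ne_of_card hΩ a b
  obtain ⟨ξ, hξ, -⟩ := c.exists_end hT v hb.symm
  obtain ⟨η, hη, -⟩ := c.exists_end hT v hb
  obtain ⟨ζ, hζ, -⟩ := c.exists_end hT v hda
  refine (c.isExtremelyProximal hT (Γ := ⊤) fun _ _ => trivial).infinite (x := ξ) (y := η) (z := ζ)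
    ?_ ?_ ?_ <;> rintro rfl
  · exact hb ((c.nbr_injective v) (hξ.symm.trans hη)).symm
  · exact hda ((c.nbr_injective v) (hξ.symm.trans hζ)).symm
  · exact hdb ((c.nbr_injective v) (hη.symm.trans hζ)).symm

/-- An automorphism that fixes all ends in a half-tree fixes the vertices inside. -/
theorem apply_eq_of_fixes_halfTree [Finite Ω] (hΩ : 3 ≤ Nat.card Ω) (hT : T.IsTree) {g : T ≃g T}
    {x : V} {a b : Ω} (hab : b ≠ a)
    (hg : ∀ ξ : TreeBoundary T, ξ x = c.nbr x a → g • ξ = ξ) :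
    g (c.nbr (c.nbr x a) b) = c.nbr (c.nbr x a) b := by
  set y := c.nbr x a with hy
  set z := c.nbr y b with hz
  have hyx : c.nbr y a = x := by rw [hy, nbr_nbr]
  have hzy : c.nbr z b = y := by rw [hz, nbr_nbr]
  have hadj : T.Adj x y := c.adj_nbr x a
  -- the ends leaving `z` away from `y`
  have haway : ∀ ξ : TreeBoundary T, ξ z ≠ y → ξ x = y := fun ξ h => by
    refine (ξ.orient hadj).resolve_right fun h1 => ?_
    have h2 := (ξ.orient (c.adj_nbr y b)).resolve_right h
    rw [h1, ← hyx, nbr_inj] at h2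
    exact hab h2.symm
  -- Three ends of the half-tree leave z in distinct directions: two away from y, and one through y
  -- that turns off by a colour e different from a, hence not towards x.
  obtain ⟨e, heb, hea⟩ := exists_ne_ne_of_card hΩ b a
  obtain ⟨p, hpb, -⟩ := exists_ne_ne_of_card hΩ b b
  obtain ⟨q, hqb, hqp⟩ := exists_ne_ne_of_card hΩ b p
  obtain ⟨ξ₀, h0, h0'⟩ := c.exists_end hT z heb.symm
  obtain ⟨ξ₁, h1, -⟩ := c.exists_end hT z hpb
  obtain ⟨ξ₂, h2, -⟩ := c.exists_end hT z hqb
  rw [hzy] at h0'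
  have hval : ∀ i : Fin 3, (![ξ₀, ξ₁, ξ₂] i) z = c.nbr z (![b, p, q] i) := by
    intro i; fin_cases i <;> assumption
  refine TreeBoundary.apply_eq_of_smul_eq hT g z ![ξ₀, ξ₁, ξ₂] ?_ ?_
  · intro i j hij
    simp only [hval, nbr_inj] at hij
    fin_cases i <;> fin_cases j <;> simp_all
  · intro i
    fin_cases i
    · refine hg _ ((ξ₀.orient hadj).resolve_right fun h3 => ?_)
      rw [h0', ← hyx, nbr_inj] at h3
      exact hea h3
    · refine hg _ (haway ξ₁ fun h => hpb (c.nbr_injective z ?_))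
      rw [← h1, h, hzy]
    · refine hg _ (haway ξ₂ fun h => hqb (c.nbr_injective z ?_))
      rw [← h2, h, hzy]

/-- An element of a germ stabilizer fixes all edges far along the ray. -/
theorem exists_fixes_edge [Finite Ω] (hΩ : 3 ≤ Nat.card Ω) (hT : T.IsTree) {S : Set (T ≃g T)}
    {U : Set (TreeBoundary T)} (hU : IsOpen U) {ξ : TreeBoundary T} (hξ : ξ ∈ U)
    (hfix : ∀ g ∈ S, ∀ η ∈ U, g • η = η) :
    ∃ v a, ∀ g ∈ S, g v = v ∧ g (c.nbr v a) = c.nbr v a := by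
  obtain ⟨x, hx⟩ := TreeBoundary.exists_halfTree_subset hT hU hξ
  obtain ⟨a, ha⟩ := c.exists_nbr_eq (ξ.adj x)
  rw [← ha] at hx
  obtain ⟨b, hb, -⟩ := exists_ne_ne_of_card hΩ a a
  obtain ⟨e, he, hea⟩ := exists_ne_ne_of_card hΩ b a
  refine ⟨c.nbr (c.nbr x a) b, e, fun g hg => ?_⟩
  have hgx : ∀ η : TreeBoundary T, η x = c.nbr x a → g • η = η := fun η hη => hfix g hg η (hx η hη)
  refine ⟨c.apply_eq_of_fixes_halfTree hΩ hT hb hgx,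
    c.apply_eq_of_fixes_halfTree hΩ hT he fun η hη => hgx η ?_⟩
  refine (η.orient (c.adj_nbr x a)).resolve_right fun h => ?_
  refine hb (c.nbr_injective (c.nbr x a) ?_)
  rw [← hη, h, nbr_nbr]

end prescribed

end LegalColoring

/-! ### Countability of G(F, F') and finite subgroups of vertex stabilizers -/

namespace LegalColoring

section countable

variable {V : Type*} {T : SimpleGraph V} {Ω : Type*} (c : LegalColoring T Ω)

/-- The ball around `v`. -/
def ball (v : V) : ℕ → Set V
  | 0 => {v}
  | n + 1 => ball v n ∪ ⋃ a, (fun x => c.nbr x a) '' ball v n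

theorem finite_ball [Finite Ω] (v : V) (n : ℕ) : (c.ball v n).Finite := by
  induction n with
  | zero => exact Set.finite_singleton v
  | succ n ih => exact ih.union (Set.finite_iUnion fun a => ih.image _)

theorem ball_mono (v : V) : Monotone (c.ball v) :=
  monotone_nat_of_le_succ fun _ => Set.subset_union_left

theorem mem_ball_self (v : V) (n : ℕ) : v ∈ c.ball v n := c.ball_mono v (Nat.zero_le n) rfl

theorem exists_mem_ball (hT : T.IsTree) (v w : V) : ∃ n, w ∈ c.ball v n := by
  induction w using c.nbr_induction hT (v₀ := v) with
  | h₀ => exact ⟨0, rfl⟩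
  | h w a ih =>
    obtain ⟨n, hn⟩ := ih
    exact ⟨n + 1, Or.inr (Set.mem_iUnion.2 ⟨a, w, hn, rfl⟩)⟩

theorem exists_subset_ball (hT : T.IsTree) (v : V) {S : Set V} (hS : S.Finite) :
    ∃ n, S ⊆ c.ball v n := by
  choose n hn using fun w => c.exists_mem_ball hT v w
  obtain ⟨N, hN⟩ := (hS.image n).bddAbove
  exact ⟨N, fun w hw => c.ball_mono v (hN (Set.mem_image_of_mem n hw)) (hn w)⟩

theorem apply_mem_ball {g : T ≃g T} {v : V} (hg : g v = v) (n : ℕ) {x : V} (hx : x ∈ c.ball v n) :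
    g x ∈ c.ball v n := by
  induction n generalizing x with
  | zero =>
    obtain rfl : x = v := hx
    exact hg
  | succ n ih =>
    rcases hx with hx | hx
    · exact Or.inl (ih hx)
    · obtain ⟨a, y, hy, rfl⟩ := Set.mem_iUnion.1 hx
      exact Or.inr (Set.mem_iUnion.2 ⟨c.localPerm g y a, g y, ih hy, (c.map_nbr g y a).symm⟩)

theorem countable_vertices {V : Type*} {T : SimpleGraph V} {Ω : Type*} (c : LegalColoring T Ω)
    [Finite Ω] (hT : T.IsTree) : Countable V := by
  obtain ⟨v⟩ := hT.connected.nonempty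
  refine Function.Surjective.countable
    (f := fun l : List Ω => l.foldr (fun a x => c.nbr x a) v) fun w => ?_
  induction w using c.nbr_induction hT (v₀ := v) with
  | h₀ => exact ⟨[], rfl⟩
  | h w a ih =>
    obtain ⟨l, hl⟩ := ih
    exact ⟨a :: l, by simpa using congrArg (fun x => c.nbr x a) hl⟩

variable {F F' : Subgroup (Equiv.Perm Ω)}

/-- An automorphism with local permutations in a semi-regular group off `B` is determined by its
local permutations on `B`. -/
theorem eq_of_localPerm_eq (hT : T.IsTree) (hF : IsSemiregularPermGroup F) {g h : T ≃g T} {v : V}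
    (hgh : g v = h v) {B : Set V} (hvB : v ∈ B)
    (hB : ∀ x ∈ B, c.localPerm g x = c.localPerm h x) (hg : ∀ x ∉ B, c.localPerm g x ∈ F)
    (hh : ∀ x ∉ B, c.localPerm h x ∈ F) : g = h := by
  refine c.aut_ext hT v hgh fun x => ?_
  induction x using c.nbr_induction hT (v₀ := v) with
  | h₀ => exact hB v hvB
  | h x a ih =>
    by_cases hx : c.nbr x a ∈ B
    · exact hB _ hx
    · have := hF _ (F.mul_mem (F.inv_mem (hh _ hx)) (hg _ hx)) a (by
        rw [Equiv.Perm.mul_apply, localPerm_nbr, ih, ← localPerm_nbr]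
        exact Equiv.symm_apply_apply _ _)
      exact (inv_mul_eq_one.1 this).symm

/-- An element is encoded by its finite set of singularities, the image of v and finitely many local
permutations. -/
theorem countable_prescribedGroup [Finite Ω] (hT : T.IsTree) (hF : IsSemiregularPermGroup F) :
    Countable (c.prescribedGroup F F') := by
  classical
  have := c.countable_vertices hT
  obtain ⟨v⟩ := hT.connected.nonempty
  let S : c.prescribedGroup F F' → Finset V := fun g => insert v g.2.2.toFinset
  refine Function.Injective.countable (β := Σ S : Finset V, V × (S → Equiv.Perm Ω))
    (f := fun g => ⟨S g, g.1 v, fun x => c.localPerm g.1 x⟩) fun g h hgh => Subtype.ext ?_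
  obtain ⟨h1, h2⟩ := Sigma.mk.inj hgh
  have hmem : ∀ (g : c.prescribedGroup F F'), ∀ x ∉ S g, c.localPerm g.1 x ∈ F := by
    intro g x hx
    by_contra hcon
    exact hx (Finset.mem_insert_of_mem (by simpa using hcon))
  generalize hS : S h = B at *
  subst h1
  obtain ⟨h3, h4⟩ := Prod.mk.inj (eq_of_heq h2)
  exact c.eq_of_localPerm_eq hT hF h3 (B := S g) (Finset.mem_insert_self _ _)
    (fun x hx => congrFun h4 ⟨x, hx⟩) (hmem g) (fun x hx => hmem h x (hS ▸ hx))

/-- The automorphisms fixing `v` with local permutations in `F` outside the `n`-ball. -/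
def stabilizerBall (F : Subgroup (Equiv.Perm Ω)) (v : V) (n : ℕ) : Subgroup (T ≃g T) where
  carrier := {g | g v = v ∧ ∀ x ∉ c.ball v n, c.localPerm g x ∈ F}
  one_mem' := ⟨rfl, fun x _ => by rw [localPerm_one]; exact F.one_mem⟩
  mul_mem' := by
    rintro g h ⟨hg, hg'⟩ ⟨hh, hh'⟩
    refine ⟨(congrArg g hh).trans hg, fun x hx => ?_⟩
    rw [localPerm_mul]
    refine F.mul_mem (hg' _ fun hcon => hx ?_) (hh' x hx)
    have h1 : h⁻¹ v = v := by conv_lhs => rw [← hh, RelIso.inv_apply_self]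
    simpa using c.apply_mem_ball h1 n hcon
  inv_mem' := by
    rintro g ⟨hg, hg'⟩
    refine ⟨by conv_lhs => rw [← hg, RelIso.inv_apply_self], fun x hx => ?_⟩
    rw [localPerm_inv]
    refine F.inv_mem (hg' _ fun hcon => hx ?_)
    simpa using c.apply_mem_ball hg n hcon

theorem finite_stabilizerBall [Finite Ω] (hT : T.IsTree) (hF : IsSemiregularPermGroup F) (v : V)
    (n : ℕ) : Finite (c.stabilizerBall F v n) := by
  have := (c.finite_ball v n).to_subtype
  refine Finite.of_injective
    (fun (g : c.stabilizerBall F v n) (x : c.ball v n) => c.localPerm g.1 x)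
    fun g h hgh => Subtype.ext ?_
  exact c.eq_of_localPerm_eq hT hF (g.2.1.trans h.2.1.symm) (c.mem_ball_self v n)
    (fun x hx => congrFun hgh ⟨x, hx⟩) g.2.2 h.2.2

end countable

/-! ### Germ stabilizers and edge fixators in G(F, F') -/

section germs

variable {V : Type u} {T : SimpleGraph V} {Ω : Type v} (c : LegalColoring T Ω)
  {F F' : Subgroup (Equiv.Perm Ω)}

/-- Finitely many elements fixing a common open set of ends fix a common vertex, and one ball holds
all their singularities; so they lie in one finite `stabilizerBall`. -/
theorem hasAmenableGerms_prescribedGroup [Finite Ω] (hΩ : 3 ≤ Nat.card Ω) (hT : T.IsTree)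
    (hF : IsSemiregularPermGroup F) :
    HasAmenableGerms (c.prescribedGroup F F') (TreeBoundary T) := by
  have := c.infinite_treeBoundary hΩ hT
  obtain ⟨z⟩ := (inferInstance : Nonempty (TreeBoundary T))
  refine hasAmenableGerms_of_finite z fun A hA => ?_
  obtain ⟨v, a, hva⟩ := c.exists_fixes_edge hΩ hT (S := Subtype.val '' (A : Set (c.prescribedGroup F F')))
    (U := ⋂ g ∈ A, interior (MulAction.fixedBy (TreeBoundary T) g))
    (isOpen_biInter_finset fun _ _ => isOpen_interior) (Set.mem_iInter₂.2 hA) (by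
      rintro _ ⟨g, hg, rfl⟩ η hη
      have h1 : η ∈ MulAction.fixedBy (TreeBoundary T) g :=
        interior_subset (Set.mem_iInter₂.1 hη g hg)
      exact h1)
  obtain ⟨n, hn⟩ := c.exists_subset_ball hT v
    (S := ⋃ g ∈ A, {x | c.localPerm g.1 x ∉ F}) (A.finite_toSet.biUnion fun g _ => g.2.2)
  have := c.finite_stabilizerBall hT hF v n
  refine ⟨(c.stabilizerBall F v n).subgroupOf _, Finite.of_injective
    (fun g => (⟨g.1.1, g.2⟩ : c.stabilizerBall F v n))
    fun g h hgh => Subtype.ext (Subtype.ext (Subtype.mk.inj hgh)), fun g hg => ?_⟩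
  refine ⟨(hva _ ⟨g, hg, rfl⟩).1, fun x hx => ?_⟩
  by_contra hcon
  exact hx (hn (Set.mem_iUnion₂.2 ⟨g, hg, hcon⟩))

/-- The subgroup generated by the elements that fix an edge pointwise. -/
def edgeFixators (Γ : Subgroup (T ≃g T)) : Subgroup Γ :=
  Subgroup.closure {g | ∃ v a, g.1 v = v ∧ g.1 (c.nbr v a) = c.nbr v a}

/-- The only exit from S is the edge back to x, which the ray cannot retrace. So g fixes the ray,
and the ray determines the end. -/
theorem smul_eq_of_fixes_side (hT : T.IsTree) {g : T ≃g T} {S : Set V} {x : V} {b : Ω}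
    (hx : c.nbr x b ∈ S) (hS : ∀ z e, z ∈ S → c.nbr z e ∉ S → z = c.nbr x b ∧ e = b)
    (hg : ∀ z ∈ S, g z = z) (ξ : TreeBoundary T) (hξ : ξ x = c.nbr x b) : g • ξ = ξ := by
  have hray : ∀ n, ξ^[n] (c.nbr x b) ∈ S := by
    intro n
    induction n with
    | zero => exact hx
    | succ n ih =>
      rw [Function.iterate_succ_apply']
      obtain ⟨e, he⟩ := c.exists_nbr_eq (ξ.adj (ξ^[n] (c.nbr x b)))
      by_contra hcon
      obtain ⟨h1, rfl⟩ := hS _ e ih (he ▸ hcon)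
      rw [h1, nbr_nbr, ← hξ] at he
      exact ξ.ne x he.symm
  refine TreeBoundary.ext fun v => ?_
  obtain ⟨m, n, hmn⟩ := TreeBoundary.exists_iterate_eq hT ξ v (c.nbr x b)
  refine TreeBoundary.apply_eq_of_iterate _ _ v m ?_
  rw [hmn]
  have h1 := TreeBoundary.smul_apply_apply g ξ (ξ^[n] (c.nbr x b))
  rw [hg _ (hray n)] at h1
  rw [h1]
  have h2 := hg _ (hray (n + 1))
  rwa [Function.iterate_succ_apply'] at h2

theorem mem_germSubgroup_of_fixes_halfTree {Γ : Subgroup (T ≃g T)} [Finite Ω]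
    (hΩ : 3 ≤ Nat.card Ω) (hT : T.IsTree) {g : T ≃g T} (hgΓ : g ∈ Γ) {x : V} {b : Ω}
    (hg : ∀ ξ : TreeBoundary T, ξ x = c.nbr x b → g • ξ = ξ) :
    (⟨g, hgΓ⟩ : Γ) ∈ germSubgroup Γ (TreeBoundary T) := by
  obtain ⟨e, he, -⟩ := exists_ne_ne_of_card hΩ b b
  obtain ⟨ξ, hξ, -⟩ := c.exists_end hT x he.symm
  exact Subgroup.subset_closure ⟨ξ, mem_interior.2
    ⟨{ξ | ξ x = c.nbr x b}, hg, TreeBoundary.isOpen_apply_eq _ _, hξ⟩⟩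

/-- Fixing an open set of ends forces an edge to be fixed. Conversely an element fixing an edge is a
product of two elements, each trivial on one of its half-trees. -/
theorem germSubgroup_eq [Finite Ω] (hΩ : 3 ≤ Nat.card Ω) (hT : T.IsTree) :
    germSubgroup (c.prescribedGroup F F') (TreeBoundary T) =
      c.edgeFixators (c.prescribedGroup F F') := by
  refine le_antisymm ((Subgroup.closure_le _).2 ?_) ((Subgroup.closure_le _).2 ?_)
  · rintro g ⟨ξ, hξ⟩
    obtain ⟨v, a, h⟩ := c.exists_fixes_edge hΩ hT (S := {g.1}) isOpen_interior hξ (by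
      rintro _ rfl η hη
      have h1 : η ∈ MulAction.fixedBy (TreeBoundary T) g := interior_subset hη
      exact h1)
    exact Subgroup.subset_closure ⟨v, a, h _ rfl⟩
  · rintro ⟨g, hg⟩ ⟨v, a, hv, hw⟩
    obtain ⟨g₁, hg₁, g₂, hg₂, S, rfl, hvS, hwS, hout, hin, h1, h2⟩ :=
      c.exists_mul_of_fixes_edge hT hg hv hw
    have hm₁ := c.mem_germSubgroup_of_fixes_halfTree hΩ hT hg₁
      (c.smul_eq_of_fixes_side hT (S := Sᶜ) (x := c.nbr v a) (b := a) (by simpa using hvS)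
        (fun z e hz hz' => by simpa using hin z e hz (not_not.1 hz')) h1)
    have hm₂ := c.mem_germSubgroup_of_fixes_halfTree hΩ hT hg₂
      (c.smul_eq_of_fixes_side hT hwS hout h2)
    exact mul_mem hm₁ hm₂

/-- An element of F' outside F is corrected by the element of F that agrees with it at a. -/
theorem exists_ne_one_of_ne (hFF' : F ≤ F')
    (horb : ∀ f ∈ F', ∀ a : Ω, f a ∈ MulAction.orbit F a) (hne : F ≠ F') [Nonempty Ω] :
    ∃ f ∈ F', f ≠ 1 ∧ ∃ a, f a = a := by
  obtain ⟨f, hf, hfF⟩ := SetLike.exists_of_lt (lt_of_le_of_ne hFF' hne)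
  obtain ⟨a⟩ := ‹Nonempty Ω›
  obtain ⟨k, hk⟩ := horb f hf a
  have hk' : (k : Equiv.Perm Ω) a = f a := hk
  refine ⟨(k : Equiv.Perm Ω)⁻¹ * f, F'.mul_mem (F'.inv_mem (hFF' k.2)) hf, fun h => hfF ?_, a, ?_⟩
  · rw [← inv_mul_eq_one.1 h]
    exact k.2
  · rw [Equiv.Perm.mul_apply, ← hk']
    exact Equiv.symm_apply_apply _ _

theorem exists_edgeFixators_smul_ne [Finite Ω] (hΩ : 3 ≤ Nat.card Ω) (hT : T.IsTree)
    (hFF' : F ≤ F') (horb : ∀ f ∈ F', ∀ a : Ω, f a ∈ MulAction.orbit F a) (hne : F ≠ F') :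
    ∃ n ∈ c.edgeFixators (c.prescribedGroup F F'), ∃ z : TreeBoundary T, n • z ≠ z := by
  have : Nonempty Ω := by
    rw [← Finite.card_pos_iff]; omega
  obtain ⟨f, hf, hf1, a, ha⟩ := exists_ne_one_of_ne hFF' horb hne
  obtain ⟨v⟩ := hT.connected.nonempty
  obtain ⟨g, hg, hgv, hgf⟩ := c.exists_localPerm_eq hT hFF' horb v hf
  obtain ⟨b, hb⟩ : ∃ b, f b ≠ b := by
    by_contra! h
    exact hf1 (Equiv.ext h)
  obtain ⟨e, he, -⟩ := exists_ne_ne_of_card hΩ b b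
  obtain ⟨ξ, hξ, -⟩ := c.exists_end hT v he.symm
  refine ⟨⟨g, hg⟩, Subgroup.subset_closure ⟨v, a, hgv, by rw [map_nbr, hgv, hgf, ha]⟩, ξ,
    fun h => hb ?_⟩
  have h1 := TreeBoundary.smul_apply_apply g ξ v
  have h2 : g • ξ = ξ := h
  rw [h2, hgv, hξ, map_nbr, hgv, hgf, nbr_inj] at h1
  exact h1.symm

end germs

end LegalColoring

/-! ### Quotients without invariant states -/

/-- In the free product of three groups of order two, `A i` consists of the reduced words starting
in the i-th factor. -/
theorem exists_three_involutions : ∃ (M : Type) (_ : Group M) (s : Fin 3 → M)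
    (A : Fin 3 → Set M), (∀ i, s i * s i = 1) ∧ (∀ i j x, x ∈ A i → x ∈ A j → i = j) ∧
      ∀ i x, x ∉ A i → s i * x ∈ A i := by
  classical
  let L : Fin 3 → Type := fun _ => Multiplicative (ZMod 2)
  let _ : ∀ i, Group (L i) := fun _ => inferInstanceAs (Group (Multiplicative (ZMod 2)))
  let _ : ∀ i, DecidableEq (L i) := fun _ => inferInstanceAs (DecidableEq (Multiplicative (ZMod 2)))
  let t : Multiplicative (ZMod 2) := Multiplicative.ofAdd 1
  have ht : t * t = 1 := by decide
  have ht1 : t ≠ 1 := by decide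
  refine ⟨Monoid.CoprodI L, inferInstance,
    fun i => Monoid.CoprodI.of (M := L) (i := i) t,
    fun i => {x | (Monoid.CoprodI.Word.equiv (M := L) x).fstIdx = some i}, fun i => ?_,
    fun i j x hi hj => ?_, fun i x hx => ?_⟩
  · rw [← map_mul, ht, map_one]
  · exact Option.some_injective _ (Eq.trans (Eq.symm hi) hj)
  · have h1 : Monoid.CoprodI.Word.equiv (M := L) (Monoid.CoprodI.of (M := L) (i := i) t * x) =
        Monoid.CoprodI.Word.cons (M := L) (i := i) t (Monoid.CoprodI.Word.equiv (M := L) x) hx ht1 := by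
      rw [← Equiv.eq_symm_apply]
      change _ = Monoid.CoprodI.Word.prod _
      rw [Monoid.CoprodI.Word.prod_cons]
      congr 1
      exact ((Monoid.CoprodI.Word.equiv (M := L)).symm_apply_apply x).symm
    change (Monoid.CoprodI.Word.equiv (M := L) (Monoid.CoprodI.of (M := L) (i := i) t * x)).fstIdx = some i
    rw [h1, Monoid.CoprodI.Word.fstIdx_cons]

/-- A state on the ultrafilters is a finitely additive mean. If it is invariant, each `A i` has mean
at least 1/2, as `s i` moves its complement into it, and three disjoint such sets do not fit. -/
theorem not_exists_invariant_state {G α : Type*} [Group G] [MulAction G α] (s : Fin 3 → G)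
    (A : Fin 3 → Set α) (hA : ∀ i j x, x ∈ A i → x ∈ A j → i = j)
    (hs : ∀ i x, x ∉ A i → s i • x ∈ A i) :
    letI := ultrafilterAction G α
    haveI := ultrafilterAction_continuous G α
    ¬ ∃ φ : C(Ultrafilter α, ℝ) → ℝ, IsState φ ∧ ∀ g : G, actState g φ = φ := by
  classical
  let _ := ultrafilterAction G α
  have := ultrafilterAction_continuous G α
  rintro ⟨φ, hφ, hinv⟩
  let χ : Fin 3 → C(Ultrafilter α, ℝ) := fun i =>
    ⟨fun p => if A i ∈ p then 1 else 0, by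
      refine continuous_const.if (fun p hp => ?_) continuous_const
      have hcl : IsClopen {p : Ultrafilter α | A i ∈ p} :=
        ⟨ultrafilter_isClosed_basic _, ultrafilter_isOpen_basic _⟩
      rw [hcl.frontier_eq] at hp
      exact hp.elim⟩
  have hχ : ∀ i p, χ i p = if A i ∈ p then 1 else 0 := fun _ _ => rfl
  have h1 : ∀ i, 1 ≤ 2 * φ (χ i) := fun i => by
    have h2 : φ ((χ i).comp ⟨fun x => s i • x, continuous_const_smul (s i)⟩) = φ (χ i) :=
      congrFun (hinv (s i)) (χ i)
    have h3 := hφ.mono (f := 1)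
      (g := χ i + (χ i).comp ⟨fun x => s i • x, continuous_const_smul (s i)⟩) fun p => by
        simp only [ContinuousMap.add_apply, ContinuousMap.comp_apply, ContinuousMap.coe_mk, hχ,
          ContinuousMap.one_apply]
        by_cases hp : A i ∈ p
        · rw [if_pos hp]
          split_ifs <;> norm_num
        · have h4 : A i ∈ s i • p := by
            change (fun x => s i • x) ⁻¹' A i ∈ p
            exact Filter.mem_of_superset (Ultrafilter.compl_mem_iff_notMem.2 hp) fun x hx => hs i x hx
          rw [if_neg hp, if_pos h4, zero_add]
    rw [hφ.one, hφ.add, h2] at h3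
    linarith
  have h5 := hφ.mono (f := ∑ i, χ i) (g := 1) fun p => by
    have hdisj : ∀ i j, A i ∈ p → A j ∈ p → i = j := fun i j hi hj => by
      obtain ⟨x, hxi, hxj⟩ := p.nonempty_of_mem (Filter.inter_mem hi hj)
      exact hA i j x hxi hxj
    simp only [ContinuousMap.coe_sum, Finset.sum_apply, hχ, ContinuousMap.one_apply,
      Finset.sum_boole]
    exact_mod_cast Finset.card_le_one.2 fun i hi j hj =>
      hdisj i j (Finset.mem_filter.1 hi).2 (Finset.mem_filter.1 hj).2
  rw [hφ.sum, hφ.one, Fin.sum_univ_three] at h5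
  linarith [h1 0, h1 1, h1 2]

section trivial

variable {G : Type u} [Group G] {W : Type u} [TopologicalSpace W] [MulAction G W]
  [ContinuousConstSMul G W] [CompactSpace W] [Nonempty W]

theorem not_isCoamenable_of_invariant_state {N : Subgroup G} (hN : ∀ n ∈ N, ∀ w : W, n • w = w)
    (h : ¬ ∃ φ : C(W, ℝ) → ℝ, IsState φ ∧ ∀ g : G, actState g φ = φ) : ¬ IsCoamenable N := by
  intro hco
  have hS : ∀ g : G, ∀ φ ∈ stateSpace W, actState g φ ∈ stateSpace W :=
    fun g φ hφ => IsState.act hφ g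
  let _ := invariantAction (G := G) (stateSpace W) hS
  obtain ⟨w⟩ := ‹Nonempty W›
  obtain ⟨φ, hφ⟩ := hco (C(W, ℝ) → ℝ) (stateSpace W) (convex_stateSpace W) (isCompact_stateSpace W)
    (invariantAction_continuous _ hS) (fun g x y z a b _ _ _ hz => by
      change actState g (z : C(W, ℝ) → ℝ) = _
      rw [hz]
      rfl) ⟨⟨evalState w, IsState.eval w⟩, fun n hn => Subtype.ext (by
        change actState n (evalState w) = _
        rw [actState_evalState, hN n hn])⟩
  exact h ⟨φ, φ.2, fun g => congrArg Subtype.val (hφ g)⟩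

/-- The boundary inside the state space of W inherits the trivial action of N; a one-point boundary
would be an invariant state. -/
theorem exists_boundary_of_invariant_state {N : Subgroup G} (hN : ∀ n ∈ N, ∀ w : W, n • w = w)
    (h : ¬ ∃ φ : C(W, ℝ) → ℝ, IsState φ ∧ ∀ g : G, actState g φ = φ) :
    ∃ (X : Type u) (_ : TopologicalSpace X) (_ : MulAction G X), IsBoundary G X ∧ Nontrivial X ∧
      ∀ n ∈ N, ∀ x : X, n • x = x := by
  obtain ⟨X, _, _, j, hX, -, hj, hjst, hjG⟩ := exists_boundary_stateSpace (G := G) (W := W)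
  refine ⟨X, inferInstance, inferInstance, hX, ?_, fun n hn x => hj ?_⟩
  · by_contra hn
    rw [not_nontrivial_iff_subsingleton] at hn
    obtain ⟨x⟩ := hX.nonempty
    exact h ⟨j x, hjst x, fun g => by rw [← hjG, Subsingleton.elim (g • x) x]⟩
  · rw [hjG]
    funext f
    simp only [actState]
    congr 1
    ext w
    simp [hN n hn w]

end trivial

/-- If three elements play ping-pong on `G ⧸ N`, then `N` is not co-amenable and acts trivially on
some non-trivial boundary. -/
theorem not_isCoamenable_of_pingPong {G : Type u} [Group G] {N : Subgroup G} [N.Normal]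
    (s : Fin 3 → G) (A : Fin 3 → Set (G ⧸ N)) (hA : ∀ i j x, x ∈ A i → x ∈ A j → i = j)
    (hs : ∀ i x, x ∉ A i → s i • x ∈ A i) :
    ¬ IsCoamenable N ∧ ∃ (X : Type u) (_ : TopologicalSpace X) (_ : MulAction G X),
      IsBoundary G X ∧ Nontrivial X ∧ ∀ n ∈ N, ∀ x : X, n • x = x := by
  let _ := ultrafilterAction G (G ⧸ N)
  have := ultrafilterAction_continuous G (G ⧸ N)
  have h := not_exists_invariant_state s A hA hs
  have hN : ∀ n ∈ N, ∀ w : Ultrafilter (G ⧸ N), n • w = w := by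
    intro n hn w
    have h1 : (fun x : G ⧸ N => n • x) = id := by
      funext x
      induction x using QuotientGroup.induction_on with
      | H g =>
        refine (QuotientGroup.eq.2 ?_).symm
        simpa [mul_assoc] using (‹N.Normal›.conj_mem n hn g⁻¹)
    change w.map (fun x => n • x) = w
    rw [h1]
    exact Ultrafilter.map_id w
  exact ⟨not_isCoamenable_of_invariant_state hN h, exists_boundary_of_invariant_state hN h⟩

/-! ### Orbits of the subgroup generated by point stabilizers -/

section pointStabilizers

variable {Ω : Type*} {F' : Subgroup (Equiv.Perm Ω)}

theorem pointStabilizersSubgroup_le : pointStabilizersSubgroup F' ≤ F' :=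
  iSup_le fun _ => inf_le_left

theorem mem_pointStabilizersSubgroup {f : Equiv.Perm Ω} (hf : f ∈ F') {a : Ω} (ha : f a = a) :
    f ∈ pointStabilizersSubgroup F' :=
  le_iSup (fun a : Ω => F' ⊓ MulAction.stabilizer (Equiv.Perm Ω) a) a ⟨hf, ha⟩

theorem conj_mem_pointStabilizersSubgroup {f s : Equiv.Perm Ω} (hf : f ∈ F')
    (hs : s ∈ pointStabilizersSubgroup F') : f * s * f⁻¹ ∈ pointStabilizersSubgroup F' := by
  have : pointStabilizersSubgroup F' ≤
      (pointStabilizersSubgroup F').comap (MulAut.conj f).toMonoidHom := by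
    refine iSup_le fun a s hs => ?_
    refine mem_pointStabilizersSubgroup (a := f a)
      (F'.mul_mem (F'.mul_mem hf hs.1) (F'.inv_mem hf)) ?_
    have h1 : s a = a := hs.2
    simp [h1]
  exact this hs

/-- The class of a point modulo the subgroup generated by point stabilizers. -/
def stabClass (F' : Subgroup (Equiv.Perm Ω)) (a : Ω) :
    MulAction.orbitRel.Quotient (pointStabilizersSubgroup F') Ω := Quotient.mk'' a

theorem stabClass_eq_iff {a b : Ω} :
    stabClass F' a = stabClass F' b ↔ ∃ s ∈ pointStabilizersSubgroup F', s b = a := by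
  rw [stabClass, stabClass, Quotient.eq'']
  constructor
  · rintro ⟨⟨s, hs⟩, h⟩
    exact ⟨s, hs, h⟩
  · rintro ⟨s, hs, h⟩
    exact ⟨⟨s, hs⟩, h⟩

theorem stabClass_apply {s : Equiv.Perm Ω} (hs : s ∈ pointStabilizersSubgroup F') (a : Ω) :
    stabClass F' (s a) = stabClass F' a :=
  stabClass_eq_iff.2 ⟨s, hs, rfl⟩

theorem stabClass_apply_congr {f : Equiv.Perm Ω} (hf : f ∈ F') {a b : Ω}
    (h : stabClass F' a = stabClass F' b) : stabClass F' (f a) = stabClass F' (f b) := by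
  obtain ⟨s, hs, rfl⟩ := stabClass_eq_iff.1 h
  refine stabClass_eq_iff.2 ⟨_, conj_mem_pointStabilizersSubgroup hf hs, ?_⟩
  simp

/-- Composing f with the inverse of an element of the subgroup taking a to f a yields a permutation
fixing a. So F' modulo the subgroup acts freely on the classes. -/
theorem mem_pointStabilizersSubgroup_of_stabClass {f : Equiv.Perm Ω} (hf : f ∈ F') {a : Ω}
    (h : stabClass F' (f a) = stabClass F' a) : f ∈ pointStabilizersSubgroup F' := by
  obtain ⟨s, hs, hsa⟩ := stabClass_eq_iff.1 h
  have h1 := mem_pointStabilizersSubgroup (f := s⁻¹ * f) (a := a)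
    (F'.mul_mem (F'.inv_mem (pointStabilizersSubgroup_le hs)) hf) (by
      rw [Equiv.Perm.mul_apply, ← hsa]
      exact Equiv.symm_apply_apply _ _)
  simpa using Subgroup.mul_mem _ hs h1

end pointStabilizers

/-! ### Recognizing C₂ and D_∞ -/

section groups

theorem nonempty_mulEquiv_zmod_two {Q : Type*} [Group Q] {s : Q} (hs : s * s = 1) (hs1 : s ≠ 1)
    (h : ∀ H : Subgroup Q, s ∈ H → H = ⊤) : Nonempty (Q ≃* Multiplicative (ZMod 2)) := by
  have h1 : Nat.card Q = 2 := by
    rw [← Subgroup.card_top, ← h _ (Subgroup.mem_zpowers s), Nat.card_zpowers]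
    exact orderOf_eq_prime (by rw [pow_two, hs]) hs1
  have : Fact (Nat.Prime 2) := ⟨Nat.prime_two⟩
  exact ⟨mulEquivOfPrimeCardEq (p := 2) h1 (by simp)⟩

theorem nonempty_mulEquiv_dihedralGroup {Q : Type*} [Group Q] {a b : Q} (ha : a * a = 1)
    (hb : b * b = 1) (hab : ∀ n : ℕ, 0 < n → (a * b) ^ n ≠ 1)
    (h : ∀ H : Subgroup Q, a ∈ H → b ∈ H → H = ⊤) : Nonempty (Q ≃* DihedralGroup 0) := by
  have hainv : a⁻¹ = a := inv_eq_of_mul_eq_one_left ha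
  have hbinv : b⁻¹ = b := inv_eq_of_mul_eq_one_left hb
  set x := a * b with hx
  have hax : a * x * a⁻¹ = x⁻¹ := by
    rw [hx, mul_inv_rev, hainv, hbinv, ← mul_assoc, ha, one_mul]
  have hconj : ∀ i : ℤ, x ^ i * a = a * x ^ (-i) := fun i => by
    have h1 : a * x ^ (-i) * a⁻¹ = x ^ i := by
      rw [← conj_zpow, hax, inv_zpow, zpow_neg, inv_inv]
    rw [← h1, inv_mul_cancel_right]
  have hpow : ∀ i : ℤ, x ^ i = 1 → i = 0 := fun i hi => by
    by_contra hne
    refine hab i.natAbs (Int.natAbs_pos.2 hne) ?_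
    rcases Int.natAbs_eq i with h1 | h1
    · rw [h1, zpow_natCast] at hi
      exact hi
    · rw [h1, zpow_neg, zpow_natCast, inv_eq_one] at hi
      exact hi
  let f : DihedralGroup 0 → Q := fun d => match d with
    | .r i => x ^ (show ℤ from i)
    | .sr i => a * x ^ (show ℤ from i)
  have hmul : ∀ d e, f (d * e) = f d * f e := by
    rintro (i | i) (j | j)
    · change x ^ ((show ℤ from i) + (show ℤ from j)) = x ^ (show ℤ from i) * x ^ (show ℤ from j)
      rw [zpow_add]
    · change a * x ^ ((show ℤ from j) - (show ℤ from i)) =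
        x ^ (show ℤ from i) * (a * x ^ (show ℤ from j))
      rw [← mul_assoc, hconj, mul_assoc, ← zpow_add, neg_add_eq_sub]
    · change a * x ^ ((show ℤ from i) + (show ℤ from j)) =
        a * x ^ (show ℤ from i) * x ^ (show ℤ from j)
      rw [zpow_add, mul_assoc]
    · change x ^ ((show ℤ from j) - (show ℤ from i)) =
        a * x ^ (show ℤ from i) * (a * x ^ (show ℤ from j))
      rw [mul_assoc, ← mul_assoc _ a, hconj, mul_assoc, ← mul_assoc, ha, one_mul, ← zpow_add,
        neg_add_eq_sub]
  let φ : DihedralGroup 0 →* Q := MonoidHom.mk' f hmul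
  have hinj : Function.Injective φ := by
    rw [injective_iff_map_eq_one]
    rintro (i | i) hi
    · have : i = 0 := hpow _ hi
      rw [this]; rfl
    -- A reflection in the kernel would make a a power of x. Then a commutes with x, so x = x⁻¹,
    -- against the infinite order of x.
    · obtain ⟨k, h1⟩ : ∃ k : ℤ, a = x ^ k := ⟨-(show ℤ from i), by
        rw [zpow_neg]
        exact eq_inv_of_mul_eq_one_left hi⟩
      have h2 : x = x⁻¹ := by
        rw [← hax, eq_mul_inv_iff_mul_eq, h1]
        exact ((Commute.refl x).zpow_right _).eq
      have h3 : x ^ 2 = 1 := by rw [pow_two, mul_eq_one_iff_eq_inv, ← h2]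
      exact absurd h3 (hab 2 two_pos)
  have hsurj : Function.Surjective φ := by
    rw [← MonoidHom.range_eq_top]
    refine h _ ⟨.sr 0, ?_⟩ ⟨.sr 1, ?_⟩
    · change a * x ^ (0 : ℤ) = a
      simp
    · change a * x ^ (1 : ℤ) = b
      rw [zpow_one, hx, ← mul_assoc, ha, one_mul]
  exact ⟨(MulEquiv.ofBijective φ ⟨hinj, hsurj⟩).symm⟩

end groups

/-! ### Flips in the quotient by the edge fixators -/

namespace LegalColoring

variable {V : Type u} {T : SimpleGraph V} {Ω : Type v} (c : LegalColoring T Ω)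
  {F F' : Subgroup (Equiv.Perm Ω)}

instance edgeFixators_normal (Γ : Subgroup (T ≃g T)) : (c.edgeFixators Γ).Normal := by
  refine ⟨fun n hn g => ?_⟩
  have : c.edgeFixators Γ ≤ (c.edgeFixators Γ).comap (MulAut.conj g).toMonoidHom := by
    refine (Subgroup.closure_le _).2 ?_
    rintro n ⟨v, a, hv, hw⟩
    refine Subgroup.subset_closure ⟨g.1 v, c.localPerm g.1 v a, ?_, ?_⟩
    · change g.1 (n.1 (g.1⁻¹ (g.1 v))) = _
      rw [RelIso.inv_apply_self, hv]
    · rw [← map_nbr]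
      change g.1 (n.1 (g.1⁻¹ (g.1 (c.nbr v a)))) = _
      rw [RelIso.inv_apply_self, hw]
  exact this hn

/-- Elements agreeing on one edge differ by an edge fixator; this is how identities between flips
are checked in the quotient. -/
theorem mk_eq_mk_of_edge {Γ : Subgroup (T ≃g T)} {g h : Γ} {v : V} {a : Ω} (hv : g.1 v = h.1 v)
    (hw : g.1 (c.nbr v a) = h.1 (c.nbr v a)) : (g : Γ ⧸ c.edgeFixators Γ) = h := by
  refine QuotientGroup.eq.2 (Subgroup.subset_closure ⟨v, a, ?_, ?_⟩)
  · change g.1⁻¹ (h.1 v) = v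
    rw [← hv, RelIso.inv_apply_self]
  · change g.1⁻¹ (h.1 _) = _
    rw [← hw, RelIso.inv_apply_self]

theorem localPerm_mem_pointStabilizersSubgroup (hT : T.IsTree) {g : T ≃g T}
    (hg : ∀ x, c.localPerm g x ∈ F') {v : V} (hv : c.localPerm g v ∈ pointStabilizersSubgroup F')
    (x : V) : c.localPerm g x ∈ pointStabilizersSubgroup F' := by
  induction x using c.nbr_induction hT (v₀ := v) with
  | h₀ => exact hv
  | h x a ih =>
    refine mem_pointStabilizersSubgroup_of_stabClass (hg _) (a := a) ?_
    rw [localPerm_nbr]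
    exact stabClass_apply ih a

/-- Local permutations at v of the elements of the edge-fixator group fixing v form a group R. It
contains every point stabilizer of F', since realizing a permutation that fixes a colour fixes the
edge of that colour. Hence g agrees with an element of the edge-fixator group around v. -/
theorem mk_eq_one_of_localPerm (hT : T.IsTree) (hFF' : F ≤ F')
    (horb : ∀ f ∈ F', ∀ a : Ω, f a ∈ MulAction.orbit F a) [Nonempty Ω]
    {g : c.prescribedGroup F F'} {v : V} (hgv : g.1 v = v)
    (hg : c.localPerm g.1 v ∈ pointStabilizersSubgroup F') :
    (g : c.prescribedGroup F F' ⧸ c.edgeFixators (c.prescribedGroup F F')) = 1 := by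
  let R : Subgroup (Equiv.Perm Ω) :=
    { carrier := {f | ∃ h ∈ c.edgeFixators (c.prescribedGroup F F'), h.1 v = v ∧
        c.localPerm h.1 v = f}
      one_mem' := ⟨1, one_mem _, rfl, c.localPerm_one v⟩
      mul_mem' := by
        rintro _ _ ⟨h, hh, hv, rfl⟩ ⟨k, hk, kv, rfl⟩
        refine ⟨h * k, mul_mem hh hk, (congrArg h.1 kv).trans hv, ?_⟩
        change c.localPerm (h.1 * k.1) v = _
        rw [localPerm_mul, kv]
      inv_mem' := by
        rintro _ ⟨h, hh, hv, rfl⟩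
        have hv' : h.1⁻¹ v = v := by conv_lhs => rw [← hv, RelIso.inv_apply_self]
        refine ⟨h⁻¹, inv_mem hh, hv', ?_⟩
        change c.localPerm h.1⁻¹ v = _
        rw [localPerm_inv, hv'] }
  have hR : pointStabilizersSubgroup F' ≤ R := by
    refine iSup_le ?_
    rintro a f ⟨hf, hfa⟩
    obtain ⟨h, hh, hv, rfl⟩ := c.exists_localPerm_eq hT hFF' horb v hf
    have hfa' : c.localPerm h v a = a := hfa
    exact ⟨⟨h, hh⟩, Subgroup.subset_closure ⟨v, a, hv, by rw [map_nbr, hv, hfa']⟩, hv, rfl⟩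
  obtain ⟨h, hh, hv, hl⟩ := hR hg
  obtain ⟨a⟩ := ‹Nonempty Ω›
  rw [← (QuotientGroup.eq_one_iff h).2 hh]
  exact c.mk_eq_mk_of_edge (v := v) (a := a) (hgv.trans hv.symm) (by
    rw [map_nbr, map_nbr, hgv, hv, hl])

/-- For each colour there is a colour preserving automorphism inverting the edge of that colour
at `v`. -/
theorem exists_flips (hT : T.IsTree) (v : V) : ∃ u : Ω → c.prescribedGroup F F',
    (∀ a, (u a).1 v = c.nbr v a) ∧ ∀ a x, c.localPerm (u a).1 x = 1 := by
  choose u hu hu1 using fun a => c.exists_aut_one hT v (c.nbr v a)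
  exact ⟨fun a => ⟨u a, c.mem_prescribedGroup_of_one (hu1 a)⟩, hu, hu1⟩

section flips

variable {v : V} {u : Ω → c.prescribedGroup F F'} (hu : ∀ a, (u a).1 v = c.nbr v a)
  (hu1 : ∀ a x, c.localPerm (u a).1 x = 1)

include hu hu1

theorem flip_apply_nbr (a : Ω) : (u a).1 (c.nbr v a) = v := by
  rw [map_nbr, hu, hu1, Equiv.Perm.one_apply, nbr_nbr]

theorem mk_flip_mul_self (a : Ω) :
    (u a : c.prescribedGroup F F' ⧸ c.edgeFixators (c.prescribedGroup F F')) * u a = 1 := by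
  rw [← QuotientGroup.mk_mul, ← QuotientGroup.mk_one]
  refine c.mk_eq_mk_of_edge (v := v) (a := a) ?_ ?_
  · change (u a).1 ((u a).1 v) = v
    rw [hu, c.flip_apply_nbr hu hu1]
  · change (u a).1 ((u a).1 (c.nbr v a)) = c.nbr v a
    rw [c.flip_apply_nbr hu hu1, hu]

theorem mk_conj_flip {g : c.prescribedGroup F F'} (hg : g.1 v = v) (a : Ω) :
    (g : c.prescribedGroup F F' ⧸ c.edgeFixators (c.prescribedGroup F F')) * u a * (g⁻¹ :) =
      u (c.localPerm g.1 v a) := by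
  have hginv : g.1⁻¹ v = v := by conv_lhs => rw [← hg, RelIso.inv_apply_self]
  have hgn : g.1 (c.nbr v a) = c.nbr v (c.localPerm g.1 v a) := by rw [map_nbr, hg]
  rw [← QuotientGroup.mk_mul, ← QuotientGroup.mk_mul]
  refine c.mk_eq_mk_of_edge (v := v) (a := c.localPerm g.1 v a) ?_ ?_
  · change g.1 ((u a).1 (g.1⁻¹ v)) = _
    rw [hginv, hu, hu, hgn]
  · change g.1 ((u a).1 (g.1⁻¹ _)) = _
    rw [← hgn, RelIso.inv_apply_self, c.flip_apply_nbr hu hu1, hgn, c.flip_apply_nbr hu hu1, hg]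

/-- An element with local permutation s at v conjugates the flip of b to that of s b, and is itself
trivial in the quotient. -/
theorem mk_flip_eq (hT : T.IsTree) (hFF' : F ≤ F')
    (horb : ∀ f ∈ F', ∀ a : Ω, f a ∈ MulAction.orbit F a) {a b : Ω}
    (h : stabClass F' a = stabClass F' b) :
    (u a : c.prescribedGroup F F' ⧸ c.edgeFixators (c.prescribedGroup F F')) = u b := by
  have : Nonempty Ω := ⟨a⟩
  obtain ⟨s, hs, rfl⟩ := stabClass_eq_iff.1 h
  obtain ⟨g, hg, hgv, rfl⟩ :=
    c.exists_localPerm_eq hT hFF' horb v (pointStabilizersSubgroup_le hs)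
  have h1 := c.mk_eq_one_of_localPerm hT hFF' horb (g := ⟨g, hg⟩) hgv hs
  have h2 := c.mk_conj_flip hu hu1 (g := ⟨g, hg⟩) hgv b
  rw [QuotientGroup.mk_inv, h1, one_mul, inv_one, mul_one] at h2
  exact h2.symm

/-- Flips together with the stabilizer of a vertex generate. -/
theorem eq_top_of_flips_mem (hT : T.IsTree)
    {H : Subgroup (c.prescribedGroup F F' ⧸ c.edgeFixators (c.prescribedGroup F F'))}
    (hH : ∀ a, (u a : c.prescribedGroup F F' ⧸ c.edgeFixators (c.prescribedGroup F F')) ∈ H)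
    (hv : ∀ g : c.prescribedGroup F F', g.1 v = v →
      (g : c.prescribedGroup F F' ⧸ c.edgeFixators (c.prescribedGroup F F')) ∈ H) : H = ⊤ := by
  have key : ∀ w, ∃ h : c.prescribedGroup F F', h.1 v = w ∧ (∀ x, c.localPerm h.1 x = 1) ∧
      (h : c.prescribedGroup F F' ⧸ c.edgeFixators (c.prescribedGroup F F')) ∈ H := by
    intro w
    induction w using c.nbr_induction hT (v₀ := v) with
    | h₀ => exact ⟨1, rfl, c.localPerm_one, H.one_mem⟩
    | h w a ih =>
      obtain ⟨h, rfl, h1, hH'⟩ := ih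
      refine ⟨h * u a, ?_, fun x => ?_, H.mul_mem hH' (hH a)⟩
      · change h.1 ((u a).1 v) = _
        rw [hu, map_nbr, h1]
        rfl
      · change c.localPerm (h.1 * (u a).1) x = 1
        rw [localPerm_mul, h1, hu1, one_mul]
  rw [Subgroup.eq_top_iff']
  intro x
  induction x using QuotientGroup.induction_on with
  | H g =>
    obtain ⟨h, hh, -, hH'⟩ := key (g.1 v)
    have h1 := hv (h⁻¹ * g) (by
      change h.1⁻¹ (g.1 v) = v
      rw [← hh, RelIso.inv_apply_self])
    rw [← mul_inv_cancel_left h g]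
    exact H.mul_mem hH' h1

end flips

/-! ### Vertex labellings that detect elements of the quotient -/

section cocycle

variable {M : Type*} [Group M] {m : Ω → M} {p : V → M} {v : V}

/-- The label of a vertex is the product of the m-values of the colours along the path from v;
involutions make backtracking harmless. -/
theorem exists_cocycle (hT : T.IsTree) (hm : ∀ a, m a * m a = 1) (v : V) :
    ∃ p : V → M, p v = 1 ∧ ∀ x a, p (c.nbr x a) = p x * m a :=
  c.exists_dev hT (fun _ a x => x * m a) (fun _ a x => by rw [mul_assoc, hm, mul_one]) v 1

theorem cocycle_apply (hT : T.IsTree) (hp1 : p v = 1) (hp : ∀ x a, p (c.nbr x a) = p x * m a)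
    {g : T ≃g T} (hg : ∀ x a, m (c.localPerm g x a) = m a) (x : V) : p (g x) = p (g v) * p x := by
  induction x using c.nbr_induction hT (v₀ := v) with
  | h₀ => rw [hp1, mul_one]
  | h x a ih => rw [map_nbr, hp, ih, hg, hp, mul_assoc]

/-- A generator fixes some vertex y and its local permutations preserve classes, so it acts on
labels by a left multiplication fixing the label of y, that is, trivially. -/
theorem cocycle_edgeFixators (hT : T.IsTree) (hp1 : p v = 1)
    (hp : ∀ x a, p (c.nbr x a) = p x * m a)
    (hm : ∀ a b, stabClass F' a = stabClass F' b → m a = m b) {n : c.prescribedGroup F F'}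
    (hn : n ∈ c.edgeFixators (c.prescribedGroup F F')) (x : V) : p (n.1 x) = p x := by
  induction hn using Subgroup.closure_induction generalizing x with
  | mem n hn =>
    obtain ⟨y, a, hy, hya⟩ := hn
    have h1 : c.localPerm n.1 y ∈ pointStabilizersSubgroup F' :=
      mem_pointStabilizersSubgroup (n.2.1 y) (a := a)
        (c.localPerm_eq_of_map_nbr (by rw [hya, hy]))
    have h2 := c.cocycle_apply hT hp1 hp (g := n.1) fun x a => hm _ _
      (stabClass_apply (c.localPerm_mem_pointStabilizersSubgroup hT n.2.1 h1 x) a)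
    have h3 : p (n.1 v) = 1 := by
      have h4 := h2 y
      rw [hy] at h4
      exact right_eq_mul.1 h4
    rw [h2, h3, one_mul]
  | one => rfl
  | mul g h _ _ ihg ihh => exact (ihg _).trans (ihh _)
  | inv g _ ih =>
    have h1 := ih (g.1⁻¹ x)
    rw [RelIso.apply_inv_self] at h1
    exact h1.symm

end cocycle

end LegalColoring

/-! ### The quotient for at most two classes and for at least three -/

namespace LegalColoring

variable {V : Type u} {T : SimpleGraph V} {Ω : Type v} (c : LegalColoring T Ω)
  {F F' : Subgroup (Equiv.Perm Ω)}

/-- The labelling is the bipartition of the tree, which edge fixators preserve and g does not. -/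
theorem mk_flip_ne_one (hT : T.IsTree) {v : V} {a : Ω} {g : c.prescribedGroup F F'}
    (hg : g.1 v = c.nbr v a) :
    (g : c.prescribedGroup F F' ⧸ c.edgeFixators (c.prescribedGroup F F')) ≠ 1 := by
  intro h
  obtain ⟨p, hp1, hp⟩ := c.exists_cocycle hT (m := fun _ => Multiplicative.ofAdd (1 : ZMod 2))
    (fun _ => by decide) v
  have h1 := c.cocycle_edgeFixators hT hp1 hp (F' := F') (fun _ _ _ => rfl)
    ((QuotientGroup.eq_one_iff g).1 h) v
  rw [hg, hp, hp1, one_mul] at h1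
  exact absurd h1 (by decide)

/-- Labelling the class of a by one reflection of D_∞ and all others by another, the k-th power of
the product moves v to label `r k`. -/
theorem mk_flip_mul_pow_ne_one (hT : T.IsTree) {v : V} {u : Ω → c.prescribedGroup F F'}
    (hu : ∀ a, (u a).1 v = c.nbr v a) (hu1 : ∀ a x, c.localPerm (u a).1 x = 1) {a b : Ω}
    (hab : stabClass F' a ≠ stabClass F' b) (n : ℕ) (hn : 0 < n) :
    ((u a : c.prescribedGroup F F' ⧸ c.edgeFixators (c.prescribedGroup F F')) * u b) ^ n ≠ 1 := by
  classical
  intro h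
  let m : Ω → DihedralGroup 0 := fun e => if stabClass F' e = stabClass F' a then .sr 0 else .sr 1
  have hma : m a = .sr 0 := if_pos rfl
  have hmb : m b = .sr 1 := if_neg hab.symm
  obtain ⟨p, hp1, hp⟩ := c.exists_cocycle hT (m := m) (fun e => by
    change (if _ then _ else _) * (if _ then _ else _) = _
    split_ifs <;> simp) v
  have hpow : ∀ k : ℕ, p (((u a * u b) ^ k : c.prescribedGroup F F').1 v) = .r (k : ZMod 0) := by
    intro k
    induction k with
    | zero => exact hp1
    | succ k ih =>
      rw [pow_succ', mul_assoc]
      change p ((u a).1 ((u b).1 (((u a * u b) ^ k : c.prescribedGroup F F').1 v))) = _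
      rw [c.cocycle_apply hT hp1 hp (fun x e => by rw [hu1]; rfl),
        c.cocycle_apply hT hp1 hp (g := (u b).1) (fun x e => by rw [hu1]; rfl), ih, hu, hu, hp, hp,
        hp1, hma, hmb, one_mul, one_mul, ← mul_assoc, DihedralGroup.sr_mul_sr,
        DihedralGroup.r_mul_r, sub_zero, Nat.cast_succ, add_comm]
  have h1 := c.cocycle_edgeFixators hT hp1 hp (F' := F') (n := (u a * u b) ^ n)
    (fun x y hxy => by simp only [m, hxy]) ((QuotientGroup.eq_one_iff _).1 h) v
  rw [hpow, hp1, DihedralGroup.one_def, DihedralGroup.r.injEq] at h1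
  have h2 : (n : ℤ) = 0 := h1
  omega

theorem nonempty_mulEquiv_of_card_le_two [Finite Ω] [Nonempty Ω] (hT : T.IsTree) (hFF' : F ≤ F')
    (horb : ∀ f ∈ F', ∀ a : Ω, f a ∈ MulAction.orbit F a)
    (hcard : Nat.card (MulAction.orbitRel.Quotient (pointStabilizersSubgroup F') Ω) ≤ 2) :
    Nonempty (c.prescribedGroup F F' ⧸ c.edgeFixators (c.prescribedGroup F F') ≃*
      Multiplicative (ZMod 2)) ∨
    Nonempty (c.prescribedGroup F F' ⧸ c.edgeFixators (c.prescribedGroup F F') ≃*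
      DihedralGroup 0) := by
  obtain ⟨v⟩ := hT.connected.nonempty
  obtain ⟨u, hu, hu1⟩ := c.exists_flips (F := F) (F' := F') hT v
  have hflip := @mk_flip_eq _ _ _ c F F' v u hu hu1 hT hFF' horb
  obtain ⟨a⟩ := ‹Nonempty Ω›
  have : Nonempty Ω := ⟨a⟩
  by_cases hone : ∀ b, stabClass F' b = stabClass F' a
  · refine Or.inl (nonempty_mulEquiv_zmod_two (c.mk_flip_mul_self hu hu1 a)
      (c.mk_flip_ne_one hT (hu a)) fun H hH => c.eq_top_of_flips_mem hu hu1 hT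
        (fun b => hflip (hone b) ▸ hH) fun g hg => ?_)
    rw [c.mk_eq_one_of_localPerm hT hFF' horb hg
      (mem_pointStabilizersSubgroup_of_stabClass (g.2.1 v) (hone (c.localPerm g.1 v a)))]
    exact H.one_mem
  right
  obtain ⟨b, hb⟩ := not_forall.1 hone
  have htwo : ∀ e, stabClass F' e ≠ stabClass F' a → stabClass F' e = stabClass F' b := by
    intro e he
    by_contra heb
    have := Fintype.ofFinite (MulAction.orbitRel.Quotient (pointStabilizersSubgroup F') Ω)
    rw [Nat.card_eq_fintype_card] at hcard
    exact absurd (Fintype.two_lt_card_iff.2 ⟨_, _, _, he, heb, Ne.symm hb⟩) (not_lt.2 hcard)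
  have hpow := c.mk_flip_mul_pow_ne_one hT hu hu1 (Ne.symm hb)
  have hflips : ∀ H : Subgroup (c.prescribedGroup F F' ⧸ c.edgeFixators (c.prescribedGroup F F')),
      (u a : c.prescribedGroup F F' ⧸ c.edgeFixators (c.prescribedGroup F F')) ∈ H →
      (u b : c.prescribedGroup F F' ⧸ c.edgeFixators (c.prescribedGroup F F')) ∈ H → ∀ e,
      (u e : c.prescribedGroup F F' ⧸ c.edgeFixators (c.prescribedGroup F F')) ∈ H := by
    intro H ha hb' e
    by_cases he : stabClass F' e = stabClass F' a
    · exact hflip he ▸ ha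
    · exact hflip (htwo e he) ▸ hb'
  by_cases hswap : ∀ f ∈ F', stabClass F' (f a) = stabClass F' a
  · refine nonempty_mulEquiv_dihedralGroup (c.mk_flip_mul_self hu hu1 a)
      (c.mk_flip_mul_self hu hu1 b) hpow fun H ha hb' => c.eq_top_of_flips_mem hu hu1 hT
        (hflips H ha hb') fun g hg => ?_
    rw [c.mk_eq_one_of_localPerm hT hFF' horb hg
      (mem_pointStabilizersSubgroup_of_stabClass (g.2.1 v) (hswap _ (g.2.1 v)))]
    exact H.one_mem
  · push Not at hswap
    obtain ⟨f, hf, hfa⟩ := hswap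
    obtain ⟨g, hg, hgv, rfl⟩ := c.exists_localPerm_eq hT hFF' horb v hf
    -- When F' exchanges the two classes, τ is an involution in the quotient conjugating u a to u b.
    -- Then (u a τ)² = u a u b, so u a τ has infinite order, and u a and τ generate a copy of D_∞.
    set τ : c.prescribedGroup F F' := ⟨g, hg⟩ with hτ
    have hback : ∀ e, stabClass F' e ≠ stabClass F' a →
        stabClass F' ((c.localPerm g v)⁻¹ e) = stabClass F' a := by
      intro e he
      have h1 := stabClass_apply_congr (F'.inv_mem hf) ((htwo e he).trans (htwo _ hfa).symm)
      rw [h1]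
      congr 1
      exact Equiv.symm_apply_apply _ _
    have hττ : (τ : c.prescribedGroup F F' ⧸ c.edgeFixators (c.prescribedGroup F F')) * τ = 1 := by
      rw [← QuotientGroup.mk_mul]
      refine c.mk_eq_one_of_localPerm hT hFF' horb (v := v) ((congrArg g hgv).trans hgv) ?_
      change c.localPerm (g * g) v ∈ _
      rw [localPerm_mul, hgv]
      refine mem_pointStabilizersSubgroup_of_stabClass (F'.mul_mem hf hf) (a := a) ?_
      by_contra hcon
      refine hfa ?_
      have h1 := hback _ hcon
      rw [← h1]
      congr 1
      exact (Equiv.symm_apply_apply _ _).symm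
    have hconj : (τ : c.prescribedGroup F F' ⧸ c.edgeFixators (c.prescribedGroup F F')) * u a * τ =
        u b := by
      rw [← hflip (htwo _ hfa), ← c.mk_conj_flip hu hu1 (g := τ) hgv a, QuotientGroup.mk_inv,
        inv_eq_of_mul_eq_one_left hττ]
    refine nonempty_mulEquiv_dihedralGroup (c.mk_flip_mul_self hu hu1 a) hττ
      (fun n hn h => hpow n hn ?_) fun H ha hτH => c.eq_top_of_flips_mem hu hu1 hT
        (hflips H ha (hconj ▸ H.mul_mem (H.mul_mem hτH ha) hτH)) fun h hh => ?_
    · rw [← hconj, ← mul_assoc, ← mul_assoc, mul_assoc (_ * _), ← pow_two, ← pow_mul, mul_comm,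
        pow_mul, h, one_pow]
    · by_cases hha : stabClass F' (c.localPerm h.1 v a) = stabClass F' a
      · rw [c.mk_eq_one_of_localPerm hT hFF' horb hh
          (mem_pointStabilizersSubgroup_of_stabClass (h.2.1 v) hha)]
        exact H.one_mem
      · have hginv : g⁻¹ v = v := by conv_lhs => rw [← hgv, RelIso.inv_apply_self]
        have h1 : ((τ⁻¹ * h : c.prescribedGroup F F') :
            c.prescribedGroup F F' ⧸ c.edgeFixators (c.prescribedGroup F F')) = 1 := by
          refine c.mk_eq_one_of_localPerm hT hFF' horb (v := v) ?_ ?_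
          · change g⁻¹ (h.1 v) = v
            rw [hh, hginv]
          · change c.localPerm (g⁻¹ * h.1) v ∈ _
            rw [localPerm_mul, localPerm_inv, hh, hginv]
            exact mem_pointStabilizersSubgroup_of_stabClass
              (F'.mul_mem (F'.inv_mem hf) (h.2.1 v)) (hback _ hha)
        rw [QuotientGroup.mk_mul, QuotientGroup.mk_inv, inv_mul_eq_one] at h1
        exact h1 ▸ hτH

theorem not_isCoamenable_of_two_lt_card [Finite Ω] (hT : T.IsTree)
    (hcard : 2 < Nat.card (MulAction.orbitRel.Quotient (pointStabilizersSubgroup F') Ω)) :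
    ¬ IsCoamenable (c.edgeFixators (c.prescribedGroup F F')) ∧
      ∃ (X : Type u) (_ : TopologicalSpace X) (_ : MulAction (c.prescribedGroup F F') X),
        IsBoundary (c.prescribedGroup F F') X ∧ Nontrivial X ∧
          ∀ n ∈ c.edgeFixators (c.prescribedGroup F F'), ∀ x : X, n • x = x := by
  classical
  obtain ⟨v⟩ := hT.connected.nonempty
  obtain ⟨u, hu, hu1⟩ := c.exists_flips (F := F) (F' := F') hT v
  obtain ⟨e⟩ : Nonempty (Fin 3 ↪ MulAction.orbitRel.Quotient (pointStabilizersSubgroup F') Ω) := by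
    have := Fintype.ofFinite (MulAction.orbitRel.Quotient (pointStabilizersSubgroup F') Ω)
    rw [Nat.card_eq_fintype_card] at hcard
    exact Function.Embedding.nonempty_of_card_le (by rw [Fintype.card_fin]; exact hcard)
  obtain ⟨M, _, s, A, hs, hA, hping⟩ := exists_three_involutions
  -- Three chosen classes are labelled by the involutions, all remaining classes by 1.
  let m : Ω → M := fun a => Function.extend e s (fun _ => 1) (stabClass F' a)
  obtain ⟨p, hp1, hp⟩ := c.exists_cocycle hT (m := m) (fun a => by
    by_cases h : ∃ i, e i = stabClass F' a
    · obtain ⟨i, hi⟩ := h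
      simp only [m, ← hi, e.injective.extend_apply, hs]
    · simp only [m, Function.extend_apply' _ _ _ h, mul_one]) v
  -- By normality g n is an edge-fixator element times g, so the label of g v descends to the
  -- quotient, where the ping-pong sets are pulled back.
  have hpN : ∀ g n : c.prescribedGroup F F', n ∈ c.edgeFixators (c.prescribedGroup F F') →
      p ((g * n).1 v) = p (g.1 v) := fun g n hn => by
    have h1 := c.cocycle_edgeFixators hT hp1 hp (F' := F')
      (fun a b hab => by simp only [m, hab])
      ((c.edgeFixators_normal (c.prescribedGroup F F')).conj_mem n hn g) (g.1 v)
    rw [← h1]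
    change _ = p ((g * n * g⁻¹ * g).1 v)
    rw [inv_mul_cancel_right]
  choose r hr using fun i => Quotient.exists_rep (e i)
  have hmr : ∀ i, m (r i) = s i := fun i => by
    have h1 : stabClass F' (r i) = e i := hr i
    simp only [m, h1, e.injective.extend_apply]
  let q : c.prescribedGroup F F' ⧸ c.edgeFixators (c.prescribedGroup F F') → M :=
    fun x => p (x.out.1 v)
  have hq : ∀ g : c.prescribedGroup F F', q g = p (g.1 v) := fun g => by
    obtain ⟨n, hn⟩ := QuotientGroup.mk_out_eq_mul (c.edgeFixators (c.prescribedGroup F F')) g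
    change p ((Quotient.out (g : c.prescribedGroup F F' ⧸ c.edgeFixators _)).1 v) = _
    rw [hn, hpN g n n.2]
  refine not_isCoamenable_of_pingPong (fun i => u (r i)) (fun i => q ⁻¹' A i)
    (fun i j x => hA i j (q x)) fun i x hx => ?_
  induction x using QuotientGroup.induction_on with
  | H g =>
    have h1 : q (u (r i) • (g : c.prescribedGroup F F' ⧸ c.edgeFixators _)) = s i * q g := by
      change q ((u (r i) * g : c.prescribedGroup F F') :) = _
      rw [hq, hq]
      change p ((u (r i)).1 (g.1 v)) = _
      rw [c.cocycle_apply hT hp1 hp (fun x a => by rw [hu1]; rfl), hu, hp, hp1, one_mul, hmr]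
    rw [Set.mem_preimage, h1]
    exact hping i _ hx

end LegalColoring

/-! ### Equivalence of the five conditions -/

theorem theorem5p8 {V : Type u} {Ω : Type v} [Finite Ω] (hΩ : 3 ≤ Nat.card Ω)
    (T : SimpleGraph V) (hT : T.IsTree) (c : LegalColoring T Ω)
    (F F' : Subgroup (Equiv.Perm Ω)) (hFF' : F ≤ F')
    (horb : ∀ f ∈ F', ∀ a : Ω, f a ∈ MulAction.orbit F a)
    (hF : IsSemiregularPermGroup F) (hne : F ≠ F')
    (Γ : Subgroup (T ≃g T)) (hΓ : Γ = c.prescribedGroup F F') :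
    List.TFAE [
      Nat.card (MulAction.orbitRel.Quotient (pointStabilizersSubgroup F') Ω) ≤ 2,
      Nonempty (Γ ⧸ envelope (furstenbergURS Γ) ≃* Multiplicative (ZMod 2)) ∨
        Nonempty (Γ ⧸ envelope (furstenbergURS Γ) ≃* DihedralGroup 0) ∨
        ∃ φ : Multiplicative (ZMod 2) →* MulAut (DihedralGroup 0),
          Nonempty (Γ ⧸ envelope (furstenbergURS Γ) ≃*
            DihedralGroup 0 ⋊[φ] Multiplicative (ZMod 2)),
      IsCoamenable (envelope (furstenbergURS Γ)),
      ∀ (X : Type u) [TopologicalSpace X] [MulAction Γ X],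
        IsBoundary Γ X → Nontrivial X → stabilizerURS Γ X = furstenbergURS Γ,
      IsBoundaryIndivisible Γ] := by
  subst hΓ
  have : Nonempty Ω := by
    rw [← Finite.card_pos_iff]; omega
  have := c.countable_prescribedGroup hT hF (F' := F')
  have := c.infinite_treeBoundary hΩ hT
  have := TreeBoundary.compactSpace c.neighborSet_finite
  have hEP : IsExtremelyProximal (c.prescribedGroup F F') (TreeBoundary T) :=
    c.isExtremelyProximal hT fun _ => c.mem_prescribedGroup_of_one
  have hAm : HasAmenableGerms (c.prescribedGroup F F') (TreeBoundary T) :=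
    c.hasAmenableGerms_prescribedGroup hΩ hT hF
  have hnt := c.exists_edgeFixators_smul_ne hΩ hT hFF' horb hne
  have hgerm := c.germSubgroup_eq (F := F) (F' := F') hΩ hT
  have hURS := furstenbergURS_eq hEP hAm (hgerm ▸ hnt)
  have henv : envelope (furstenbergURS (c.prescribedGroup F F')) =
      c.edgeFixators (c.prescribedGroup F F') := by
    rw [hURS, envelope_stabilizerURS, hgerm]
  have hcoam : ∀ {H : Type} [Group H], IsIteratedCyclic (⊤ : Subgroup H) →
      Nonempty (c.prescribedGroup F F' ⧸ envelope (furstenbergURS (c.prescribedGroup F F')) ≃* H) →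
      IsCoamenable (envelope (furstenbergURS (c.prescribedGroup F F'))) := by
    rintro H _ hH ⟨e⟩
    have h1 := hH.isCoamenable (e.toMonoidHom.comp (QuotientGroup.mk' _))
      (e.surjective.comp (QuotientGroup.mk'_surjective _))
    have h2 : (e.toMonoidHom.comp (QuotientGroup.mk' _)).ker =
        envelope (furstenbergURS (c.prescribedGroup F F')) := by
      ext g
      rw [MonoidHom.mem_ker]
      change e (g : _ ⧸ _) = 1 ↔ _
      rw [e.map_eq_one_iff, QuotientGroup.eq_one_iff]
    rwa [h2] at h1
  -- The semidirect product alternative is not needed here, since exchanged classes also lead to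
  -- D_∞.
  tfae_have 1 → 2 := by
    intro h
    rcases c.nonempty_mulEquiv_of_card_le_two hT hFF' horb h with ⟨⟨e⟩⟩ | ⟨⟨e⟩⟩
    · exact Or.inl ⟨(QuotientGroup.quotientMulEquivOfEq henv).trans e⟩
    · exact Or.inr (Or.inl ⟨(QuotientGroup.quotientMulEquivOfEq henv).trans e⟩)
  tfae_have 2 → 3 := by
    rintro (h | h | ⟨φ, h⟩)
    · exact hcoam (isIteratedCyclic_of_isCyclic _) h
    · exact hcoam isIteratedCyclic_dihedralGroup h
    · exact hcoam (isIteratedCyclic_semidirectProduct isIteratedCyclic_dihedralGroup φ) h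
  tfae_have 3 → 4 := by
    intro h X _ _ hX hX'
    rw [henv, ← hgerm] at h
    rw [hURS]
    exact stabilizerURS_eq hEP hAm hX (h.exists_smul_ne hX hX')
  tfae_have 3 → 5 := by
    intro h
    rw [henv, ← hgerm] at h
    exact isBoundaryIndivisible_of_germSubgroup hEP hAm fun X _ _ hX hX' => h.exists_smul_ne hX hX'
  tfae_have 4 → 1 := by
    intro h
    by_contra hcon
    obtain ⟨-, X, _, _, hX, hX', hXN⟩ := c.not_isCoamenable_of_two_lt_card hT (F := F) (not_le.1 hcon)
    have := hEP.isMinimal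
    exact stabilizerURS_ne_of_trivial hnt hXN ((h X hX hX').trans hURS)
  tfae_have 5 → 1 := by
    intro h
    by_contra hcon
    obtain ⟨-, X, _, _, hX, hX', hXN⟩ := c.not_isCoamenable_of_two_lt_card hT (F := F) (not_le.1 hcon)
    have := hX.t2
    exact h X (TreeBoundary T) hX hX' hEP.isBoundary inferInstance
      (areDisjointSpaces_of_trivial hEP hnt hXN)
  tfae_finish
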